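/- Let $k$ be a field, let $(z_0:z_1:z_2)$ be the homogeneous coordinates on $\mathbb P^2_k$, and put $U_i=\{z_i\neq 0\}$, $H_0=\{z_0=0\}$, $x=z_1/z_0$, $y=z_2/z_0$. Let $\mathcal I\subset\mathcal O_{\mathbb P^2_k}$ be the ideal sheaf of $H_0$. The formal completion $\widehat{(\mathbb P^2_k)}_{H_0}$ of $\mathbb P^2_k$ along $H_0$ is the topological space $H_0$ with the sheaf of rings $\widehat{\mathcal O}=\varprojlim_n\mathcal O_{\mathbb P^2_k}/\mathcal I^n$. The punctured formal neighborhood $\widehat{(\mathbb P^2_k)}_{H_0}-H_0$ is the space $H_0$ with the sheaf of rings $\widehat{\mathcal O}(*H_0)$ obtained from $\widehat{\mathcal O}$ by inverting the local equations of $H_0$ (the sheafified localization of $\widehat{\mathcal O}$ at the functions induced by local functions on $\mathbb P^2_k$ without zeros outside $H_0$). For a ringed space, $\operatorname{Pic}$ denotes the group, under tensor product, of isomorphism classes of sheaves of modules that are locally free of rank one over the structure sheaf. Let $$G=1+x^{-1}y^{-1}k[[x^{-1},y^{-1}]]\subset \bigl(k[[x^{-1},y^{-1}]]\bigr)^{\times}$$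 be the multiplicative group of formal power series of this form. Then: 1. There is an isomorphism of groups $\operatorname{Pic}\bigl(\widehat{(\mathbb P^2_k)}_{H_0}\bigr)\cong\mathbb Z\times G$. It is the natural one: $(n,g)$ corresponds to the class of the line bundle which is glued from the trivial line bundles on $U_1\cap H_0$ and $U_2\cap H_0$ by the transition function $(x/y)^n g\in\widehat{\mathcal O}(U_1\cap U_2\cap H_0)^\times$. 2. There is an isomorphism of groups $\operatorname{Pic}\bigl(\widehat{(\mathbb P^2_k)}_{H_0}-H_0\bigr)\cong G$, under which $g$ corresponds to the class of the line bundle which is glued from the trivial line bundles on $U_1\cap H_0$ and $U_2\cap H_0$ by the transition function $g$. -/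

import Mathlib

universe u

noncomputable section

section

open CategoryTheory Opposite TopologicalSpace AlgebraicGeometry

namespace SheafPic

open MonoidalCategory

/-! ### Invertible modules on a ringed space `(X, O)` and the Picard group -/

variable {X : TopCat.{u}} (O : TopCat.Sheaf CommRingCat.{u} X)

/-- `O` as a sheaf of (not necessarily commutative) rings. -/
abbrev ringSheaf : Sheaf (Opens.grothendieckTopology X) RingCat.{u} :=
  ⟨O.presheaf ⋙ forget₂ CommRingCat RingCat, ((sheafCompose (Opens.grothendieckTopology X) (forget₂ CommRingCat.{u} RingCat.{u})).obj O).property⟩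

/-- Presheaves of `O`-modules. -/
abbrev PreMod := PresheafOfModules.{u} (O.presheaf ⋙ forget₂ CommRingCat RingCat)
/-- Sheaves of `O`-modules. -/
abbrev Mod := SheafOfModules.{u} (ringSheaf O)

variable {O}
/-- Sections of `M` over `U`. -/
abbrev Sec (M : PreMod O) (U : Opens X) : Type u := M.obj (op U)

/-- Restriction of sections. -/
def res (M : PreMod O) {U V : Opens X} (h : V ≤ U) (s : Sec M U) : Sec M V :=
  M.map (homOfLE h).op s

/-- The ring `O(U)`. -/
abbrev fn (O : TopCat.Sheaf CommRingCat.{u} X) (U : Opens X) : Type u := O.presheaf.obj (op U)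

/-- Restriction of functions. -/
def fnRes (O : TopCat.Sheaf CommRingCat.{u} X) {U V : Opens X} (h : V ≤ U) : fn O U →+* fn O V :=
  (O.presheaf.map (homOfLE h).op).hom

instance (M : PreMod O) (U : Opens X) : Module (fn O U) (Sec M U) :=
  inferInstanceAs (Module ((O.presheaf ⋙ forget₂ CommRingCat RingCat).obj (op U)) (M.obj (op U)))

lemma res_smul (M : PreMod O) {U V : Opens X} (h : V ≤ U) (a : fn O U) (s : Sec M U) :
    res M h (a • s) = fnRes O h a • res M h s :=
  PresheafOfModules.map_smul M _ _ _

lemma res_res (M : PreMod O) {U V W : Opens X} (h : V ≤ U) (h' : W ≤ V) (s : Sec M U) :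
    res M h' (res M h s) = res M (h'.trans h) s :=
  (PresheafOfModules.map_comp_apply M (homOfLE h).op (homOfLE h').op s).symm

lemma res_self (M : PreMod O) {U : Opens X} (s : Sec M U) : res M le_rfl s = s := by
  have := M.map_id (op U)
  exact ConcreteCategory.congr_hom this s

lemma fnRes_fnRes {U V W : Opens X} (h : V ≤ U) (h' : W ≤ V) (s : fn O U) :
    fnRes O h' (fnRes O h s) = fnRes O (h'.trans h) s :=
  (ConcreteCategory.congr_hom (O.presheaf.map_comp (homOfLE h).op (homOfLE h').op) s).symm

/-- The action on sections of a morphism. -/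
def app {P Q : PreMod O} (φ : P ⟶ Q) (U : Opens X) : Sec P U →ₗ[fn O U] Sec Q U :=
  (φ.app (op U)).hom

lemma app_res {P Q : PreMod O} (φ : P ⟶ Q) {U V : Opens X} (h : V ≤ U) (s : Sec P U) :
    app φ V (res P h s) = res Q h (app φ U s) :=
  PresheafOfModules.naturality_apply φ _ s

/-- `s ∈ M(U)` is a frame: `a ↦ a • s` is an isomorphism of `O|_U` with `M|_U`. -/
def IsFrame (M : PreMod O) (U : Opens X) (s : Sec M U) : Prop :=
  ∀ (V : Opens X) (h : V ≤ U), Function.Bijective fun a : fn O V => a • res M h s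

/-- The sheafification functor on `O`-modules. -/
def sheafify : PreMod O ⥤ Mod O :=
  PresheafOfModules.sheafification (R := ringSheaf O) (𝟙 (ringSheaf O).obj)

/-- The canonical morphism to the sheafification. -/
def eta (P : PreMod O) : P ⟶ ((sheafify.obj P).val : PreMod O) :=
  PresheafOfModules.homMk
    (CategoryTheory.toSheafify (Opens.grothendieckTopology X) P.presheaf : P.presheaf ⟶ ((sheafify.obj P).val : PreMod O).presheaf)
    (fun U r m => (((PresheafOfModules.sheafificationAdjunction (R := ringSheaf O)
      (𝟙 (ringSheaf O).obj)).unit.app P).app U).hom.map_smul r m)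

instance (P : PreMod O) : Presheaf.IsLocallyInjective (Opens.grothendieckTopology X)
    ((PresheafOfModules.toPresheaf _).map (eta P)) :=
  inferInstanceAs (Presheaf.IsLocallyInjective _
    (CategoryTheory.toSheafify (Opens.grothendieckTopology X) P.presheaf))

instance (P : PreMod O) : Presheaf.IsLocallySurjective (Opens.grothendieckTopology X)
    ((PresheafOfModules.toPresheaf _).map (eta P)) :=
  inferInstanceAs (Presheaf.IsLocallySurjective _
    (CategoryTheory.toSheafify (Opens.grothendieckTopology X) P.presheaf))


lemma eq_of_locally_eq (M : Mod O) {U : Opens X} (a b : Sec M.val U)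
    (h : ∀ x ∈ U, ∃ (V : Opens X) (hV : V ≤ U), x ∈ V ∧ res M.val hV a = res M.val hV b) :
    a = b := by
  choose V hV hx hab using fun x : U => h x.1 x.2
  refine TopCat.Sheaf.eq_of_locally_eq' (X := X) (⟨M.val.presheaf, M.isSheaf⟩ : TopCat.Sheaf Ab X)
    V U (fun x => homOfLE (hV x)) (fun x hx' => Opens.mem_iSup.2 ⟨⟨x, hx'⟩, hx _⟩) a b ?_
  exact fun x => hab x

lemma isIso_sheafify_map {P Q : PreMod O} (φ : P ⟶ Q)
    (h : ∀ x : X, ∃ U : Opens X, x ∈ U ∧ ∀ V ≤ U, Function.Bijective (app φ V)) :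
    IsIso (sheafify.map φ) := by
  have : (MorphismProperty.isomorphisms _).inverseImage
      (PresheafOfModules.sheafification (R := ringSheaf O) (𝟙 (ringSheaf O).obj)) φ := by
    rw [← PresheafOfModules.inverseImage_W_toPresheaf_eq_inverseImage_isomorphisms]
    change (Opens.grothendieckTopology X).W _
    rw [GrothendieckTopology.W_iff_isLocallyBijective]
    constructor
    · constructor
      intro U a b hab x hx
      obtain ⟨V, hxV, hV⟩ := h x
      refine ⟨V ⊓ U.unop, homOfLE inf_le_right, ?_, hxV, hx⟩
      apply (hV (V ⊓ U.unop) inf_le_left).1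
      have := congrArg (res Q (inf_le_right : V ⊓ U.unop ≤ U.unop)) hab
      exact (app_res φ _ a).trans (Eq.trans this (app_res φ _ b).symm)
    · constructor
      intro U b x hx
      obtain ⟨V, hxV, hV⟩ := h x
      obtain ⟨a, ha⟩ := (hV (V ⊓ U) inf_le_left).2 (res Q (inf_le_right : V ⊓ U ≤ U) b)
      exact ⟨V ⊓ U, homOfLE inf_le_right, ⟨a, ha⟩, hxV, hx⟩
  exact this

lemma IsFrame.res {M : PreMod O} {U V : Opens X} {s : Sec M U} (hs : IsFrame M U s)
    (h : V ≤ U) : IsFrame M V (res M h s) := by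
  intro W j
  rw [res_res]
  exact hs W (j.trans h)

lemma IsFrame.app_bijective {P Q : PreMod O} (φ : P ⟶ Q) {U : Opens X} {s : Sec P U}
    (hs : IsFrame P U s) (ht : IsFrame Q U (app φ U s)) (V : Opens X) (h : V ≤ U) :
    Function.Bijective (app φ V) := by
  have h2 := ht V h
  rw [← Function.Bijective.of_comp_iff _ (hs V h)]
  convert h2 using 2 with a
  simp [app_res]

lemma IsFrame.map_of_bijective {P Q : PreMod O} (φ : P ⟶ Q) {U : Opens X} {s : Sec P U}
    (hs : IsFrame P U s) (h : ∀ V ≤ U, Function.Bijective (app φ V)) :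
    IsFrame Q U (app φ U s) := by
  intro V i
  convert (h V i).comp (hs V i) using 2 with a
  simp [app_res]

/-- `O` as a module over itself. -/
abbrev unitMod (O : TopCat.Sheaf CommRingCat.{u} X) : Mod O := SheafOfModules.unit (ringSheaf O)

lemma isFrame_one (U : Opens X) :
    IsFrame (unitMod O).val U (1 : fn O U) := by
  intro V h
  change Function.Bijective (fun a : fn O V => a * fnRes O h 1)
  simp only [map_one, mul_one]
  exact Function.bijective_id

/-- The section `s ⊗ t` of the presheaf tensor product. -/
def tmul {P Q : PreMod O} {U : Opens X} (s : Sec P U) (t : Sec Q U) : Sec (P ⊗ Q : PreMod O) U :=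
  TensorProduct.tmul (fn O U) s t

lemma res_tmul {P Q : PreMod O} {U V : Opens X} (h : V ≤ U) (s : Sec P U) (t : Sec Q U) :
    res (P ⊗ Q) h (tmul s t) = tmul (res P h s) (res Q h t) := rfl

lemma IsFrame.tmul {P Q : PreMod O} {U : Opens X} {s : Sec P U} {t : Sec Q U}
    (hs : IsFrame P U s) (ht : IsFrame Q U t) : IsFrame (P ⊗ Q) U (tmul s t) := by
  intro V h
  let e₁ : fn O V ≃ₗ[fn O V] Sec P V :=
    .ofBijective (LinearMap.toSpanSingleton (fn O V) _ (SheafPic.res P h s)) (hs V h)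
  let e₂ : fn O V ≃ₗ[fn O V] Sec Q V :=
    .ofBijective (LinearMap.toSpanSingleton (fn O V) _ (SheafPic.res Q h t)) (ht V h)
  have key : ∀ a : fn O V, a • SheafPic.tmul (SheafPic.res P h s) (SheafPic.res Q h t) =
      ((TensorProduct.lid (fn O V) (fn O V)).symm.trans (TensorProduct.congr e₁ e₂)) a := by
    intro a
    have h₁ : e₁ 1 = SheafPic.res P h s := one_smul _ _
    have h₂ : e₂ a = a • SheafPic.res Q h t := rfl
    change a • TensorProduct.tmul (fn O V) _ _ = _
    rw [LinearEquiv.trans_apply, TensorProduct.lid_symm_apply, TensorProduct.congr_tmul, h₁, h₂,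
      TensorProduct.tmul_smul]
  have : (fun a : fn O V => a • SheafPic.res (P ⊗ Q) h (SheafPic.tmul s t)) =
      ⇑((TensorProduct.lid (fn O V) (fn O V)).symm.trans (TensorProduct.congr e₁ e₂)) :=
    funext key
  rw [this]
  exact LinearEquiv.bijective _

lemma IsFrame.sheafify {P : PreMod O} {U : Opens X} {s : Sec P U} (hs : IsFrame P U s) :
    IsFrame (SheafPic.sheafify.obj P).val U (app (eta P) U s) := by
  have inj : ∀ V ≤ U, Function.Injective (app (eta P) V) := by
    intro V hV a b hab
    obtain ⟨a, rfl⟩ := (hs V hV).2 a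
    obtain ⟨b, rfl⟩ := (hs V hV).2 b
    have := Presheaf.equalizerSieve_mem (Opens.grothendieckTopology X)
      ((PresheafOfModules.toPresheaf _).map (eta P)) (X := op V) _ _ hab
    congr 1
    choose W f hW hx using fun x : V => this x.1 x.2
    refine TopCat.Sheaf.eq_of_locally_eq' O W V f
      (fun x hx' => Opens.mem_iSup.2 ⟨⟨x, hx'⟩, hx _⟩) a b fun x => ?_
    have h1 : SheafPic.res P (f x).le (a • SheafPic.res P hV s) =
      SheafPic.res P (f x).le (b • SheafPic.res P hV s) := hW x
    rw [res_smul, res_smul, res_res] at h1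
    exact (hs _ _).1 h1
  apply hs.map_of_bijective
  intro V hV
  refine ⟨inj V hV, ?_⟩
  intro y
  have := Presheaf.imageSieve_mem (Opens.grothendieckTopology X)
    ((PresheafOfModules.toPresheaf _).map (eta P)) (U := op V) y
  choose W f hW hx using fun x : V => this x.1 x.2
  replace hW : ∀ x, ∃ p : Sec P (W x), app (eta P) _ p = SheafPic.res _ (f x).le y := hW
  choose p hp using hW
  choose a ha using fun x => (hs (W x) ((f x).le.trans hV)).2 (p x)
  have hcov : V ≤ iSup W := fun x hx' => Opens.mem_iSup.2 ⟨⟨x, hx'⟩, hx _⟩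
  obtain ⟨c, hc, -⟩ := TopCat.Sheaf.existsUnique_gluing' O W V f hcov a (by
    intro x x'
    have hle : W x ⊓ W x' ≤ U := inf_le_left.trans ((f x).le.trans hV)
    refine (hs (W x ⊓ W x') hle).1 (inj _ hle ?_)
    have e : ∀ (z : V) (h : W x ⊓ W x' ≤ W z),
        app (eta P) _ (fnRes O h (a z) • SheafPic.res P hle s) =
          SheafPic.res _ (h.trans (f z).le) y := by
      intro z h
      rw [← res_res _ (f z).le h, ← hp, ← app_res, ← ha]
      dsimp only
      rw [res_smul, res_res]
    exact (e x inf_le_left).trans (e x' inf_le_right).symm)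
  refine ⟨c • SheafPic.res P hV s, ?_⟩
  apply eq_of_locally_eq
  intro x hx'
  refine ⟨W ⟨x, hx'⟩, (f _).le, hx ⟨x, hx'⟩, ?_⟩
  have h2 : fnRes O (f ⟨x, hx'⟩).le c = a ⟨x, hx'⟩ := hc ⟨x, hx'⟩
  rw [← app_res, res_smul, res_res, ← hp, h2]
  exact congrArg _ (ha ⟨x, hx'⟩)

/-- Locally free of rank one: every point has an open neighbourhood on which `M` is
isomorphic to `O`. -/
def IsInvertible (M : PreMod O) : Prop :=
  ∀ x : X, ∃ U : Opens X, x ∈ U ∧ ∃ s : Sec M U, IsFrame M U s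

/-- The tensor product of sheaves of `O`-modules: the sheafification of
`U ↦ L(U) ⊗_{O(U)} M(U)`. -/
def tensor (L M : Mod O) : Mod O := sheafify.obj (L.val ⊗ M.val : PreMod O)

lemma IsInvertible.tmul {P Q : PreMod O} (hP : IsInvertible P) (hQ : IsInvertible Q) :
    IsInvertible (P ⊗ Q) := by
  intro x
  obtain ⟨U, hU, s, hs⟩ := hP x
  obtain ⟨V, hV, t, ht⟩ := hQ x
  exact ⟨U ⊓ V, ⟨hU, hV⟩, _, (hs.res inf_le_left).tmul (ht.res inf_le_right)⟩

lemma IsInvertible.sheafify {P : PreMod O} (hP : IsInvertible P) :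
    IsInvertible (SheafPic.sheafify.obj P).val := by
  intro x
  obtain ⟨U, hU, s, hs⟩ := hP x
  exact ⟨U, hU, _, hs.sheafify⟩

lemma isInvertible_unit : IsInvertible (unitMod O).val :=
  fun _ => ⟨⊤, trivial, _, isFrame_one ⊤⟩

/-- A sheaf of modules is its own sheafification. -/
def sheafifyIso (M : Mod O) : sheafify.obj (M.val : PreMod O) ≅ M :=
  (asIso (PresheafOfModules.sheafificationAdjunction (R := ringSheaf O)
      (𝟙 (ringSheaf O).obj)).counit).app M

lemma isIso_whiskerRight {P Q : PreMod O} (hP : IsInvertible P) (hQ : IsInvertible Q) :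
    IsIso (sheafify.map (eta P ▷ Q)) := by
  apply isIso_sheafify_map
  intro x
  obtain ⟨U, hU, s, hs⟩ := hP x
  obtain ⟨V, hV, t, ht⟩ := hQ x
  have h := (hs.res (inf_le_left : U ⊓ V ≤ U))
  have h' := (ht.res (inf_le_right : U ⊓ V ≤ V))
  exact ⟨U ⊓ V, ⟨hU, hV⟩, (h.tmul h').app_bijective (eta P ▷ Q) (h.sheafify.tmul h')⟩

lemma isIso_whiskerLeft {P Q : PreMod O} (hP : IsInvertible P) (hQ : IsInvertible Q) :
    IsIso (sheafify.map (P ◁ eta Q)) := by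
  apply isIso_sheafify_map
  intro x
  obtain ⟨U, hU, s, hs⟩ := hP x
  obtain ⟨V, hV, t, ht⟩ := hQ x
  have h := (hs.res (inf_le_left : U ⊓ V ≤ U))
  have h' := (ht.res (inf_le_right : U ⊓ V ≤ V))
  exact ⟨U ⊓ V, ⟨hU, hV⟩, (h.tmul h').app_bijective (P ◁ eta Q) (h.tmul h'.sheafify)⟩

lemma tensor_assoc {L M N : Mod O} (hL : IsInvertible L.val) (hM : IsInvertible M.val)
    (hN : IsInvertible N.val) :
    Nonempty (tensor (tensor L M) N ≅ tensor L (tensor M N)) := by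
  have := isIso_whiskerRight (hL.tmul hM) hN
  exact ⟨(asIso (sheafify.map (eta (L.val ⊗ M.val : PreMod O) ▷ (N.val : PreMod O)))).symm ≪≫
    sheafify.mapIso (α_ (L.val : PreMod O) M.val N.val) ≪≫
    @asIso _ _ _ _ _ (isIso_whiskerLeft hL (hM.tmul hN))⟩

/-- The tensor product respects isomorphisms. -/
def tensorCongr {L L' M M' : Mod O} (e : L ≅ L') (e' : M ≅ M') : tensor L M ≅ tensor L' M' :=
  sheafify.mapIso (((SheafOfModules.forget _).mapIso e : (L.val : PreMod O) ≅ L'.val) ⊗ᵢ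
    ((SheafOfModules.forget _).mapIso e' : (M.val : PreMod O) ≅ M'.val))

/-- Commutativity of the tensor product. -/
def tensorComm (L M : Mod O) : tensor L M ≅ tensor M L :=
  sheafify.mapIso (BraidedCategory.braiding (L.val : PreMod O) M.val)

/-- `O` is a unit for the tensor product. -/
def unitTensor (L : Mod O) : tensor (unitMod O) L ≅ L :=
  sheafify.mapIso (λ_ (L.val : PreMod O)) ≪≫ sheafifyIso L

/-- `O(W)`-linear maps `P(W) → O(W)`, for `W ≤ V`; `O(V)` acts through restriction. -/
def LocalHom (P : PreMod O) (V : Opens X) (W : {W : Opens X // W ≤ V}) : Type u :=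
  Sec P W.1 →ₗ[fn O W.1] fn O W.1

instance (P : PreMod O) (V : Opens X) (W : {W : Opens X // W ≤ V}) :
    AddCommGroup (LocalHom P V W) :=
  inferInstanceAs (AddCommGroup (Sec P W.1 →ₗ[fn O W.1] fn O W.1))

instance (P : PreMod O) (V : Opens X) (W : {W : Opens X // W ≤ V}) :
    Module (fn O V) (LocalHom P V W) :=
  Module.compHom (Sec P W.1 →ₗ[fn O W.1] fn O W.1) (fnRes O W.2)

/-- The underlying linear map. -/
def LocalHom.lin {P : PreMod O} {V : Opens X} {W : {W : Opens X // W ≤ V}} (φ : LocalHom P V W) :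
    Sec P W.1 →ₗ[fn O W.1] fn O W.1 := φ

/-- The `O(V)`-module of morphisms `P|_V ⟶ O|_V`. -/
def dualSec (P : PreMod O) (V : Opens X) : Submodule (fn O V) (∀ W, LocalHom P V W) where
  carrier := {φ | ∀ (W : {W : Opens X // W ≤ V}) (W' : Opens X) (h : W' ≤ W.1) (s : Sec P W.1),
    (φ ⟨W', h.trans W.2⟩).lin (res P h s) = fnRes O h ((φ W).lin s)}
  add_mem' {φ ψ} hφ hψ W W' h s :=
    (congrArg₂ (· + ·) (hφ W W' h s) (hψ W W' h s)).trans (map_add (fnRes O h) _ _).symm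
  zero_mem' W W' h s := (map_zero (fnRes O h)).symm
  smul_mem' a φ hφ W W' h s := by
    refine (congrArg (fnRes O (h.trans W.2) a * ·) (hφ W W' h s)).trans ?_
    rw [← fnRes_fnRes W.2 h]
    exact (map_mul (fnRes O h) _ _).symm

/-- Restriction of morphisms `P|_U ⟶ O|_U` to a smaller open subset. -/
def dualRes (P : PreMod O) {U V : Opens X} (h : V ≤ U) :
    dualSec P U →ₛₗ[fnRes O h] dualSec P V where
  toFun φ := ⟨fun W => φ.1 ⟨W.1, W.2.trans h⟩, fun W W' h' s => φ.2 ⟨W.1, W.2.trans h⟩ W' h' s⟩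
  map_add' _ _ := rfl
  map_smul' a φ := by
    apply Subtype.ext
    funext W
    change fnRes O (W.2.trans h) a • (φ.1 ⟨W.1, W.2.trans h⟩).lin =
      fnRes O W.2 (fnRes O h a) • (φ.1 ⟨W.1, W.2.trans h⟩).lin
    rw [fnRes_fnRes]

/-- The dual presheaf of modules `V ↦ Hom(P|_V, O|_V)`. -/
def dual (P : PreMod O) : PreMod O where
  obj V := ModuleCat.of (fn O V.unop) (dualSec P V.unop)
  map {U V} i := ModuleCat.ofHom
    (X := ModuleCat.of (fn O U.unop) (dualSec P U.unop))
    (Y := (ModuleCat.restrictScalars (fnRes O i.unop.le)).obj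
      (ModuleCat.of (fn O V.unop) (dualSec P V.unop)))
    { toFun := dualRes P i.unop.le
      map_add' := map_add (dualRes P i.unop.le)
      map_smul' := (dualRes P i.unop.le).map_smul' }
  map_id _ := rfl
  map_comp _ _ := rfl

lemma fnRes_self {V : Opens X} (a : fn O V) : fnRes O (le_refl V) a = a :=
  ConcreteCategory.congr_hom (O.presheaf.map_id (op V)) a

/-- The evaluation pairing on sections. -/
def evalMap (P : PreMod O) (V : Opens X) : dualSec P V →ₗ[fn O V] Sec P V →ₗ[fn O V] fn O V where
  toFun φ := (φ.1 ⟨V, le_rfl⟩).lin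
  map_add' _ _ := rfl
  map_smul' a φ := by
    change fnRes O (le_refl V) a • (φ.1 ⟨V, le_rfl⟩).lin = a • (φ.1 ⟨V, le_rfl⟩).lin
    rw [fnRes_self]

/-- The evaluation morphism from `dual P ⊗ P` to `O`. -/
def evaluation (P : PreMod O) : dual P ⊗ P ⟶ ((unitMod O).val : PreMod O) where
  app V := ModuleCat.ofHom (TensorProduct.lift (evalMap P V.unop))
  naturality {U V} i := ModuleCat.MonoidalCategory.tensor_ext (fun φ s =>
    φ.2 ⟨U.unop, le_rfl⟩ V.unop i.unop.le s)

lemma evaluation_app (P : PreMod O) {V : Opens X} (φ : dualSec P V) (s : Sec P V) :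
    app (evaluation P) V (tmul (P := dual P) φ s) = evalMap P V φ s := rfl

lemma IsFrame.exists_dual {P : PreMod O} {U : Opens X} {s : Sec P U} (hs : IsFrame P U s) :
    ∃ φ : Sec (dual P) U, IsFrame (dual P) U φ ∧ app (evaluation P) U (SheafPic.tmul φ s) = (1 : fn O U) := by
  let e : ∀ W (h : W ≤ U), fn O W ≃ₗ[fn O W] Sec P W := fun W h =>
    .ofBijective (LinearMap.toSpanSingleton (fn O W) _ (SheafPic.res P h s)) (hs W h)
  have he : ∀ W h a, e W h a = a • SheafPic.res P h s := fun _ _ _ => rfl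
  let φ₀ : ∀ W, LocalHom P U W := fun W => (e W.1 W.2).symm.toLinearMap
  have hφ : φ₀ ∈ dualSec P U := by
    intro W W' h t
    obtain ⟨a, rfl⟩ := (e W.1 W.2).surjective t
    change (e W' (h.trans W.2)).symm _ = fnRes O h ((e W.1 W.2).symm _)
    rw [LinearEquiv.symm_apply_apply, LinearEquiv.symm_apply_eq, he, he, res_smul, res_res]
  refine ⟨(⟨φ₀, hφ⟩ : dualSec P U), ?_, ?_⟩
  · intro V hV
    have key : ∀ (b : fn O V) (W : {W : Opens X // W ≤ V}),
        (((b • SheafPic.res (dual P) hV (⟨φ₀, hφ⟩ : dualSec P U) : Sec (dual P) V) : dualSec P V).1 W).lin =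
          fnRes O W.2 b • (e W.1 (W.2.trans hV)).symm.toLinearMap := fun _ _ => rfl
    constructor
    · intro b b' hbb
      have h1 := key b ⟨V, le_rfl⟩
      have h2 := key b' ⟨V, le_rfl⟩
      have h3 := h1.symm.trans ((congrArg (fun ψ : dualSec P V => (ψ.1 ⟨V, le_rfl⟩).lin) hbb).trans h2)
      have h4 := LinearMap.congr_fun h3 (e V hV 1)
      simpa [fnRes_self] using h4
    · intro ψ
      change dualSec P V at ψ
      refine ⟨(ψ.1 ⟨V, le_rfl⟩).lin (e V hV 1), ?_⟩
      refine Subtype.ext (funext fun W => ?_)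
      refine (key _ W).trans ?_
      ext t
      obtain ⟨a, rfl⟩ := (e W.1 (W.2.trans hV)).surjective t
      have h1 := ψ.2 ⟨V, le_rfl⟩ W.1 W.2 (e V hV 1)
      have h2 : (ψ.1 W).lin (e W.1 (W.2.trans hV) a) =
          a • (ψ.1 W).lin (SheafPic.res P (W.2.trans hV) s) := map_smul _ _ _
      have h3 : SheafPic.res P W.2 (e V hV 1) = SheafPic.res P (W.2.trans hV) s := by
        rw [he, one_smul, res_res]
      rw [h3] at h1
      rw [LinearMap.smul_apply, ← h1, LinearEquiv.coe_coe, LinearEquiv.symm_apply_apply]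
      exact (mul_comm _ _).trans h2.symm
  · refine (evaluation_app P (⟨φ₀, hφ⟩ : dualSec P U) s).trans ?_
    change (e U le_rfl).symm s = 1
    rw [LinearEquiv.symm_apply_eq, he, one_smul]
    exact (res_self P s).symm

lemma IsInvertible.dual {P : PreMod O} (hP : IsInvertible P) : IsInvertible (SheafPic.dual P) := by
  intro x
  obtain ⟨U, hU, s, hs⟩ := hP x
  obtain ⟨φ, hφ, -⟩ := hs.exists_dual
  exact ⟨U, hU, φ, hφ⟩

lemma tensor_dual {L : Mod O} (hL : IsInvertible L.val) :
    Nonempty (tensor (sheafify.obj (dual L.val)) L ≅ unitMod O) := by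
  have h1 := isIso_whiskerRight hL.dual hL
  have h2 : IsIso (sheafify.map (evaluation (L.val : PreMod O))) := by
    apply isIso_sheafify_map
    intro x
    obtain ⟨U, hU, s, hs⟩ := hL x
    obtain ⟨φ, hφ, h⟩ := hs.exists_dual
    refine ⟨U, hU, (hφ.tmul hs).app_bijective _ ?_⟩
    rw [h]
    exact isFrame_one U
  exact ⟨(@asIso _ _ _ _ _ h1).symm ≪≫ @asIso _ _ _ _ _ h2 ≪≫ sheafifyIso (unitMod O)⟩

variable (O) in
/-- Invertible `O`-modules (line bundles): sheaves of `O`-modules locally free of rank one. -/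
def LineBundle : Type (u + 1) := {M : Mod O // IsInvertible M.val}

instance lineBundleSetoid : Setoid (LineBundle O) where
  r L M := Nonempty (L.1 ≅ M.1)
  iseqv := ⟨fun _ => ⟨Iso.refl _⟩, fun ⟨e⟩ => ⟨e.symm⟩, fun ⟨e⟩ ⟨f⟩ => ⟨e ≪≫ f⟩⟩

variable (O) in
/-- The Picard group of the ringed space `(X, O)`: isomorphism classes of invertible
`O`-modules. -/
def Pic : Type (u + 1) := Quotient (lineBundleSetoid (O := O))

/-- The class of a line bundle. -/
def Pic.mk (L : LineBundle O) : Pic O := Quotient.mk _ L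

/-- The tensor product of line bundles. -/
def LineBundle.tensor (L M : LineBundle O) : LineBundle O :=
  ⟨SheafPic.tensor L.1 M.1, (L.2.tmul M.2).sheafify⟩

/-- The dual line bundle. -/
def LineBundle.dual (L : LineBundle O) : LineBundle O :=
  ⟨SheafPic.sheafify.obj (SheafPic.dual L.1.val), L.2.dual.sheafify⟩

/-- The group law is the tensor product; every class has an inverse by `tensor_dual`. -/
instance : CommGroup (Pic O) :=
  letI : Mul (Pic O) := ⟨Quotient.map₂ LineBundle.tensor
    fun _ _ ⟨e⟩ _ _ ⟨f⟩ => ⟨tensorCongr e f⟩⟩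
  letI : One (Pic O) := ⟨Pic.mk ⟨unitMod O, isInvertible_unit⟩⟩
  have hinv : ∀ a : Pic O, ∃ b : Pic O, b * a = 1 := by
    rintro ⟨L⟩
    exact ⟨Pic.mk L.dual, Quotient.sound (tensor_dual L.2)⟩
  letI : Inv (Pic O) := ⟨fun a => (hinv a).choose⟩
  have hcomm : ∀ a b : Pic O, a * b = b * a := by
    rintro ⟨L⟩ ⟨M⟩
    exact Quotient.sound ⟨tensorComm L.1 M.1⟩
  have hone : ∀ a : Pic O, 1 * a = a := by
    rintro ⟨L⟩
    exact Quotient.sound ⟨unitTensor L.1⟩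
  { mul_assoc := by
      rintro ⟨L⟩ ⟨M⟩ ⟨N⟩
      exact Quotient.sound (tensor_assoc L.2 M.2 N.2)
    one_mul := hone
    mul_one := fun a => (hcomm a 1).trans (hone a)
    inv_mul_cancel := fun a => (hinv a).choose_spec
    mul_comm := hcomm }

/-- The class `p` is represented by a line bundle which has frames `s` over `U` and `t` over `V`
such that `s = c • t` over `U ⊓ V`; when `U` and `V` cover `X`, this says that `p` is the class of
the line bundle glued from the trivial ones on `U` and `V` by the transition function `c`. -/
def Pic.HasTransition (p : Pic O) (U V : Opens X) (c : fn O (U ⊓ V)) : Prop :=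
  ∃ L : LineBundle O, Pic.mk L = p ∧ ∃ (s : Sec L.1.val U) (t : Sec L.1.val V),
    IsFrame L.1.val U s ∧ IsFrame L.1.val V t ∧
      res L.1.val inf_le_left s = c • res L.1.val inf_le_right t

end SheafPic

namespace FormalCompletion

open Limits


/-! ### The formal completion of a scheme along a closed subscheme -/

/-- For a morphism `f : Y ⟶ Y'` of schemes over a space `T`, the induced map of the pushforwards
to `T` of the structure sheaves. -/
def pushforwardMap {T : TopCat.{u}} {Y Y' : Scheme.{u}} (f : Y ⟶ Y') (a : Y.toTopCat ⟶ T)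
    (a' : Y'.toTopCat ⟶ T) (h : f.base ≫ a' = a) :
    (TopCat.Sheaf.pushforward CommRingCat.{u} a').obj Y'.sheaf ⟶
      (TopCat.Sheaf.pushforward CommRingCat.{u} a).obj Y.sheaf where
  hom :=
    { app W := f.app ((Opens.map a').obj W.unop) ≫
        Y.presheaf.map (eqToHom (by rw [← h]; rfl)).op
      naturality {V W} i := by
        subst h
        change Y'.presheaf.map ((Opens.map a').map i.unop).op ≫
            f.app ((Opens.map a').obj W.unop) ≫ _ = _ ≫ Y.presheaf.map _
        rw [Scheme.Hom.naturality_assoc]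
        refine Eq.trans ?_ (Category.assoc _ _ _).symm
        refine congrArg (f.app _ ≫ ·) ?_
        refine (Y.presheaf.map_comp _ _).symm.trans (Eq.trans ?_ (Y.presheaf.map_comp _ _))
        exact congrArg Y.presheaf.map (Subsingleton.elim _ _) }

variable {X : Scheme.{u}} (I : X.IdealSheafData)

/-- The underlying space of the formal completion: the support of `I`. -/
abbrev space : TopCat.{u} := TopCat.of I.support

/-- The inclusion of the underlying space. -/
def incl : space I ⟶ X.toTopCat := TopCat.ofHom ⟨Subtype.val, continuous_subtype_val⟩

/-- The infinitesimal neighbourhood cut out by `I ^ (n + 1)`. -/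
abbrev nbhd (n : ℕ) : Scheme.{u} := (I ^ (n + 1)).subscheme

/-- The canonical map from the space of `nbhd I n` to the support of `I`, a homeomorphism. -/
def nbhdToSpace (n : ℕ) : (nbhd I n).toTopCat ⟶ space I :=
  TopCat.ofHom ⟨fun z => ⟨(I ^ (n + 1)).subschemeι z, by
    have h : (I ^ (n + 1)).subschemeι z ∈ Set.range (I ^ (n + 1)).subschemeι := ⟨z, rfl⟩
    rw [Scheme.IdealSheafData.range_subschemeι, Scheme.IdealSheafData.support_pow_succ] at h
    exact h⟩, by
    exact Continuous.subtype_mk (I ^ (n + 1)).subschemeι.continuous _⟩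

lemma nbhdToSpace_incl (n : ℕ) :
    nbhdToSpace I n ≫ incl I = (I ^ (n + 1)).subschemeι.base := rfl

lemma pow_succ_le (n : ℕ) : I ^ (n + 1 + 1) ≤ I ^ (n + 1) :=
  fun _ => Ideal.pow_le_pow_right (n + 1).le_succ

lemma inclusion_base_nbhdToSpace (n : ℕ) :
    (Scheme.IdealSheafData.inclusion (pow_succ_le I n)).base ≫ nbhdToSpace I (n + 1) =
      nbhdToSpace I n := by
  have : Mono (incl I) := by
    rw [TopCat.mono_iff_injective]; exact Subtype.val_injective
  rw [← cancel_mono (incl I), Category.assoc, nbhdToSpace_incl, nbhdToSpace_incl,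
    ← Scheme.Hom.comp_base, Scheme.IdealSheafData.inclusion_subschemeι]

/-- The sheaf `𝒪_X / I ^ (n + 1)`, as a sheaf on the support. -/
def nbhdSheaf (n : ℕ) : Sheaf (Opens.grothendieckTopology (space I)) CommRingCat.{u} :=
  (TopCat.Sheaf.pushforward CommRingCat.{u} (nbhdToSpace I n)).obj (nbhd I n).sheaf

/-- The restriction `𝒪_X / I ^ (n + 2) ⟶ 𝒪_X / I ^ (n + 1)`. -/
def nbhdRestr (n : ℕ) : nbhdSheaf I (n + 1) ⟶ nbhdSheaf I n :=
  pushforwardMap (Scheme.IdealSheafData.inclusion (pow_succ_le I n)) _ _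
    (inclusion_base_nbhdToSpace I n)

/-- The structure sheaf `lim_n 𝒪_X / I ^ n` of the formal completion, a sheaf on `space I`. -/
def structureSheaf : TopCat.Sheaf CommRingCat.{u} (space I) :=
  limit (C := Sheaf (Opens.grothendieckTopology (space I)) CommRingCat.{u})
    (Functor.ofOpSequence (nbhdRestr I))

/-- Reduction of functions on the formal completion modulo `I ^ (n + 1)`. -/
def reduction (n : ℕ) (W : Opens (space I)) : (structureSheaf I).presheaf.obj (op W) ⟶
    Γ(nbhd I n, (Opens.map (nbhdToSpace I n)).obj W) :=
  (limit.π (C := Sheaf (Opens.grothendieckTopology (space I)) CommRingCat.{u})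
    (Functor.ofOpSequence (nbhdRestr I)) (op n)).hom.app (op W)

lemma reduction_naturality (n : ℕ) {W W' : Opens (space I)} (i : W' ⟶ W) :
    (structureSheaf I).presheaf.map i.op ≫ reduction I n W' =
      reduction I n W ≫ (nbhd I n).presheaf.map ((Opens.map (nbhdToSpace I n)).map i).op :=
  (limit.π (C := Sheaf (Opens.grothendieckTopology (space I)) CommRingCat.{u})
    (Functor.ofOpSequence (nbhdRestr I)) (op n)).hom.naturality i.op

/-- Restriction of functions on `X` to the infinitesimal neighbourhood `nbhd I n`. -/
def restrictNbhd (n : ℕ) (V : X.Opens) (W : Opens (space I)) (h : W ≤ (Opens.map (incl I)).obj V) :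
    Γ(X, V) ⟶ Γ(nbhd I n, (Opens.map (nbhdToSpace I n)).obj W) :=
  (I ^ (n + 1)).subschemeι.app V ≫
    (nbhd I n).presheaf.map ((Opens.map (nbhdToSpace I n)).map (homOfLE h)).op

lemma map_restrictNbhd (n : ℕ) (V : X.Opens) {W W' : Opens (space I)} (i : W' ⟶ W)
    (h : W ≤ (Opens.map (incl I)).obj V) :
    restrictNbhd I n V W h ≫ (nbhd I n).presheaf.map ((Opens.map (nbhdToSpace I n)).map i).op =
      restrictNbhd I n V W' (i.le.trans h) :=
  (Category.assoc _ _ _).trans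
    (congrArg ((I ^ (n + 1)).subschemeι.app V ≫ ·) ((nbhd I n).presheaf.map_comp _ _).symm)

lemma restrictNbhd_res (n : ℕ) {V V' : X.Opens} (i : V' ⟶ V) (W : Opens (space I))
    (h : W ≤ (Opens.map (incl I)).obj V') (f : Γ(X, V)) :
    restrictNbhd I n V' W h (X.presheaf.map i.op f) =
      restrictNbhd I n V W (h.trans ((Opens.map (incl I)).map i).le) f := by
  have e : X.presheaf.map i.op ≫ restrictNbhd I n V' W h =
      restrictNbhd I n V W (h.trans ((Opens.map (incl I)).map i).le) := by
    refine (Scheme.Hom.naturality_assoc _ _ _).trans ?_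
    exact congrArg ((I ^ (n + 1)).subschemeι.app V ≫ ·) ((nbhd I n).presheaf.map_comp _ _).symm
  exact ConcreteCategory.congr_hom e f

/-- `c` is the `I`-adic limit of the functions `f n` on `X`, in the precise form
`c ≡ f n` modulo `I ^ (n + 1)` for all `n`. For a constant sequence: `c` is the function on the
formal completion which `f` induces. -/
def IsLimitOf (V : X.Opens) (f : ℕ → Γ(X, V)) (W : Opens (space I))
    (c : (structureSheaf I).presheaf.obj (op W)) : Prop :=
  ∃ h : W ≤ (Opens.map (incl I)).obj V, ∀ n,
    reduction I n W c = restrictNbhd I n V W h (f n)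

/-- The functions on the formal completion which are induced by functions on an open subset of `X`
without zeros outside the support `Z` of `I`. Where `Z` is given by one equation `t`, these are
locally divisors of powers of `t`, and `t` is one of them. -/
def locSubmonoid : (structureSheaf I).presheaf.SubmonoidPresheaf where
  obj W :=
    { carrier := {c | ∃ (V : X.Opens) (f : Γ(X, V)), (V : Set X) \ I.support ⊆ X.basicOpen f ∧
        IsLimitOf I V (fun _ => f) W.unop c}
      one_mem' := by
        refine ⟨⊤, 1, fun x hx => ?_, le_top, fun n => ?_⟩
        · rw [Scheme.basicOpen_of_isUnit _ isUnit_one]; trivial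
        · simp
      mul_mem' := by
        rintro a b ⟨V, f, hf, hV, ha⟩ ⟨V', f', hf', hV', hb⟩
        refine ⟨V ⊓ V', X.presheaf.map (homOfLE inf_le_left).op f *
          X.presheaf.map (homOfLE inf_le_right).op f', fun x hx => ?_, le_inf hV hV',
          fun n => ?_⟩
        · rw [Scheme.basicOpen_mul, Scheme.basicOpen_res, Scheme.basicOpen_res]
          exact ⟨⟨hx.1, hf ⟨hx.1.1, hx.2⟩⟩, ⟨hx.1, hf' ⟨hx.1.2, hx.2⟩⟩⟩
        · rw [map_mul, ha n, hb n, map_mul]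
          exact congrArg₂ (· * ·)
            (restrictNbhd_res I n (homOfLE inf_le_left) W.unop (le_inf hV hV') f).symm
            (restrictNbhd_res I n (homOfLE inf_le_right) W.unop (le_inf hV hV') f').symm
      }
  map {W W'} i := by
    rintro c ⟨V, f, hf, hV, h⟩
    refine ⟨V, f, hf, i.unop.le.trans hV, fun n => ?_⟩
    have h1 := ConcreteCategory.congr_hom (reduction_naturality I n i.unop) c
    have h2 := ConcreteCategory.congr_hom (map_restrictNbhd I n V i.unop hV) f
    refine h1.trans (Eq.trans ?_ h2)
    exact congrArg _ (h n)

/-- The structure sheaf of the punctured formal neighbourhood of an effective Cartier divisor `Z`,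
as a sheaf on `Z`: the sheafified localization of the structure sheaf of the formal completion at
the functions without zeros outside `Z`. Where `Z` has the equation `t`, this is the
sheaf `(lim_n 𝒪_X / t ^ n)[1 / t]`. -/
def puncturedSheaf : TopCat.Sheaf CommRingCat.{u} (space I) :=
  (presheafToSheaf (Opens.grothendieckTopology (space I)) CommRingCat.{u}).obj
    (locSubmonoid I).localizationPresheaf

/-- The localization morphism: restriction of functions to the punctured neighbourhood. -/
def toPunctured : (structureSheaf I).presheaf ⟶ (puncturedSheaf I).presheaf :=
  (locSubmonoid I).toLocalizationPresheaf ≫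
    CategoryTheory.toSheafify (Opens.grothendieckTopology (space I)) _
end FormalCompletion

namespace ProjPlane

/-! ### The projective plane, the line at infinity, and the group of power series -/

open MvPolynomial

variable (k : Type u) [Field k]

/-- The grading of `k[z₀, z₁, z₂]` by degree. -/
abbrev grading : ℕ → Submodule k (MvPolynomial (Fin 3) k) := homogeneousSubmodule (Fin 3) k

instance : GradedAlgebra (grading k) := MvPolynomial.gradedAlgebra

/-- The projective plane over `k`. -/
abbrev P2 : Scheme.{u} := Proj (grading k)

/-- The affine chart `zᵢ ≠ 0`. -/
def chart (i : Fin 3) : (P2 k).Opens := Proj.basicOpen (grading k) (X i)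

/-- The line at infinity `z₀ = 0`. -/
def lineAtInfinity : Closeds (P2 k) := (chart k 0).compl

/-- The ideal sheaf of the line at infinity with its reduced structure. -/
def idealInfinity : (P2 k).IdealSheafData :=
  Scheme.IdealSheafData.vanishingIdeal (lineAtInfinity k)

/-- The underlying space of the formal completion of the plane along the line at infinity. -/
abbrev infinitySpace : TopCat.{u} := FormalCompletion.space (idealInfinity k)

/-- The structure sheaf of the formal completion of the plane along the line at infinity. -/
abbrev formalSheaf : TopCat.Sheaf CommRingCat.{u} (infinitySpace k) :=
  FormalCompletion.structureSheaf (idealInfinity k)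

/-- The structure sheaf of the punctured formal neighbourhood of the line at infinity. -/
abbrev formalPuncturedSheaf : TopCat.Sheaf CommRingCat.{u} (infinitySpace k) :=
  FormalCompletion.puncturedSheaf (idealInfinity k)

/-- The part of the line at infinity in the chart `zᵢ ≠ 0`. -/
def chartInfinity (i : Fin 3) : Opens (infinitySpace k) :=
  (Opens.map (FormalCompletion.incl (idealInfinity k))).obj (chart k i)

/-- The function `zᵢ / zⱼ` on the chart `zⱼ ≠ 0`. -/
def frac (i j : Fin 3) : Γ(P2 k, chart k j) :=
  (Proj.awayToSection (grading k) (X j)).hom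
    (HomogeneousLocalization.Away.mk (grading k) (d := 1) (isHomogeneous_X k j) 1 (X i)
      (isHomogeneous_X k i))

/-- Constants, as functions on the chart `zⱼ ≠ 0`. -/
def const (j : Fin 3) : k →+* Γ(P2 k, chart k j) :=
  (Proj.awayToSection (grading k) (X j)).hom.comp
    ((algebraMap (grading k 0) (HomogeneousLocalization.Away (grading k) (X j))).comp
      (algebraMap k (grading k 0)))

/-- Restriction from the chart `z₁ ≠ 0` to the overlap `z₁ z₂ ≠ 0`. -/
def resLeft : Γ(P2 k, chart k 1) →+* Γ(P2 k, chart k 1 ⊓ chart k 2) :=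
  ((P2 k).presheaf.map (homOfLE inf_le_left).op).hom

/-- Restriction from the chart `z₂ ≠ 0` to the overlap `z₁ z₂ ≠ 0`. -/
def resRight : Γ(P2 k, chart k 2) →+* Γ(P2 k, chart k 1 ⊓ chart k 2) :=
  ((P2 k).presheaf.map (homOfLE inf_le_right).op).hom

/-- The function `x / y = z₁ / z₂` on the overlap, where `x = z₁ / z₀` and `y = z₂ / z₀`. -/
def ratio : Γ(P2 k, chart k 1 ⊓ chart k 2) := resRight k (frac k 1 2)

/-- The function on the overlap which is the truncation of the power series `g` to total degree at
most `n`, with `x⁻¹ = z₀ / z₁` and `y⁻¹ = z₀ / z₂` substituted for the two variables. -/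
def evalTrunc (g : MvPowerSeries (Fin 2) k) (n : ℕ) : Γ(P2 k, chart k 1 ⊓ chart k 2) :=
  eval₂ ((resLeft k).comp (const k 1)) ![resLeft k (frac k 0 1), resRight k (frac k 0 2)]
    (MvPowerSeries.truncTotal (n + 1) g)

/-- The group `1 + x⁻¹ y⁻¹ k[[x⁻¹, y⁻¹]]` under multiplication; the variables of the power series
with indices `0` and `1` are `x⁻¹` and `y⁻¹`. -/
def G : Subgroup (MvPowerSeries (Fin 2) k)ˣ where
  carrier := {u | ∃ h : MvPowerSeries (Fin 2) k,
    (u : MvPowerSeries (Fin 2) k) = 1 + MvPowerSeries.X 0 * MvPowerSeries.X 1 * h}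
  one_mem' := ⟨0, by simp⟩
  mul_mem' := by
    rintro a b ⟨h, ha⟩ ⟨h', hb⟩
    refine ⟨h + h' + MvPowerSeries.X 0 * MvPowerSeries.X 1 * h * h', ?_⟩
    rw [Units.val_mul, ha, hb]
    ring
  inv_mem' := by
    rintro a ⟨h, ha⟩
    refine ⟨-h * (a⁻¹ : (MvPowerSeries (Fin 2) k)ˣ), ?_⟩
    have h1 : (a : MvPowerSeries (Fin 2) k) * (a⁻¹ : (MvPowerSeries (Fin 2) k)ˣ) = 1 :=
      a.mul_inv
    rw [ha] at h1
    linear_combination h1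

/-- `c` is the function which the power series `g` in `x⁻¹, y⁻¹` defines on the part of the formal
completion over the overlap of the charts. -/
def IsValue (g : MvPowerSeries (Fin 2) k)
    (c : SheafPic.fn (formalSheaf k) (chartInfinity k 1 ⊓ chartInfinity k 2)) : Prop :=
  FormalCompletion.IsLimitOf (idealInfinity k) (chart k 1 ⊓ chart k 2) (evalTrunc k g) _ c

/-- `r` is the function `x / y` on the part of the formal completion over the overlap of the
charts. -/
def IsRatio (r : SheafPic.fn (formalSheaf k) (chartInfinity k 1 ⊓ chartInfinity k 2)) : Prop :=
  FormalCompletion.IsLimitOf (idealInfinity k) (chart k 1 ⊓ chart k 2) (fun _ => ratio k) _ r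

/-- Restriction of functions on the overlap to the punctured formal neighbourhood. -/
def restrictPunctured (c : SheafPic.fn (formalSheaf k) (chartInfinity k 1 ⊓ chartInfinity k 2)) :
    SheafPic.fn (formalPuncturedSheaf k) (chartInfinity k 1 ⊓ chartInfinity k 2) :=
  ((FormalCompletion.toPunctured (idealInfinity k)).app (op _)).hom c

end ProjPlane

end

end

noncomputable section

open CategoryTheory Opposite TopologicalSpace AlgebraicGeometry

/-! ### Line bundles on a ringed space and their transition functions for a cover by two open sets
-/

namespace SheafPic
open MonoidalCategory

variable {X : TopCat.{u}} {O : TopCat.Sheaf CommRingCat.{u} X}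

/-! Put v = y/x = z₂/z₁, s = x⁻¹ = z₀/z₁ and K = k((v)). All rings of functions that occur are
compared inside the fixed ring K[[s]], or K((s)) in the punctured case, by expansion along one arc
Spec K[[s]] → ℙ². Over U₁ ∩ H₀ the formal functions become k[v][[s]], over the overlap k[v,
v⁻¹][[s]]. Over U₂ ∩ H₀, where the coordinates are v⁻¹ and y⁻¹ = v⁻¹s, they become the series whose
coefficient of sⁿ lies in v⁻ⁿk[v⁻¹]. This is the content of `Chart.expansion_injective`,
`Chart.expansion_mem_series` and `Chart.exists_expansion_eq`.

Every line bundle is trivial over U₁ ∩ H₀ and over U₂ ∩ H₀ (`Chart.exists_isFrame`). These are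
affine lines, k[t] is a principal ideal domain, and a unit over D(fg) is a unit over D(f) times a
unit over D(g). Thus frames over D(f) and D(g) can be corrected to agree, and they combine to a
frame over the union. The Picard group is therefore the group of units on the overlap modulo the
units on the two sets (`exists_pic_equiv`).

This quotient is computed degree by degree in s. The units of k[v, v⁻¹] are the cvᵐ with c a nonzero
scalar; they account for the factor ℤ. For n ≥ 1, k[v, v⁻¹] is the direct sum of k[v], the span of
the v⁻ᵇ with 0 < b < n, and v⁻ⁿk[v⁻¹] (`coeffs_le_sup`, `eq_zero_of_add_eq`); the middle summand is
H¹(ℙ¹, 𝒪(-n)). Since v⁻ᵇsⁿ is x⁻¹ to the power n - b times y⁻¹ to the power b, the middle summands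
collect exactly the monomials divisible by x⁻¹y⁻¹. Successive approximation turns the additive
decomposition into a multiplicative one, whose middle factor is an element of G (`exists_mul_mul`,
`eq_one_of_eq_mul`).

On the punctured neighbourhood s becomes invertible over U₁ and v⁻¹s over U₂. A unit is then a power
of the equation times a unit power series (`exists_eq_laurentMonomial_mul`). As vᵐ = sᵐ(v⁻¹s)⁻ᵐ, the
factor ℤ disappears, and a comparison of orders in s shows that G survives. -/

lemma exists_glue (M : Mod O) {A B : Opens X} (s : Sec M.val A) (t : Sec M.val B)
    (h : res M.val inf_le_left s = res M.val (inf_le_right : A ⊓ B ≤ B) t) :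
    ∃ e : Sec M.val (A ⊔ B), res M.val le_sup_left e = s ∧ res M.val le_sup_right e = t := by
  let F : TopCat.Sheaf Ab X := ⟨M.val.presheaf, M.isSheaf⟩
  have key := TopCat.Sheaf.existsUnique_gluing' F (fun b : Bool => cond b A B) (A ⊔ B)
    (fun b => homOfLE (by cases b; exacts [le_sup_right, le_sup_left]))
    (sup_le (le_iSup (fun b : Bool => cond b A B) true) (le_iSup (fun b : Bool => cond b A B)
        false))
    (fun b => match b with
      | true => (s : Sec M.val A)
      | false => (t : Sec M.val B)) (by
      rintro (_ | _) (_ | _)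
      · rfl
      · exact (res_res M.val inf_le_right (le_inf inf_le_right inf_le_left : B ⊓ A ≤ A ⊓ B)
            t).symm.trans
          ((congrArg (res M.val (le_inf inf_le_right inf_le_left : B ⊓ A ≤ A ⊓ B)) h.symm).trans
            (res_res M.val inf_le_left (le_inf inf_le_right inf_le_left : B ⊓ A ≤ A ⊓ B) s))
      · exact h
      · rfl)
  obtain ⟨e, he, -⟩ := key
  exact ⟨e, he true, he false⟩

lemma fn_ext {U : Opens X} (a b : fn O U)
    (h : ∀ x ∈ U, ∃ (V : Opens X) (hV : V ≤ U), x ∈ V ∧ fnRes O hV a = fnRes O hV b) :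
    a = b := by
  choose V hV hx hab using fun x : U => h x.1 x.2
  exact TopCat.Sheaf.eq_of_locally_eq' O V U (fun x => homOfLE (hV x))
    (fun x hx' => Opens.mem_iSup.2 ⟨⟨x, hx'⟩, hx _⟩) a b hab

/-- Injectivity is local because `O` is separated. For surjectivity, the local coefficients of a
section are unique, hence agree on overlaps and glue to a function. -/
lemma isFrame_of_locally (M : Mod O) {U : Opens X} (s : Sec M.val U)
    (h : ∀ x ∈ U, ∃ (V : Opens X) (hV : V ≤ U), x ∈ V ∧ IsFrame M.val V (res M.val hV s)) :
    IsFrame M.val U s := by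
  intro W hW
  have h' : ∀ x ∈ W, ∃ (V : Opens X) (hV : V ≤ W), x ∈ V ∧
      IsFrame M.val V (res M.val (hV.trans hW) s) := by
    intro x hx
    obtain ⟨V, hV, hxV, hs⟩ := h x (hW hx)
    refine ⟨V ⊓ W, inf_le_right, ⟨hxV, hx⟩, ?_⟩
    have := hs.res (inf_le_left : V ⊓ W ≤ V)
    rwa [res_res] at this
  constructor
  · intro a b hab
    refine fn_ext a b fun x hx => ?_
    obtain ⟨V, hV, hxV, hs⟩ := h' x hx
    refine ⟨V, hV, hxV, (hs V le_rfl).1 ?_⟩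
    have := congrArg (res M.val hV) hab
    simpa only [res_smul, res_res] using this
  · intro y
    choose V hV hx hs using fun x : W => h' x.1 x.2
    choose a ha using fun x : W => (hs x (V x) le_rfl).2 (res M.val (hV x) y)
    have hcov : W ≤ iSup V := fun x hx' => Opens.mem_iSup.2 ⟨⟨x, hx'⟩, hx _⟩
    obtain ⟨c, hc, -⟩ := TopCat.Sheaf.existsUnique_gluing' O V W (fun x => homOfLE (hV x)) hcov a
        (by
      intro x x'
      refine ((hs x) (V x ⊓ V x') inf_le_left).1 ?_
      have e : ∀ (z : W) (h : V x ⊓ V x' ≤ V z),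
          fnRes O h (a z) • res M.val (h.trans ((hV z).trans hW)) s = res M.val (h.trans (hV z)) y
              := by
        intro z h
        have := congrArg (res M.val h) (ha z)
        simpa only [res_smul, res_res] using this
      have e1 := e x inf_le_left
      have e2 := e x' inf_le_right
      simp only [res_res]
      exact e1.trans e2.symm)
    refine ⟨c, eq_of_locally_eq M _ _ fun x hx' => ⟨V ⟨x, hx'⟩, hV _, hx ⟨x, hx'⟩, ?_⟩⟩
    have h2 : fnRes O (hV ⟨x, hx'⟩) c = a ⟨x, hx'⟩ := hc ⟨x, hx'⟩
    have h3 := ha ⟨x, hx'⟩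
    simp only [res_res] at h3
    rw [res_smul, h2, res_res]
    exact h3

lemma IsFrame.smul {M : PreMod O} {U : Opens X} {s : Sec M U} (hs : IsFrame M U s) (c : (fn O U)ˣ) :
    IsFrame M U ((c : fn O U) • s) := by
  intro V h
  have h1 : (fun a : fn O V => a • SheafPic.res M h ((c : fn O U) • s)) =
      (fun a : fn O V => a • SheafPic.res M h s) ∘ fun a : fn O V => a * fnRes O h c := by
    funext a
    simp only [Function.comp, res_smul, mul_smul]
  rw [h1]
  exact (hs V h).comp (Units.map (fnRes O h).toMonoidHom c).mulRight_bijective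

lemma IsFrame.exists_unit {M : PreMod O} {U : Opens X} {s t : Sec M U} (hs : IsFrame M U s)
    (ht : IsFrame M U t) : ∃ c : (fn O U)ˣ, s = (c : fn O U) • t := by
  obtain ⟨a, ha⟩ := (hs U le_rfl).2 t
  obtain ⟨b, hb⟩ := (ht U le_rfl).2 s
  simp only [res_self] at ha hb
  refine ⟨⟨b, a, (ht U le_rfl).1 ?_, (hs U le_rfl).1 ?_⟩, hb.symm⟩
  · simp only [res_self, mul_smul, one_smul]
    rw [smul_comm, hb, ha]
  · simp only [res_self, mul_smul, one_smul]
    rw [smul_comm, ha, hb]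

/-- A line bundle with a global frame is trivial. -/
lemma mk_eq_one_of_isFrame (L : LineBundle O) (e : Sec L.1.val ⊤) (he : IsFrame L.1.val ⊤ e) :
    Pic.mk L = 1 := by
  -- A global section is the same as a morphism from `O`. It carries the frame 1 to the frame `e`,
  -- so it is bijective on all open sets.
  let φ : unitMod O ⟶ L.1 := L.1.unitHomEquiv.symm
    ((PresheafOfModules.sectionsMk (M := L.1.val) (fun U => res L.1.val (le_top : U.unop ≤ ⊤) e)
      (fun U V i => res_res L.1.val le_top i.unop.le e)))
  have hφ : app (φ.val : (unitMod O).val ⟶ L.1.val) ⊤ (1 : fn O ⊤) = e := by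
    have h1 := congrArg (fun σ : L.1.sections => (σ.val (op ⊤) : Sec L.1.val ⊤))
      (L.1.unitHomEquiv.apply_symm_apply (PresheafOfModules.sectionsMk (M := L.1.val)
        (fun U => res L.1.val (le_top : U.unop ≤ ⊤) e)
        (fun U V i => res_res L.1.val le_top i.unop.le e)))
    exact h1.trans (res_self L.1.val e)
  refine Quotient.sound ⟨?_⟩
  have : IsIso (sheafify.map (φ.val : (unitMod O).val ⟶ L.1.val)) := by
    apply isIso_sheafify_map
    intro x
    refine ⟨⊤, trivial, (isFrame_one ⊤).app_bijective _ ?_⟩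
    rw [hφ]
    exact he
  exact (sheafifyIso L.1).symm ≪≫ (asIso (sheafify.map (φ.val : (unitMod O).val ⟶ L.1.val))).symm ≪≫
    sheafifyIso (unitMod O)

lemma Pic.HasTransition.eq_one {p : Pic O} {U V : Opens X} (hUV : U ⊔ V = ⊤)
    (h : p.HasTransition U V 1) : p = 1 := by
  obtain ⟨L, rfl, s, t, hs, ht, hst⟩ := h
  rw [one_smul] at hst
  obtain ⟨e, rfl, rfl⟩ := exists_glue L.1 s t hst
  have key : IsFrame L.1.val (U ⊔ V) e := isFrame_of_locally _ _ fun x hx => by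
    rcases hx with hx | hx
    · exact ⟨U, le_sup_left, hx, hs⟩
    · exact ⟨V, le_sup_right, hx, ht⟩
  clear hst hs ht
  -- The open set `U ⊔ V` occurs in the type of `e`, so it can be replaced by `⊤` only while `e` is
  -- universally quantified.
  revert e
  rw [hUV]
  intro e he
  exact mk_eq_one_of_isFrame L e he

/-- Tensor products of frames are frames of the presheaf tensor product and stay frames after
sheafification; in the relation between them the two scalars multiply. -/
lemma Pic.HasTransition.mul {p q : Pic O} {U V : Opens X} {c d : fn O (U ⊓ V)}
    (hp : p.HasTransition U V c) (hq : q.HasTransition U V d) :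
    (p * q).HasTransition U V (c * d) := by
  obtain ⟨L, rfl, s, t, hs, ht, hst⟩ := hp
  obtain ⟨L', rfl, s', t', hs', ht', hst'⟩ := hq
  refine ⟨L.tensor L', rfl, _, _, (hs.tmul hs').sheafify, (ht.tmul ht').sheafify, ?_⟩
  have h1 : tmul (res L.1.val inf_le_left s) (res L'.1.val inf_le_left s') =
      (c * d) • tmul (res L.1.val (inf_le_right : U ⊓ V ≤ V) t)
        (res L'.1.val (inf_le_right : U ⊓ V ≤ V) t') := by
    rw [hst, hst']
    exact TensorProduct.smul_tmul_smul c d _ _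
  refine (app_res (eta (L.1.val ⊗ L'.1.val : PreMod O)) inf_le_left (tmul s s')).symm.trans ?_
  refine Eq.trans ?_ (congrArg ((c * d) • ·)
    (app_res (eta (L.1.val ⊗ L'.1.val : PreMod O)) inf_le_right (tmul t t')))
  exact (congrArg (app (eta (L.1.val ⊗ L'.1.val : PreMod O)) (U ⊓ V)) h1).trans
    (map_smul (app (eta (L.1.val ⊗ L'.1.val : PreMod O)) (U ⊓ V)) _ _)

/-- The new frames are `a • s` and `b⁻¹ • t`: changing frames alters the transition function by a
coboundary. -/
lemma Pic.HasTransition.smul {p : Pic O} {U V : Opens X} {c : fn O (U ⊓ V)}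
    (hp : p.HasTransition U V c) (a : (fn O U)ˣ) (b : (fn O V)ˣ) :
    p.HasTransition U V (fnRes O inf_le_left (a : fn O U) * c * fnRes O inf_le_right (b : fn O V))
        := by
  obtain ⟨L, rfl, s, t, hs, ht, hst⟩ := hp
  refine ⟨L, rfl, _, _, hs.smul a, ht.smul b⁻¹, ?_⟩
  rw [res_smul, res_smul, hst, smul_smul, smul_smul, mul_assoc (_ * c), ← map_mul, Units.mul_inv,
    map_one, mul_one]

/-- An isomorphism with `O` carries the two frames to units on `U` and `V`, because they are
compared there with the frame 1. The relation between the frames then exhibits `c` as a coboundary.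
-/
lemma Pic.HasTransition.exists_of_eq_one {U V : Opens X} {c : fn O (U ⊓ V)}
    (h : (1 : Pic O).HasTransition U V c) :
    ∃ (a : (fn O U)ˣ) (b : (fn O V)ˣ),
      c = fnRes O inf_le_left (a : fn O U) * fnRes O inf_le_right (b : fn O V) := by
  obtain ⟨L, hL, s, t, hs, ht, hst⟩ := h
  obtain ⟨e⟩ : Nonempty (L.1 ≅ unitMod O) := Quotient.exact hL
  let φ : (L.1.val : PreMod O) ⟶ (unitMod O).val := e.hom.val
  have hφ : ∀ W, Function.Bijective (app φ W) := by
    intro W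
    have h1 : e.hom.val ≫ e.inv.val = 𝟙 _ := congrArg SheafOfModules.Hom.val e.hom_inv_id
    have h2 : e.inv.val ≫ e.hom.val = 𝟙 _ := congrArg SheafOfModules.Hom.val e.inv_hom_id
    refine Function.bijective_iff_has_inverse.2 ⟨app e.inv.val W, fun x => ?_, fun x => ?_⟩
    · exact congrArg (fun f : (L.1.val : PreMod O) ⟶ L.1.val => app f W x) h1
    · exact congrArg (fun f : ((unitMod O).val : PreMod O) ⟶ (unitMod O).val => app f W x) h2
  obtain ⟨a, ha⟩ := (hs.map_of_bijective φ fun V _ => hφ V).exists_unit (isFrame_one U)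
  -- The roles are exchanged for `t`: here `1 = b • φ t`, so that `b` is the inverse of the image of
  -- `t` and no inverse appears in the result.
  obtain ⟨b, hb⟩ := (isFrame_one V).exists_unit (ht.map_of_bijective φ fun V _ => hφ V)
  have h3 := congrArg (app φ _) hst
  rw [map_smul, app_res, app_res, ha] at h3
  replace h3 := (res_smul (unitMod O).val _ _ _).symm.trans h3
  have h4 := congrArg (res (unitMod O).val (inf_le_right : U ⊓ V ≤ V)) hb
  rw [res_smul] at h4
  obtain ⟨y, hy⟩ : ∃ y : fn O (U ⊓ V),
    y = res (unitMod O).val (inf_le_right : U ⊓ V ≤ V) (app φ V t) := ⟨_, rfl⟩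
  rw [← hy] at h3 h4
  have h5 : fnRes O inf_le_left (a : fn O U) * fnRes O inf_le_left 1 = c * y := h3
  have h6 : fnRes O inf_le_right 1 = fnRes O inf_le_right (b : fn O V) * y := h4
  rw [map_one] at h5 h6
  refine ⟨a, b, ?_⟩
  linear_combination c * h6 - fnRes O inf_le_right (b : fn O V) * h5

/-! ### The line bundle with a prescribed transition function -/

section Glue

variable (O) in
/-- `O(W ⊓ U)` as an `O(W)`-module. -/
def CutFn (W U : Opens X) : Type u := fn O (W ⊓ U)

instance (W U : Opens X) : CommRing (CutFn O W U) := inferInstanceAs (CommRing (fn O (W ⊓ U)))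

instance (W U : Opens X) : Module (fn O W) (CutFn O W U) :=
  Module.compHom (fn O (W ⊓ U)) (fnRes O (inf_le_left : W ⊓ U ≤ W))

lemma CutFn.smul_def {W U : Opens X} (a : fn O W) (b : CutFn O W U) :
    a • b = (fnRes O inf_le_left a * (show fn O (W ⊓ U) from b) : fn O (W ⊓ U)) := rfl

/-- Restriction of functions on `W ⊓ U`. -/
def CutFn.res {W W' : Opens X} (U : Opens X) (h : W' ≤ W) : CutFn O W U →+* CutFn O W' U :=
  fnRes O (inf_le_inf_right U h)

lemma CutFn.res_smul {W W' U : Opens X} (h : W' ≤ W) (a : fn O W) (b : CutFn O W U) :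
    CutFn.res U h (a • b) = fnRes O h a • CutFn.res U h b := by
  change fn O (W ⊓ U) at b
  refine (map_mul (fnRes O (inf_le_inf_right U h)) (fnRes O inf_le_left a) b).trans ?_
  rw [fnRes_fnRes, CutFn.smul_def, fnRes_fnRes]
  rfl

variable {U V : Opens X} (c : fn O (U ⊓ V))

/-- Sections over `W` of the line bundle with frames `s` over `U` and `t` over `V` such that
`s = c • t`: the pairs `(a, b)` with `a • s = b • t` on `W ⊓ U ⊓ V`. -/
def gluedSec (W : Opens X) : Submodule (fn O W) (CutFn O W U × CutFn O W V) where
  carrier := {p | fnRes O (inf_le_inf_left W inf_le_left) p.1 * fnRes O inf_le_right c =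
    (fnRes O (inf_le_inf_left W inf_le_right) p.2 : fn O (W ⊓ (U ⊓ V)))}
  add_mem' {p q} hp hq := by
    change fnRes O _ (p.1 + q.1) * _ = fnRes O _ (p.2 + q.2)
    have h1 := map_add (fnRes O (inf_le_inf_left W (inf_le_left : U ⊓ V ≤ U))) p.1 q.1
    have h2 := map_add (fnRes O (inf_le_inf_left W (inf_le_right : U ⊓ V ≤ V))) p.2 q.2
    refine (congrArg (· * fnRes O inf_le_right c) h1).trans (Eq.trans ?_ h2.symm)
    exact (add_mul _ _ _).trans (congrArg₂ (· + ·) hp hq)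
  zero_mem' := by
    change fnRes O _ (0 : fn O _) * _ = fnRes O _ (0 : fn O _)
    rw [map_zero, map_zero, zero_mul]
  smul_mem' a p hp := by
    obtain ⟨x, y⟩ := p
    change fn O (W ⊓ U) at x
    change fn O (W ⊓ V) at y
    change fnRes O _ x * _ = fnRes O _ y at hp
    change fnRes O _ (fnRes O _ a * x) * _ = fnRes O _ (fnRes O _ a * y)
    rw [map_mul, map_mul, fnRes_fnRes, fnRes_fnRes, mul_assoc]
    exact congrArg _ hp

/-- Restriction of sections of the glued line bundle. -/
def gluedRes {W W' : Opens X} (h : W' ≤ W) : gluedSec c W →ₛₗ[fnRes O h] gluedSec c W' where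
  toFun p := ⟨(CutFn.res U h p.1.1, CutFn.res V h p.1.2), by
    obtain ⟨⟨x, y⟩, hp⟩ := p
    change fn O (W ⊓ U) at x
    change fn O (W ⊓ V) at y
    change fnRes O _ x * _ = fnRes O _ y at hp
    have := congrArg (fnRes O (inf_le_inf_right (U ⊓ V) h)) hp
    rw [map_mul, fnRes_fnRes, fnRes_fnRes, fnRes_fnRes] at this
    change fnRes O _ (fnRes O _ x) * _ = fnRes O _ (fnRes O _ y)
    rw [fnRes_fnRes, fnRes_fnRes]
    exact this⟩
  map_add' p q := Subtype.ext (Prod.ext (map_add (CutFn.res U h) _ _) (map_add (CutFn.res V h) _ _))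
  map_smul' a p := Subtype.ext (Prod.ext (CutFn.res_smul h a p.1.1) (CutFn.res_smul h a p.1.2))

/-- The glued line bundle, as a presheaf of modules. -/
def glued : PreMod O where
  obj W := ModuleCat.of (fn O W.unop) (gluedSec c W.unop)
  map {W W'} i := ModuleCat.ofHom
    (X := ModuleCat.of (fn O W.unop) (gluedSec c W.unop))
    (Y := (ModuleCat.restrictScalars (fnRes O i.unop.le)).obj
      (ModuleCat.of (fn O W'.unop) (gluedSec c W'.unop)))
    { toFun := gluedRes c i.unop.le
      map_add' := map_add (gluedRes c i.unop.le)
      map_smul' := (gluedRes c i.unop.le).map_smul' }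
  map_id W := by
    ext p
    exact Subtype.ext (Prod.ext (fnRes_self (O := O) _) (fnRes_self (O := O) _))
  map_comp f g := by
    ext p
    exact Subtype.ext (Prod.ext (fnRes_fnRes (O := O) _ _ _).symm (fnRes_fnRes (O := O) _ _ _).symm)

/-- The glued presheaf has the frames `(1, c)` over `U` and `(c⁻¹, 1)` over `V`. Frames survive
sheafification, so it need not be checked that the glued presheaf is already a sheaf. -/
lemma exists_hasTransition (hUV : U ⊔ V = ⊤) (c : (fn O (U ⊓ V))ˣ) :
    ∃ p : Pic O, p.HasTransition U V (c : fn O (U ⊓ V)) := by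
  let s : gluedSec (c : fn O (U ⊓ V)) U := ⟨((1 : fn O (U ⊓ U)), (c : fn O (U ⊓ V))), by
    change fnRes O _ (1 : fn O _) * _ = fnRes O _ c.val
    rw [map_one, one_mul]⟩
  let t : gluedSec (c : fn O (U ⊓ V)) V :=
    ⟨(fnRes O (le_inf inf_le_right inf_le_left : V ⊓ U ≤ U ⊓ V) (c⁻¹ : (fn O (U ⊓ V))ˣ),
      (1 : fn O (V ⊓ V))), by
    change fnRes O _ (fnRes O _ _) * _ = fnRes O _ (1 : fn O _)
    rw [map_one, fnRes_fnRes, ← map_mul, Units.inv_mul, map_one]⟩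
  have hs : IsFrame (glued (c : fn O (U ⊓ V))) U s := by
    intro W h
    constructor
    · intro a b hab
      have h1 : fnRes O inf_le_left a * fnRes O (inf_le_inf_right U h) 1 =
        fnRes O inf_le_left b * fnRes O (inf_le_inf_right U h) 1 :=
          congrArg (fun p : gluedSec (c : fn O (U ⊓ V)) W => p.1.1) hab
      rw [map_one, mul_one, mul_one] at h1
      have h2 := congrArg (fnRes O (le_inf le_rfl h : W ≤ W ⊓ U)) h1
      rwa [fnRes_fnRes, fnRes_fnRes, fnRes_self, fnRes_self] at h2
    · rintro ⟨⟨a, b⟩, hp⟩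
      change fn O (W ⊓ U) at a
      change fn O (W ⊓ V) at b
      change fnRes O _ a * _ = fnRes O _ b at hp
      -- Since `W ≤ U`, the gluing condition holds on all of `W ⊓ V` and determines the second
      -- component from the first.
      have hle : W ⊓ V ≤ W ⊓ (U ⊓ V) := le_inf inf_le_left (inf_le_inf_right V h)
      refine ⟨fnRes O (le_inf le_rfl h : W ≤ W ⊓ U) a, Subtype.ext (Prod.ext ?_ ?_)⟩
      · change fnRes O inf_le_left (fnRes O _ a) * fnRes O (inf_le_inf_right U h) 1 = a
        rw [map_one, mul_one, fnRes_fnRes]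
        exact fnRes_self a
      · change fnRes O inf_le_left (fnRes O _ a) * fnRes O (inf_le_inf_right V h) (c : fn O _) = b
        have h2 := congrArg (fnRes O hle) hp
        rw [map_mul, fnRes_fnRes, fnRes_fnRes, fnRes_fnRes] at h2
        rw [fnRes_fnRes]
        exact h2.trans (fnRes_self b)
  have ht : IsFrame (glued (c : fn O (U ⊓ V))) V t := by
    intro W h
    constructor
    · intro a b hab
      have h1 : fnRes O inf_le_left a * fnRes O (inf_le_inf_right V h) 1 =
        fnRes O inf_le_left b * fnRes O (inf_le_inf_right V h) 1 :=
          congrArg (fun p : gluedSec (c : fn O (U ⊓ V)) W => p.1.2) hab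
      rw [map_one, mul_one, mul_one] at h1
      have h2 := congrArg (fnRes O (le_inf le_rfl h : W ≤ W ⊓ V)) h1
      rwa [fnRes_fnRes, fnRes_fnRes, fnRes_self, fnRes_self] at h2
    · rintro ⟨⟨a, b⟩, hp⟩
      change fn O (W ⊓ U) at a
      change fn O (W ⊓ V) at b
      change fnRes O _ a * _ = fnRes O _ b at hp
      have hle : W ⊓ U ≤ W ⊓ (U ⊓ V) := le_inf inf_le_left (le_inf inf_le_right (inf_le_left.trans
          h))
      refine ⟨fnRes O (le_inf le_rfl h : W ≤ W ⊓ V) b, Subtype.ext (Prod.ext ?_ ?_)⟩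
      · change fnRes O inf_le_left (fnRes O _ b) * fnRes O (inf_le_inf_right U h) (fnRes O _ _) = a
        have h2 := congrArg (fnRes O hle) hp
        rw [map_mul, fnRes_fnRes, fnRes_fnRes, fnRes_fnRes] at h2
        rw [fnRes_fnRes, fnRes_fnRes]
        refine (congrArg (· * _) h2.symm).trans ?_
        rw [mul_assoc, ← map_mul, Units.mul_inv, map_one, mul_one]
        exact fnRes_self a
      · change fnRes O inf_le_left (fnRes O _ b) * fnRes O (inf_le_inf_right V h) 1 = b
        rw [map_one, mul_one, fnRes_fnRes]
        exact fnRes_self b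
  have hst : res (glued (c : fn O (U ⊓ V))) inf_le_left s =
      (c : fn O (U ⊓ V)) • res (glued (c : fn O (U ⊓ V))) inf_le_right t := by
    refine Subtype.ext (Prod.ext ?_ ?_)
    · change fnRes O _ 1 = fnRes O _ (c : fn O (U ⊓ V)) * fnRes O _ (fnRes O _ _)
      rw [fnRes_fnRes, ← map_mul, Units.mul_inv, map_one, map_one]
    · change fnRes O _ (c : fn O (U ⊓ V)) = fnRes O _ (c : fn O (U ⊓ V)) * fnRes O _ 1
      rw [map_one, mul_one]
  refine ⟨_, ⟨sheafify.obj (glued (c : fn O (U ⊓ V))), IsInvertible.sheafify fun x => ?_⟩, rfl,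
    _, _, hs.sheafify, ht.sheafify, ?_⟩
  · rcases (hUV ▸ trivial : x ∈ U ⊔ V) with hx | hx
    · exact ⟨U, hx, s, hs⟩
    · exact ⟨V, hx, t, ht⟩
  · refine (app_res (eta (glued (c : fn O (U ⊓ V)))) inf_le_left _).symm.trans ?_
    refine Eq.trans ?_ (congrArg ((c : fn O (U ⊓ V)) • ·)
      (app_res (eta (glued (c : fn O (U ⊓ V)))) inf_le_right _))
    exact (congrArg (app (eta _) (U ⊓ V)) hst).trans (map_smul (app (eta _) (U ⊓ V)) _ _)

end Glue

/-- The Picard group of a space covered by two open subsets on which all line bundles are trivial,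
from a system of representatives of the transition functions. -/
theorem exists_pic_equiv {T : Type*} [CommGroup T] {U V : Opens X} (hUV : U ⊔ V = ⊤)
    (τ : T →* (fn O (U ⊓ V))ˣ)
    (hU : ∀ L : LineBundle O, ∃ s, IsFrame L.1.val U s)
    (hV : ∀ L : LineBundle O, ∃ s, IsFrame L.1.val V s)
    (hsurj : ∀ c : (fn O (U ⊓ V))ˣ, ∃ (t : T) (a : (fn O U)ˣ) (b : (fn O V)ˣ),
      (c : fn O (U ⊓ V)) =
        fnRes O inf_le_left (a : fn O U) * (τ t : fn O (U ⊓ V)) * fnRes O inf_le_right (b : fn O V))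
    (hinj : ∀ (t : T) (a : (fn O U)ˣ) (b : (fn O V)ˣ),
      (τ t : fn O (U ⊓ V)) = fnRes O inf_le_left (a : fn O U) * fnRes O inf_le_right (b : fn O V) →
      t = 1) :
    ∃ e : Pic O ≃* T, ∀ t, (e.symm t).HasTransition U V (τ t) := by
  -- The transition function determines the class: multiplied by a class with transition function
  -- `c⁻¹`, both `p` and `q` acquire the transition function 1 and become trivial.
  have uniq : ∀ {c : (fn O (U ⊓ V))ˣ} {p q : Pic O}, p.HasTransition U V (c : fn O (U ⊓ V)) →
      q.HasTransition U V (c : fn O (U ⊓ V)) → p = q := by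
    intro c p q hp hq
    obtain ⟨r, hr⟩ := exists_hasTransition hUV c⁻¹
    have h1 := hp.mul hr
    have h2 := hq.mul hr
    rw [Units.mul_inv] at h1 h2
    exact mul_right_cancel ((h1.eq_one hUV).trans (h2.eq_one hUV).symm)
  choose F hF using fun t => exists_hasTransition hUV (τ t)
  let φ : T →* Pic O := MonoidHom.mk' F fun a b => uniq (hF (a * b)) (by
    rw [map_mul]; exact (hF a).mul (hF b))
  have hφ : Function.Bijective φ := by
    constructor
    · refine (injective_iff_map_eq_one φ).2 fun t ht => ?_
      have h1 := hF t
      have h2 : F t = 1 := ht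
      rw [h2] at h1
      obtain ⟨a, b, h⟩ := h1.exists_of_eq_one
      exact hinj t a b h
    · rintro ⟨L⟩
      obtain ⟨s, hs⟩ := hU L
      obtain ⟨t, ht⟩ := hV L
      obtain ⟨c, hc⟩ := (hs.res (inf_le_left : U ⊓ V ≤ U)).exists_unit
        (ht.res (inf_le_right : U ⊓ V ≤ V))
      have h1 : (Pic.mk L).HasTransition U V (c : fn O (U ⊓ V)) := ⟨L, rfl, s, t, hs, ht, hc⟩
      obtain ⟨x, a, b, hx⟩ := hsurj c
      refine ⟨x, uniq (c := c) ?_ h1⟩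
      rw [hx]
      exact (hF x).smul a b
  exact ⟨(MulEquiv.ofBijective φ hφ).symm, hF⟩

/-- Frames over `A` and `B` combine to a frame over `A ⊔ B` if units on the overlap split. -/
lemma exists_isFrame_sup (M : Mod O) {A B : Opens X}
    (hsplit : ∀ c : (fn O (A ⊓ B))ˣ, ∃ (a : (fn O A)ˣ) (b : (fn O B)ˣ),
      (c : fn O (A ⊓ B)) = fnRes O inf_le_left (a : fn O A) * fnRes O inf_le_right (b : fn O B))
    (hA : ∃ s, IsFrame M.val A s) (hB : ∃ s, IsFrame M.val B s) :
    ∃ s, IsFrame M.val (A ⊔ B) s := by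
  obtain ⟨s, hs⟩ := hA
  obtain ⟨t, ht⟩ := hB
  obtain ⟨c, hc⟩ := (hs.res (inf_le_left : A ⊓ B ≤ A)).exists_unit
    (ht.res (inf_le_right : A ⊓ B ≤ B))
  obtain ⟨a, b, hab⟩ := hsplit c
  -- From `s = c • t` and `c = a * b` on the overlap it follows that `a⁻¹ • s` and `b • t` agree
  -- there.
  obtain ⟨e, he1, he2⟩ := exists_glue M ((a⁻¹ : (fn O A)ˣ) • s : Sec M.val A)
    ((b : fn O B) • t : Sec M.val B) (by
      change res M.val _ (((a⁻¹ : (fn O A)ˣ) : fn O A) • s) = _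
      rw [res_smul, res_smul, hc, hab, smul_smul, ← mul_assoc, ← map_mul, Units.inv_mul, map_one,
        one_mul])
  refine ⟨e, isFrame_of_locally _ _ fun x hx => ?_⟩
  rcases hx with hx | hx
  · exact ⟨A, le_sup_left, hx, he1 ▸ hs.smul a⁻¹⟩
  · exact ⟨B, le_sup_right, hx, he2 ▸ ht.smul b⟩

end SheafPic

/-! ### Power series with coefficients in graded pieces, and the factorization of their units -/

namespace SeriesSplitting

open PowerSeries

/-- The `m`-th coefficient is constant from the index `m + 1` on, since all later changes are
divisible by `X ^ (m + 1)`. -/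
lemma exists_limit {K : Type*} [CommRing K] (a : ℕ → K⟦X⟧)
    (h : ∀ n, (X : K⟦X⟧) ^ n ∣ a (n + 1) - a n) :
    ∃ b : K⟦X⟧, ∀ n, (X : K⟦X⟧) ^ n ∣ b - a n := by
  refine ⟨PowerSeries.mk fun m => coeff m (a (m + 1)), fun n => X_pow_dvd_iff.2 fun m hm => ?_⟩
  rw [map_sub, coeff_mk, sub_eq_zero]
  induction n, hm using Nat.le_induction with
  | base => rfl
  | succ n hn ih =>
    rw [ih, eq_comm, ← sub_eq_zero, ← map_sub]
    exact X_pow_dvd_iff.1 (h n) m hn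

lemma eq_of_forall_dvd {K : Type*} [CommRing K] {a b : K⟦X⟧}
    (h : ∀ n, (X : K⟦X⟧) ^ n ∣ a - b) : a = b := by
  ext n
  rw [← sub_eq_zero, ← map_sub]
  exact X_pow_dvd_iff.1 (h (n + 1)) n n.lt_succ_self

variable {K : Type*} [Field K]

/-- The power series in `X` whose `n`-th coefficient lies in `ω ^ n * L`. -/
def series (ω : K) (L : Subring K) : Subring K⟦X⟧ where
  carrier := {F | ∀ n, ∃ l ∈ L, coeff n F = ω ^ n * l}
  mul_mem' {F G} hF hG n := by
    rw [coeff_mul]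
    choose f hf hf' using hF
    choose g hg hg' using hG
    refine ⟨∑ p ∈ Finset.HasAntidiagonal.antidiagonal n, f p.1 * g p.2, sum_mem fun p _ => mul_mem
        (hf _) (hg _), ?_⟩
    rw [Finset.mul_sum]
    refine Finset.sum_congr rfl fun p hp => ?_
    rw [hf', hg', ← Finset.HasAntidiagonal.mem_antidiagonal.1 hp, pow_add]
    ring
  one_mem' n := by
    rw [coeff_one]
    split_ifs with h
    · exact ⟨1, one_mem _, by simp [h]⟩
    · exact ⟨0, zero_mem _, by simp⟩
  add_mem' {F G} hF hG n := by
    obtain ⟨f, hf, hf'⟩ := hF n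
    obtain ⟨g, hg, hg'⟩ := hG n
    exact ⟨f + g, add_mem hf hg, by rw [map_add, hf', hg', mul_add]⟩
  zero_mem' n := ⟨0, zero_mem _, by simp⟩
  neg_mem' {F} hF n := by
    obtain ⟨f, hf, hf'⟩ := hF n
    exact ⟨-f, neg_mem hf, by rw [map_neg, hf', mul_neg]⟩

variable {ω : K} {L L₁ L₂ : Subring K}

lemma series_mono (h : L₁ ≤ L₂) : series ω L₁ ≤ series ω L₂ := fun F hF n => by
  obtain ⟨l, hl, h'⟩ := hF n
  exact ⟨l, h hl, h'⟩

lemma C_mem_series {a : K} (ha : a ∈ L) : C a ∈ series ω L := fun n => by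
  rw [coeff_C]
  split_ifs with h
  · exact ⟨a, ha, by simp [h]⟩
  · exact ⟨0, zero_mem _, by simp⟩

lemma constantCoeff_mem {F : K⟦X⟧} (hF : F ∈ series ω L) : constantCoeff F ∈ L := by
  obtain ⟨l, hl, h⟩ := hF 0
  rw [coeff_zero_eq_constantCoeff_apply, pow_zero, one_mul] at h
  rwa [h]

/-- The `n`-th homogeneous piece `ω ^ n * L`. -/
def piece (ω : K) (L : Subring K) (n : ℕ) : AddSubgroup K :=
  L.toAddSubgroup.map (AddMonoidHom.mulLeft (ω ^ n))

lemma mem_piece {n : ℕ} {a : K} : a ∈ piece ω L n ↔ ∃ l ∈ L, a = ω ^ n * l := by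
  simp only [piece, AddSubgroup.mem_map, AddMonoidHom.coe_mulLeft, Subring.mem_toAddSubgroup,
      eq_comm]

/-- The recursion for the coefficients of the inverse respects the grading: a product of elements of
`ω ^ i * L` and `ω ^ j * L` lies in `ω ^ (i + j) * L`, and the only division is by the constant
coefficient. -/
lemma inv_mem_series {F : K⟦X⟧} (hF : F ∈ series ω L) (h : (constantCoeff F)⁻¹ ∈ L) :
    F⁻¹ ∈ series ω L := by
  intro n
  induction n using Nat.strong_induction_on with
  | _ n ih =>
    rw [← mem_piece, coeff_inv]
    split_ifs with hn
    · exact mem_piece.2 ⟨_, h, by simp [hn]⟩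
    · have key : ∑ x ∈ Finset.HasAntidiagonal.antidiagonal n,
          (if x.2 < n then coeff x.1 F * coeff x.2 F⁻¹ else 0) ∈ piece ω L n := by
        refine sum_mem fun p hp => ?_
        split_ifs with hlt
        · obtain ⟨l, hl, h1⟩ := hF p.1
          obtain ⟨l', hl', h2⟩ := ih p.2 hlt
          refine mem_piece.2 ⟨l * l', mul_mem hl hl', ?_⟩
          rw [h1, h2, ← Finset.HasAntidiagonal.mem_antidiagonal.1 hp, pow_add]
          ring
        · exact zero_mem _
      obtain ⟨l, hl, h1⟩ := mem_piece.1 key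
      exact mem_piece.2 ⟨-(constantCoeff F)⁻¹ * l, mul_mem (neg_mem h) hl, by rw [h1]; ring⟩

lemma mem_units_of_inv_mem {u : K⟦X⟧ˣ} (hu : (u : K⟦X⟧) ∈ series ω L)
    (h : (constantCoeff (u : K⟦X⟧))⁻¹ ∈ L) : u ∈ (series ω L).toSubmonoid.units := by
  refine (Submonoid.mem_units_iff _ _).2 ⟨hu, ?_⟩
  have h0 : constantCoeff (u : K⟦X⟧) ≠ 0 := (u.isUnit.map constantCoeff).ne_zero
  have : ((u⁻¹ : K⟦X⟧ˣ) : K⟦X⟧) = (u : K⟦X⟧)⁻¹ := by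
    rw [PowerSeries.eq_inv_iff_mul_eq_one h0, Units.inv_mul]
  rw [this]
  exact inv_mem_series hu h

lemma constantCoeff_mem_units {u : K⟦X⟧ˣ} (hu : u ∈ (series ω L).toSubmonoid.units) :
    Units.map (constantCoeff (R := K)).toMonoidHom u ∈ L.toSubmonoid.units := by
  obtain ⟨h1, h2⟩ := (Submonoid.mem_units_iff _ _).1 hu
  exact (Submonoid.mem_units_iff _ _).2 ⟨constantCoeff_mem h1, constantCoeff_mem h2⟩

/-- A power series with constant coefficient one whose coefficients lie in sums of graded pieces
is a product accordingly. -/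
theorem exists_mul_mul {ω₁ ω₂ : K} (B : ℕ → AddSubgroup K)
    (h₁ : ∀ n, piece ω₁ L₁ n ≤ piece ω L n) (h₂ : ∀ n, piece ω₂ L₂ n ≤ piece ω L n)
    (hB : ∀ n, B n ≤ piece ω L n)
    (h : ∀ n, n ≠ 0 → piece ω L n ≤ piece ω₁ L₁ n ⊔ B n ⊔ piece ω₂ L₂ n)
    {u : K⟦X⟧} (hu : u ∈ series ω L) (hu0 : constantCoeff u = 1) :
    ∃ a b c : K⟦X⟧, u = a * b * c ∧ a ∈ series ω₁ L₁ ∧ constantCoeff a = 1 ∧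
      c ∈ series ω₂ L₂ ∧ constantCoeff c = 1 ∧
      constantCoeff b = 1 ∧ ∀ n, n ≠ 0 → coeff n b ∈ B n := by
  -- The invariant of the approximation: the triple `t` has all required properties, and its product
  -- agrees with `u` modulo `X ^ (n + 1)`.
  let P : ℕ → K⟦X⟧ × K⟦X⟧ × K⟦X⟧ → Prop := fun n t =>
    X ^ (n + 1) ∣ u - t.1 * t.2.1 * t.2.2 ∧ t.1 ∈ series ω₁ L₁ ∧ constantCoeff t.1 = 1 ∧
      t.2.2 ∈ series ω₂ L₂ ∧ constantCoeff t.2.2 = 1 ∧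
      constantCoeff t.2.1 = 1 ∧ ∀ n, n ≠ 0 → coeff n t.2.1 ∈ B n
  have P0 : P 0 (1, 1, 1) := by
    refine ⟨?_, one_mem _, map_one _, one_mem _, map_one _, map_one _, fun n hn => ?_⟩
    · rw [zero_add, pow_one, X_dvd_iff]; simp [hu0]
    · simp [coeff_one, hn, zero_mem]
  have monom : ∀ {ω : K} {L : Subring K} {n : ℕ} {x : K}, x ∈ piece ω L n →
      C x * X ^ n ∈ series ω L := by
    intro ω L n x hx m
    rw [coeff_C_mul, coeff_X_pow]
    split_ifs with h
    · rw [mul_one]; exact h ▸ mem_piece.1 hx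
    · exact ⟨0, zero_mem _, by simp⟩
  have step : ∀ n t, P n t → ∃ t', P (n + 1) t' ∧
      X ^ (n + 1) ∣ t'.1 - t.1 ∧ X ^ (n + 1) ∣ t'.2.1 - t.2.1 ∧ X ^ (n + 1) ∣ t'.2.2 - t.2.2 := by
    rintro n ⟨a, b, c⟩ ⟨hd, ha, ha0, hc, hc0, hb0, hb⟩
    have haL : a ∈ series ω L := fun m => mem_piece.1 (h₁ m (mem_piece.2 (ha m)))
    have hcL : c ∈ series ω L := fun m => mem_piece.1 (h₂ m (mem_piece.2 (hc m)))
    have hbL : b ∈ series ω L := fun m => by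
      rcases eq_or_ne m 0 with rfl | hm
      · exact ⟨1, one_mem _, by simp [hb0]⟩
      · exact mem_piece.1 (hB m (hb m hm))
    have hdL := sub_mem hu (mul_mem (mul_mem haL hbL) hcL)
    -- The first coefficient of the error is decomposed as `x + y + z` according to the graded
    -- pieces; the three parts are added to the three factors in degree `n + 1`.
    have h1 := h (n + 1) n.succ_ne_zero (mem_piece.2 (hdL (n + 1)))
    obtain ⟨w, hw, z, hz, hyz⟩ := AddSubgroup.mem_sup.1 h1
    obtain ⟨x, hx, y, hy, rfl⟩ := AddSubgroup.mem_sup.1 hw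
    refine ⟨(a + C x * X ^ (n + 1), b + C y * X ^ (n + 1), c + C z * X ^ (n + 1)),
      ⟨?_, add_mem ha (monom hx), by simp [ha0], add_mem hc (monom hz), by simp [hc0],
        by simp [hb0], fun m hm => ?_⟩, ?_, ?_, ?_⟩
    · obtain ⟨q, hq⟩ := hd
      dsimp only at hq hyz ⊢
      rw [hq] at hyz
      have h0 := coeff_X_pow_mul q (n + 1) 0
      rw [zero_add, coeff_zero_eq_constantCoeff_apply] at h0
      rw [h0] at hyz
      -- All three factors have constant coefficient 1, so modulo `X ^ (n + 2)` the product changes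
      -- by `(x + y + z) * X ^ (n + 1)`, which is exactly the error.
      have e : u - (a + C x * X ^ (n + 1)) * (b + C y * X ^ (n + 1)) * (c + C z * X ^ (n + 1)) =
          X ^ (n + 1) * (q - C x * b * c - a * C y * c - a * b * C z -
            X ^ (n + 1) * (C x * C y * c + C x * b * C z + a * C y * C z +
              C x * C y * C z * X ^ (n + 1))) := by
        linear_combination hq
      rw [e, pow_succ]
      refine mul_dvd_mul_left _ (X_dvd_iff.2 ?_)
      simp [ha0, hb0, hc0, ← hyz]
      ring
    · rw [map_add, coeff_C_mul, coeff_X_pow]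
      refine add_mem (hb m hm) ?_
      split_ifs with h
      · rw [mul_one]; exact h ▸ hy
      · simp [zero_mem]
    all_goals simp only [add_sub_cancel_left]; exact Dvd.intro_left _ rfl
  choose! f hf hf' using step
  let g : ℕ → K⟦X⟧ × K⟦X⟧ × K⟦X⟧ := fun n => Nat.rec (1, 1, 1) (fun n t => f n t) n
  have hg : ∀ n, P n (g n) := fun n => by
    induction n with
    | zero => exact P0
    | succ n ih => exact hf n _ ih
  have hg' : ∀ n, X ^ (n + 1) ∣ (g (n + 1)).1 - (g n).1 ∧
      X ^ (n + 1) ∣ (g (n + 1)).2.1 - (g n).2.1 ∧ X ^ (n + 1) ∣ (g (n + 1)).2.2 - (g n).2.2 :=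
    fun n => hf' n _ (hg n)
  have hle : ∀ n, (X : K⟦X⟧) ^ n ∣ X ^ (n + 1) := fun n => pow_dvd_pow _ n.le_succ
  obtain ⟨a, ha⟩ := exists_limit (fun n => (g n).1) fun n => (hle n).trans (hg' n).1
  obtain ⟨b, hb⟩ := exists_limit (fun n => (g n).2.1) fun n => (hle n).trans (hg' n).2.1
  obtain ⟨c, hc⟩ := exists_limit (fun n => (g n).2.2) fun n => (hle n).trans (hg' n).2.2
  -- The limits agree with the `n`-th approximation only modulo `X ^ n`. The coefficient of degree
  -- `n` is therefore read off from the approximation with index `n + 1`.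
  have coe : ∀ {x y : K⟦X⟧} {n : ℕ}, X ^ (n + 1) ∣ x - y → coeff n x = coeff n y := by
    intro x y n h
    rw [← sub_eq_zero, ← map_sub]
    exact X_pow_dvd_iff.1 h n n.lt_succ_self
  refine ⟨a, b, c, eq_of_forall_dvd fun n => ?_, fun n => ?_, ?_, fun n => ?_, ?_, ?_, fun n hn =>
      ?_⟩
  · have e : u - a * b * c = (u - (g n).1 * (g n).2.1 * (g n).2.2) -
        ((a - (g n).1) * b * c + (g n).1 * (b - (g n).2.1) * c +
          (g n).1 * (g n).2.1 * (c - (g n).2.2)) := by ring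
    rw [e]
    refine dvd_sub ((hle n).trans (hg n).1) (dvd_add (dvd_add ?_ ?_) ?_)
    · exact ((ha n).mul_right _).mul_right _
    · exact ((hb n).mul_left _).mul_right _
    · exact (hc n).mul_left _
  · rw [coe (ha (n + 1))]; exact (hg (n + 1)).2.1 n
  · rw [← coeff_zero_eq_constantCoeff_apply, coe (ha 1)]; simpa using (hg 1).2.2.1
  · rw [coe (hc (n + 1))]; exact (hg (n + 1)).2.2.2.1 n
  · rw [← coeff_zero_eq_constantCoeff_apply, coe (hc 1)]; simpa using (hg 1).2.2.2.2.1
  · rw [← coeff_zero_eq_constantCoeff_apply, coe (hb 1)]; simpa using (hg 1).2.2.2.2.2.1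
  · rw [coe (hb (n + 1))]; exact (hg (n + 1)).2.2.2.2.2.2 n hn

lemma isUnit_of_constantCoeff_eq_one {a : K⟦X⟧} (h : constantCoeff a = 1) : IsUnit a :=
  PowerSeries.isUnit_iff_constantCoeff.2 (h ▸ isUnit_one)

/-- Splitting of units with respect to two subrings of coefficients. -/
theorem units_series_le_sup (h₁ : L₁ ≤ L) (h₂ : L₂ ≤ L)
    (hadd : L.toAddSubgroup ≤ L₁.toAddSubgroup ⊔ L₂.toAddSubgroup)
    (hmul : L.toSubmonoid.units ≤ L₁.toSubmonoid.units ⊔ L₂.toSubmonoid.units) :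
    (series ω L).toSubmonoid.units ≤
      (series ω L₁).toSubmonoid.units ⊔ (series ω L₂).toSubmonoid.units := by
  intro u hu
  -- The constant coefficient is split by the multiplicative hypothesis and divided out. The
  -- remaining unit has constant coefficient 1, where the additive hypothesis is enough.
  obtain ⟨y, hy, z, hz, hyz⟩ := Subgroup.mem_sup.1 (hmul (constantCoeff_mem_units hu))
  have hC : ∀ {L : Subring K} {y : Kˣ}, y ∈ L.toSubmonoid.units →
      Units.map (C (R := K)).toMonoidHom y ∈ (series ω L).toSubmonoid.units := by
    intro L y hy
    obtain ⟨h1, h2⟩ := (Submonoid.mem_units_iff _ _).1 hy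
    exact (Submonoid.mem_units_iff _ _).2 ⟨C_mem_series h1, C_mem_series h2⟩
  let Y : K⟦X⟧ˣ := Units.map (C (R := K)).toMonoidHom y
  let Z : K⟦X⟧ˣ := Units.map (C (R := K)).toMonoidHom z
  have hYZ : constantCoeff (u : K⟦X⟧) = y * z := (congrArg Units.val hyz).symm
  let u' : K⟦X⟧ˣ := u * (Y * Z)⁻¹
  have hmono₁ : (series ω L₁).toSubmonoid.units ≤ (series ω L).toSubmonoid.units :=
    Submonoid.units_mono (series_mono h₁)
  have hmono₂ : (series ω L₂).toSubmonoid.units ≤ (series ω L).toSubmonoid.units :=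
    Submonoid.units_mono (series_mono h₂)
  have hu' : u' ∈ (series ω L).toSubmonoid.units :=
    mul_mem hu (inv_mem (mul_mem (hmono₁ (hC hy)) (hmono₂ (hC hz))))
  have hu0 : constantCoeff (u' : K⟦X⟧) = 1 := by
    have h1 : (u' : K⟦X⟧) * (C (y : K) * C (z : K)) = u :=
      congrArg Units.val (inv_mul_cancel_right u (Y * Z))
    have h2 := congrArg constantCoeff h1
    rw [map_mul, map_mul, constantCoeff_C, constantCoeff_C, hYZ] at h2
    exact mul_right_cancel₀ (mul_ne_zero y.ne_zero z.ne_zero) (h2.trans (one_mul _).symm)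
  have hle : ∀ {L₁ : Subring K}, L₁ ≤ L → ∀ n, piece ω L₁ n ≤ piece ω L n := fun h n =>
    AddSubgroup.map_mono h
  -- With `⊥` as middle summand in every degree, the middle factor is forced to be 1.
  obtain ⟨a, b, c, habc, ha, ha0, hc, hc0, hb0, hb⟩ := exists_mul_mul (ω := ω) (ω₁ := ω) (ω₂ := ω)
    (L := L) (L₁ := L₁) (L₂ := L₂) (fun _ => ⊥) (hle h₁) (hle h₂) (fun _ => bot_le)
    (fun n _ => by rw [sup_bot_eq, piece, piece, piece, ← AddSubgroup.map_sup]
                   exact AddSubgroup.map_mono hadd)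
    ((Submonoid.mem_units_iff _ _).1 hu').1 hu0
  have hb1 : b = 1 := by
    ext n
    rcases eq_or_ne n 0 with rfl | hn
    · simp [hb0]
    · rw [coeff_one, if_neg hn]; exact hb n hn
  rw [hb1, mul_one] at habc
  obtain ⟨a, rfl⟩ := isUnit_of_constantCoeff_eq_one ha0
  obtain ⟨c, rfl⟩ := isUnit_of_constantCoeff_eq_one hc0
  refine Subgroup.mem_sup.2 ⟨Y * a, mul_mem (hC hy) (mem_units_of_inv_mem ha ?_), Z * c,
    mul_mem (hC hz) (mem_units_of_inv_mem hc ?_), ?_⟩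
  · rw [ha0, inv_one]; exact one_mem _
  · rw [hc0, inv_one]; exact one_mem _
  · have h1 : u' = a * c := Units.ext habc
    have h2 : u = u' * (Y * Z) := (inv_mul_cancel_right u (Y * Z)).symm
    rw [h2, h1]
    exact Eq.trans (mul_mul_mul_comm _ _ _ _) (mul_comm _ _)

/-! ### Laurent series -/

/-- The Laurent series in `X` whose `n`-th coefficient lies in `ω ^ n * L`. -/
def laurent (ω : Kˣ) (L : Subring K) : Subring (LaurentSeries K) where
  carrier := {F | ∀ n : ℤ, ∃ l ∈ L, F.coeff n = (ω ^ n : Kˣ) * l}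
  mul_mem' {F G} hF hG n := by
    rw [HahnSeries.coeff_mul]
    choose f hf hf' using hF
    choose g hg hg' using hG
    refine ⟨∑ p ∈ Finset.antidiagonal F.isPWO_support G.isPWO_support n, f p.1 * g p.2,
      sum_mem fun p _ => mul_mem (hf p.1) (hg p.2), ?_⟩
    rw [Finset.mul_sum]
    refine Finset.sum_congr rfl fun p hp => ?_
    rw [hf', hg', ← (Finset.mem_antidiagonal.1 hp).2.2, zpow_add, Units.val_mul]
    ring
  one_mem' n := by
    rw [HahnSeries.coeff_one]
    split_ifs with h
    · exact ⟨1, one_mem _, by simp [h]⟩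
    · exact ⟨0, zero_mem _, by simp⟩
  add_mem' {F G} hF hG n := by
    obtain ⟨f, hf, hf'⟩ := hF n
    obtain ⟨g, hg, hg'⟩ := hG n
    exact ⟨f + g, add_mem hf hg, by rw [HahnSeries.coeff_add, hf', hg', mul_add]⟩
  zero_mem' n := ⟨0, zero_mem _, by simp⟩
  neg_mem' {F} hF n := by
    obtain ⟨f, hf, hf'⟩ := hF n
    exact ⟨-f, neg_mem hf, by rw [HahnSeries.coeff_neg, hf', mul_neg]⟩

lemma coe_mem_laurent {ω : Kˣ} {F : K⟦X⟧} (hF : F ∈ series (ω : K) L) :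
    HahnSeries.ofPowerSeries ℤ K F ∈ laurent ω L := by
  intro n
  rcases lt_or_ge n 0 with h | h
  · refine ⟨0, zero_mem _, ?_⟩
    rw [mul_zero]
    rw [HahnSeries.ofPowerSeries_apply]
    refine HahnSeries.embDomain_of_notMem_range ?_
    rintro ⟨m, rfl⟩
    exact absurd h (not_lt.2 (Int.natCast_nonneg m))
  · lift n to ℕ using h
    obtain ⟨l, hl, h⟩ := hF n
    exact ⟨l, hl, by rw [HahnSeries.ofPowerSeries_apply_coeff, h]; simp⟩

/-- The Laurent series `(ω * X) ^ m`. -/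
def laurentMonomial (ω : Kˣ) (m : ℤ) : (LaurentSeries K)ˣ where
  val := HahnSeries.single m ((ω ^ m : Kˣ) : K)
  inv := HahnSeries.single (-m) ((ω ^ (-m) : Kˣ) : K)
  val_inv := by
    rw [HahnSeries.single_mul_single, ← Units.val_mul, ← zpow_add, add_neg_cancel, zpow_zero]; rfl
  inv_val := by
    rw [HahnSeries.single_mul_single, ← Units.val_mul, ← zpow_add, neg_add_cancel, zpow_zero]; rfl

lemma laurentMonomial_mem (ω : Kˣ) (m : ℤ) (L : Subring K) :
    laurentMonomial ω m ∈ (laurent ω L).toSubmonoid.units := by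
  have key : ∀ m, HahnSeries.single m ((ω ^ m : Kˣ) : K) ∈ laurent ω L := by
    intro m n
    rcases eq_or_ne n m with rfl | h
    · exact ⟨1, one_mem _, by simp⟩
    · exact ⟨0, zero_mem _, by rw [HahnSeries.coeff_single_of_ne h, mul_zero]⟩
  exact (Submonoid.mem_units_iff _ _).2 ⟨key m, key (-m)⟩

/-- The map from units of the ring of power series to Laurent series. -/
abbrev unitsCoe : K⟦X⟧ˣ →* (LaurentSeries K)ˣ :=
  Units.map (HahnSeries.ofPowerSeries ℤ K).toMonoidHom

lemma unitsCoe_mem {ω : Kˣ} {u : K⟦X⟧ˣ} (hu : u ∈ (series (ω : K) L).toSubmonoid.units) :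
    unitsCoe u ∈ (laurent ω L).toSubmonoid.units := by
  obtain ⟨h1, h2⟩ := (Submonoid.mem_units_iff _ _).1 hu
  exact (Submonoid.mem_units_iff _ _).2 ⟨coe_mem_laurent h1, coe_mem_laurent h2⟩

/-- Over a field, orders add and leading coefficients multiply, so the leading coefficients `ω ^ m *
l` of `u` and `ω ^ (-m) * l'` of its inverse satisfy `l * l' = 1`. Thus `l` is invertible in `L`,
and after removal of `(ω * X) ^ m` there remains a power series with constant coefficient `l`. -/
lemma exists_eq_laurentMonomial_mul {ω : Kˣ} {u : (LaurentSeries K)ˣ}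
    (hu : u ∈ (laurent ω L).toSubmonoid.units) :
    ∃ (m : ℤ) (w : K⟦X⟧ˣ), w ∈ (series (ω : K) L).toSubmonoid.units ∧
      u = laurentMonomial ω m * unitsCoe w := by
  obtain ⟨h1, h2⟩ := (Submonoid.mem_units_iff _ _).1 hu
  have hu0 : (u : LaurentSeries K) ≠ 0 := u.ne_zero
  have hu0' : ((u⁻¹ : (LaurentSeries K)ˣ) : LaurentSeries K) ≠ 0 := u⁻¹.ne_zero
  have hord := HahnSeries.order_mul hu0 hu0'
  have hlead := HahnSeries.leadingCoeff_mul (u : LaurentSeries K) ((u⁻¹ : (LaurentSeries K)ˣ) :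
      LaurentSeries K)
  rw [Units.mul_inv, HahnSeries.order_one] at hord
  rw [Units.mul_inv, HahnSeries.leadingCoeff_one, HahnSeries.leadingCoeff_eq,
    HahnSeries.leadingCoeff_eq, eq_neg_of_add_eq_zero_right hord.symm] at hlead
  set m := (u : LaurentSeries K).order with hm
  obtain ⟨l, hl, e1⟩ := h1 m
  obtain ⟨l', hl', e2⟩ := h2 (-m)
  rw [e1, e2] at hlead
  have hll : l * l' = 1 := by
    have h : ((ω ^ m : Kˣ) : K) * ((ω ^ (-m) : Kˣ) : K) = 1 := by
      rw [← Units.val_mul, ← zpow_add, add_neg_cancel, zpow_zero, Units.val_one]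
    linear_combination -hlead - l * l' * h
  let F : K⟦X⟧ := C ((ω ^ (-m) : Kˣ) : K) * (u : LaurentSeries K).powerSeriesPart
  have hF0 : constantCoeff F = l := by
    rw [map_mul, constantCoeff_C, ← coeff_zero_eq_constantCoeff_apply,
      LaurentSeries.powerSeriesPart_coeff, Nat.cast_zero, add_zero, ← hm, e1, ← mul_assoc,
      ← Units.val_mul, ← zpow_add, neg_add_cancel, zpow_zero, Units.val_one, one_mul]
  have hl0 : l ≠ 0 := left_ne_zero_of_mul_eq_one hll
  have hFu : IsUnit F := PowerSeries.isUnit_iff_constantCoeff.2 (hF0 ▸ hl0.isUnit)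
  obtain ⟨w, hw⟩ := hFu
  refine ⟨m, w, mem_units_of_inv_mem ?_ ?_, Units.ext ?_⟩
  · rw [hw]
    intro n
    obtain ⟨l, hl, e⟩ := h1 (m + n)
    refine ⟨l, hl, ?_⟩
    rw [coeff_C_mul, LaurentSeries.powerSeriesPart_coeff, ← hm, e, ← mul_assoc,
      ← Units.val_mul, ← zpow_add, neg_add_cancel_left, zpow_natCast, Units.val_pow_eq_pow_val]
  · rw [hw, hF0, inv_eq_of_mul_eq_one_right hll]
    exact hl'
  · change _ = HahnSeries.single m ((ω ^ m : Kˣ) : K) * HahnSeries.ofPowerSeries ℤ K w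
    have h3 := LaurentSeries.single_order_mul_powerSeriesPart (u : LaurentSeries K)
    rw [← hm] at h3
    rw [hw, map_mul, HahnSeries.ofPowerSeries_C, HahnSeries.C_apply, ← mul_assoc,
      HahnSeries.single_mul_single, add_zero, ← Units.val_mul, ← zpow_add, add_neg_cancel,
          zpow_zero]
    exact h3.symm

/-- The monomial part of a unit is a unit for every ring of coefficients, so it can be put into the
first factor; the rest is the splitting for power series. -/
theorem units_laurent_le_sup {ω : Kˣ} (h₁ : L₁ ≤ L) (h₂ : L₂ ≤ L)
    (hadd : L.toAddSubgroup ≤ L₁.toAddSubgroup ⊔ L₂.toAddSubgroup)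
    (hmul : L.toSubmonoid.units ≤ L₁.toSubmonoid.units ⊔ L₂.toSubmonoid.units) :
    (laurent ω L).toSubmonoid.units ≤
      (laurent ω L₁).toSubmonoid.units ⊔ (laurent ω L₂).toSubmonoid.units := by
  intro u hu
  obtain ⟨m, w, hw, rfl⟩ := exists_eq_laurentMonomial_mul hu
  obtain ⟨a, ha, b, hb, rfl⟩ := Subgroup.mem_sup.1 (units_series_le_sup h₁ h₂ hadd hmul hw)
  rw [map_mul, ← mul_assoc]
  exact Subgroup.mul_mem_sup (mul_mem (laurentMonomial_mem ω m L₁) (unitsCoe_mem ha)) (unitsCoe_mem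
      hb)

/-! ### Localizations of a principal ideal domain inside a field -/

section Loc

variable {R : Type*} [CommRing R] (ι : R →+* K)

/-- The subring `ι(R)[1 / ι(f)]` of `K`. -/
def loc (f : R) : Subring K where
  carrier := {a | ∃ (N : ℕ) (p : R), a * ι f ^ N = ι p}
  mul_mem' := by
    rintro a b ⟨N, p, h⟩ ⟨M, q, h'⟩
    exact ⟨N + M, p * q, by rw [map_mul, ← h, ← h', pow_add]; ring⟩
  one_mem' := ⟨0, 1, by simp⟩
  add_mem' := by
    rintro a b ⟨N, p, h⟩ ⟨M, q, h'⟩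
    exact ⟨N + M, p * f ^ M + q * f ^ N, by
      rw [map_add, map_mul, map_mul, ← h, ← h', map_pow, map_pow, pow_add]; ring⟩
  zero_mem' := ⟨0, 0, by simp⟩
  neg_mem' := by
    rintro a ⟨N, p, h⟩
    exact ⟨N, -p, by rw [map_neg, ← h, neg_mul]⟩

variable {ι}

lemma mem_loc {f : R} {a : K} : a ∈ loc ι f ↔ ∃ (N : ℕ) (p : R), a * ι f ^ N = ι p := Iff.rfl

lemma map_mem_loc (f p : R) : ι p ∈ loc ι f := ⟨0, p, by simp⟩

lemma inv_mem_loc {f g : R} (hf : ι f ≠ 0) {N : ℕ} (h : g ∣ f ^ N) : (ι g)⁻¹ ∈ loc ι f := by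
  obtain ⟨q, hq⟩ := h
  have h1 : ι f ^ N = ι g * ι q := by rw [← map_pow, hq, map_mul]
  have hg : ι g ≠ 0 := fun h => pow_ne_zero N hf (by rw [h1, h, zero_mul])
  exact ⟨N, q, by rw [h1, inv_mul_cancel_left₀ hg]⟩

lemma loc_mono {f g : R} (hg : ι g ≠ 0) (h : f ∣ g) : loc ι f ≤ loc ι g := by
  rintro a ⟨N, p, ha⟩
  obtain ⟨q, rfl⟩ := h
  exact ⟨N, p * q ^ N, by rw [map_mul, mul_pow, ← mul_assoc, ha, map_mul, map_pow]⟩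

lemma mem_loc_one {a : K} : a ∈ loc ι 1 ↔ ∃ p, a = ι p := by
  simp [mem_loc]

variable [IsDomain R] [IsPrincipalIdealRing R]

/-- The generator `h` of the ideal `(f, g)` is cancelled from the Bézout relation, which shows that
the cofactors `f'` and `g'` are coprime; `f ≠ 0` guarantees `h ≠ 0`. -/
lemma exists_bezout (f g : R) (hf : f ≠ 0) :
    ∃ h f' g' x y : R, h = x * f + y * g ∧ f = h * f' ∧ g = h * g' ∧ x * f' + y * g' = 1 := by
  obtain ⟨h, hh⟩ := IsPrincipalIdealRing.principal (Ideal.span {f, g})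
  have hf' : f ∈ Ideal.span {h} := hh.le <| Ideal.subset_span (by simp)
  have hg' : g ∈ Ideal.span {h} := hh.le <| Ideal.subset_span (by simp)
  have hh' : h ∈ Ideal.span {f, g} := hh.ge <| Ideal.mem_span_singleton_self h
  obtain ⟨f', rfl⟩ := Ideal.mem_span_singleton.1 hf'
  obtain ⟨g', rfl⟩ := Ideal.mem_span_singleton.1 hg'
  obtain ⟨x, y, hxy⟩ := Ideal.mem_span_pair.1 hh'
  refine ⟨h, f', g', x, y, hxy.symm, rfl, rfl, mul_left_cancel₀ (left_ne_zero_of_mul hf) ?_⟩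
  linear_combination hxy

/-- Partial fractions. The common divisor `h` is invertible in both localizations, so only the
coprime parts have to be separated: dividing `x * f' ^ N + y * g' ^ N = 1` by `f' ^ N * g' ^ N` does
this. The exponent `2 * N` arises because `h` occurs in both `f` and `g`. -/
lemma loc_mul_le_sup (hι : Function.Injective ι) {f g : R} (hf : f ≠ 0) (hg : g ≠ 0) :
    (loc ι (f * g)).toAddSubgroup ≤ (loc ι f).toAddSubgroup ⊔ (loc ι g).toAddSubgroup := by
  rintro a ⟨N, p, ha⟩
  obtain ⟨h, f', g', x, y, -, rfl, rfl, hxy⟩ := exists_bezout f g hf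
  obtain ⟨x, y, hxy⟩ : IsCoprime (f' ^ N) (g' ^ N) := IsCoprime.pow ⟨x, y, hxy⟩
  have hιf : ι (h * f') ≠ 0 := (map_ne_zero_iff ι hι).2 hf
  have hιg : ι (h * g') ≠ 0 := (map_ne_zero_iff ι hι).2 hg
  rw [map_mul] at hιf hιg
  have hh : ι h ≠ 0 := left_ne_zero_of_mul hιf
  have hf' : ι f' ≠ 0 := right_ne_zero_of_mul hιf
  have hg' : ι g' ≠ 0 := right_ne_zero_of_mul hιg
  have hxy' := congrArg ι hxy
  simp only [map_add, map_mul, map_pow, map_one] at hxy' ha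
  refine AddSubgroup.mem_sup.2 ⟨ι p * ι y / (ι h ^ (2 * N) * ι f' ^ N),
    ⟨2 * N, p * y * f' ^ N, ?_⟩, ι p * ι x / (ι h ^ (2 * N) * ι g' ^ N),
    ⟨2 * N, p * x * g' ^ N, ?_⟩, ?_⟩
  · simp only [map_mul, map_pow]
    field_simp
    ring
  · simp only [map_mul, map_pow]
    field_simp
    ring
  · rw [div_add_div _ _ (by positivity) (by positivity), div_eq_iff (by positivity)]
    linear_combination ι p * ι h ^ (2 * N) * hxy' - ι h ^ (2 * N) * ha

/-- If `u = p / (f g) ^ N` has the inverse `q / (f g) ^ M`, then `p` divides `f ^ (N + M) * g ^ (N +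
M)`. In a principal ideal domain it factors as `p₁ p₂` accordingly, and `u = (p₁ / f ^ N) (p₂ / g ^
N)`. -/
lemma units_loc_mul_le_sup (hι : Function.Injective ι) {f g : R} (hf : f ≠ 0) (hg : g ≠ 0) :
    (loc ι (f * g)).toSubmonoid.units ≤
      (loc ι f).toSubmonoid.units ⊔ (loc ι g).toSubmonoid.units := by
  intro u hu
  obtain ⟨⟨N, p, hp⟩, ⟨M, q, hq⟩⟩ := (Submonoid.mem_units_iff _ _).1 hu
  have hιf : ι f ≠ 0 := (map_ne_zero_iff ι hι).2 hf
  have hιg : ι g ≠ 0 := (map_ne_zero_iff ι hι).2 hg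
  have hpq : p * q = f ^ (N + M) * g ^ (N + M) := by
    apply hι
    rw [map_mul, ← hp, ← hq, map_mul, map_mul, map_pow, map_pow]
    linear_combination (ι f * ι g) ^ (N + M) * u.mul_inv
  obtain ⟨p₁, p₂, ⟨x₁, h1⟩, ⟨x₂, h2⟩, rfl⟩ := exists_dvd_and_dvd_of_dvd_mul (Dvd.intro _ hpq)
  have hp1 : ι p₁ ≠ 0 := (map_ne_zero_iff ι hι).2 (left_ne_zero_of_mul (h1 ▸ pow_ne_zero _ hf))
  have hp2 : ι p₂ ≠ 0 := (map_ne_zero_iff ι hι).2 (left_ne_zero_of_mul (h2 ▸ pow_ne_zero _ hg))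
  have key : ∀ {p f : R} (hp : ι p ≠ 0) (hf : ι f ≠ 0) (M : ℕ), p ∣ f ^ M →
      Units.mk0 (ι p) hp * (Units.mk0 (ι f) hf ^ N)⁻¹ ∈ (loc ι f).toSubmonoid.units := by
    intro p f hp hf M h
    refine mul_mem ((Submonoid.mem_units_iff _ _).2 ⟨map_mem_loc f p, ?_⟩)
      (inv_mem (pow_mem ((Submonoid.mem_units_iff _ _).2 ⟨map_mem_loc f f, ?_⟩) N))
    · rw [Units.val_inv_eq_inv_val]; exact inv_mem_loc hf h
    · rw [Units.val_inv_eq_inv_val]; exact inv_mem_loc (N := 1) hf (by simp)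
  refine Subgroup.mem_sup.2 ⟨_, key hp1 hιf _ (Dvd.intro _ h1.symm), _,
    key hp2 hιg _ (Dvd.intro _ h2.symm), Units.ext ?_⟩
  simp only [Units.val_mul, Units.val_mk0, Units.val_inv_eq_inv_val, Units.val_pow_eq_pow_val]
  rw [map_mul, map_mul] at hp
  field_simp
  rw [mul_pow] at hp
  linear_combination -hp

end Loc

end SeriesSplitting

/-! ### Laurent polynomials in the coordinate of the line, and the group `G` inside the power series
-/

namespace SeriesSplitting

open PowerSeries

variable (k : Type u) [Field k]

/-- The field of Laurent series in a variable `v`, the coordinate on the line. -/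
abbrev Coord : Type u := LaurentSeries k

/-- The coordinate `v`. -/
def coord : (Coord k)ˣ := laurentMonomial 1 1

variable {k}

lemma coord_zpow (m : ℤ) : ((coord k ^ m : (Coord k)ˣ) : Coord k) = HahnSeries.single m 1 := by
  have key : ∀ n : ℕ, ((coord k ^ n : (Coord k)ˣ) : Coord k) = HahnSeries.single (n : ℤ) 1 := by
    intro n
    rw [Units.val_pow_eq_pow_val]
    simp [coord, laurentMonomial, HahnSeries.single_pow]
  rcases Int.eq_nat_or_neg m with ⟨n, rfl | rfl⟩
  · rw [zpow_natCast, key]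
  · rw [zpow_neg, zpow_natCast]
    refine Units.inv_eq_of_mul_eq_one_right ?_
    rw [key, HahnSeries.single_mul_single, add_neg_cancel, mul_one]
    rfl

/-- The evaluation of polynomials at `η`. -/
abbrev evalAt (η : (Coord k)ˣ) : Polynomial k →+* Coord k :=
  Polynomial.eval₂RingHom HahnSeries.C (η : Coord k)

lemma evalAt_eq_sum (e : ℤ) (p : Polynomial k) :
    evalAt (coord k ^ e) p = ∑ i ∈ Finset.range (p.natDegree + 1), HahnSeries.single (e * i)
        (p.coeff i) := by
  rw [Polynomial.coe_eval₂RingHom, Polynomial.eval₂_eq_sum_range]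
  refine Finset.sum_congr rfl fun i _ => ?_
  rw [← Units.val_pow_eq_pow_val, ← zpow_natCast, ← zpow_mul, coord_zpow]
  rw [HahnSeries.C_apply, HahnSeries.single_mul_single, zero_add, mul_one]

lemma coeff_evalAt {e : ℤ} (he : e ≠ 0) (p : Polynomial k) (i : ℕ) :
    (evalAt (coord k ^ e) p).coeff (e * i) = p.coeff i := by
  classical
  rw [evalAt_eq_sum, HahnSeries.coeff_sum]
  simp only [HahnSeries.coeff_single, mul_right_inj' he, Nat.cast_inj]
  rw [Finset.sum_ite_eq]
  split_ifs with h
  · rfl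
  · rw [Finset.mem_range, Nat.lt_succ_iff, not_le] at h
    exact (Polynomial.coeff_eq_zero_of_natDegree_lt h).symm

lemma coeff_evalAt_of_ne {e : ℤ} (p : Polynomial k) {j : ℤ} (h : ∀ i : ℕ, j ≠ e * i) :
    (evalAt (coord k ^ e) p).coeff j = 0 := by
  rw [evalAt_eq_sum, HahnSeries.coeff_sum]
  exact Finset.sum_eq_zero fun i _ => HahnSeries.coeff_single_of_ne (h i)

lemma evalAt_injective {e : ℤ} (he : e ≠ 0) : Function.Injective (evalAt (coord k ^ e)) := by
  intro p q h
  ext i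
  rw [← coeff_evalAt he, h, coeff_evalAt he]

lemma evalAt_C (η : (Coord k)ˣ) (c : k) : evalAt η (Polynomial.C c) = HahnSeries.single 0 c :=
  Polynomial.eval₂_C _ _

lemma evalAt_X (η : (Coord k)ˣ) : evalAt η Polynomial.X = η := Polynomial.eval₂_X _ _

/-- Elements of the Laurent series field with exponents strictly between `-n` and `0`. -/
def between (k : Type u) [Field k] (n : ℕ) : AddSubgroup (Coord k) where
  carrier := {a | ∀ j : ℤ, a.coeff j ≠ 0 → -n < j ∧ j < 0}
  add_mem' {a b} ha hb j h := by
    rw [HahnSeries.coeff_add] at h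
    by_cases h1 : a.coeff j = 0
    · exact hb j fun h2 => h (by rw [h1, h2, add_zero])
    · exact ha j h1
  zero_mem' j h := absurd rfl h
  neg_mem' {a} ha j h := ha j fun h' => h (by rw [HahnSeries.coeff_neg, h', neg_zero])

/-- The coefficient ring `k[v, 1 / v]`. -/
abbrev coeffs (k : Type u) [Field k] : Subring (Coord k) := loc (evalAt (coord k ^ (1 : ℤ)))
    Polynomial.X

/-- The coefficient ring `k[v]`. -/
abbrev coeffsLeft (k : Type u) [Field k] : Subring (Coord k) := loc (evalAt (coord k ^ (1 : ℤ))) 1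

/-- The coefficient ring `k[1 / v]`. -/
abbrev coeffsRight (k : Type u) [Field k] : Subring (Coord k) := loc (evalAt (coord k ^ (-1 : ℤ))) 1

lemma single_mem_coeffs (m : ℤ) (c : k) : (HahnSeries.single m c : Coord k) ∈ coeffs k := by
  have h1 : coord k ∈ (coeffs k).toSubmonoid.units := by
    refine (Submonoid.mem_units_iff _ _).2 ⟨⟨0, Polynomial.X, ?_⟩, ⟨1, 1, ?_⟩⟩
    · rw [pow_zero, mul_one, evalAt_X, zpow_one]
    · rw [pow_one, evalAt_X, zpow_one, Units.inv_mul, map_one]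
  have h2 := ((Submonoid.mem_units_iff _ _).1 (zpow_mem h1 m)).1
  have h3 : evalAt (coord k ^ (1 : ℤ)) (Polynomial.C c) ∈ coeffs k := map_mem_loc _ _
  have := mul_mem h2 h3
  rw [coord_zpow, evalAt_C, HahnSeries.single_mul_single, add_zero, one_mul] at this
  exact this

lemma piece_one (L : Subring (Coord k)) (n : ℕ) : piece 1 L n = L.toAddSubgroup := by
  ext a; simp [mem_piece]

lemma mem_coeffsLeft {a : Coord k} : a ∈ coeffsLeft k ↔ ∃ p, a = evalAt (coord k ^ (1 : ℤ)) p :=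
  mem_loc_one

lemma single_mem_coeffsLeft {m : ℤ} (hm : 0 ≤ m) (c : k) :
    (HahnSeries.single m c : Coord k) ∈ coeffsLeft k := by
  lift m to ℕ using hm
  refine mem_coeffsLeft.2 ⟨Polynomial.C c * Polynomial.X ^ m, ?_⟩
  rw [map_mul, map_pow, evalAt_X, evalAt_C, zpow_one, ← Units.val_pow_eq_pow_val, ← zpow_natCast,
    coord_zpow, HahnSeries.single_mul_single, zero_add, mul_one]

lemma single_mem_piece_right {m : ℤ} {n : ℕ} (hm : m ≤ -n) (c : k) :
    (HahnSeries.single m c : Coord k) ∈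
      piece ((coord k ^ (-1 : ℤ) : (Coord k)ˣ) : Coord k) (coeffsRight k) n := by
  obtain ⟨i, hi⟩ : ∃ i : ℕ, (i : ℤ) = -n - m := ⟨_, Int.toNat_of_nonneg (by omega)⟩
  refine mem_piece.2 ⟨_, mem_loc_one.2 ⟨Polynomial.C c * Polynomial.X ^ i, rfl⟩, ?_⟩
  rw [map_mul, map_pow, evalAt_X, evalAt_C, ← Units.val_pow_eq_pow_val, ← zpow_natCast, ← zpow_mul,
    ← Units.val_pow_eq_pow_val, ← zpow_natCast, ← zpow_mul,
    coord_zpow, coord_zpow, HahnSeries.single_mul_single, HahnSeries.single_mul_single, one_mul,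
    mul_one]
  congr 2
  omega

/-- A Laurent polynomial is sorted by its exponents: those `≥ 0`, those strictly between `-n` and 0,
and those `≤ -n`. -/
lemma coeffs_le_sup (n : ℕ) :
    piece 1 (coeffs k) n ≤ piece 1 (coeffsLeft k) n ⊔ between k n ⊔
      piece ((coord k ^ (-1 : ℤ) : (Coord k)ˣ) : Coord k) (coeffsRight k) n := by
  rw [piece_one, piece_one]
  rintro a ⟨N, p, h⟩
  have ha : a = ∑ i ∈ Finset.range (p.natDegree + 1), HahnSeries.single ((i : ℤ) - N) (p.coeff i)
      := by
    have h1 : a = evalAt (coord k ^ (1 : ℤ)) p * ((coord k ^ (-N : ℤ) : (Coord k)ˣ) : Coord k) := by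
      rw [← h, evalAt_X, mul_assoc, zpow_one, ← Units.val_pow_eq_pow_val, ← Units.val_mul,
        zpow_neg, zpow_natCast, mul_inv_cancel, Units.val_one, mul_one]
    rw [h1, evalAt_eq_sum, Finset.sum_mul]
    refine Finset.sum_congr rfl fun i _ => ?_
    rw [coord_zpow, HahnSeries.single_mul_single, mul_one, one_mul, sub_eq_add_neg]
  rw [ha]
  refine sum_mem fun i _ => ?_
  rcases le_or_gt 0 ((i : ℤ) - N) with h1 | h1
  · exact AddSubgroup.mem_sup_left (AddSubgroup.mem_sup_left (single_mem_coeffsLeft h1 _))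
  · rcases le_or_gt ((i : ℤ) - N) (-n) with h2 | h2
    · exact AddSubgroup.mem_sup_right (single_mem_piece_right h2 _)
    · refine AddSubgroup.mem_sup_left (AddSubgroup.mem_sup_right fun j hj => ?_)
      have : j = (i : ℤ) - N := by
        by_contra hne
        exact hj (HahnSeries.coeff_single_of_ne hne)
      omega

lemma coeffsLeft_le : coeffsLeft k ≤ coeffs k :=
  loc_mono (by rw [evalAt_X]; exact Units.ne_zero _) (one_dvd _)

lemma piece_right_le (n : ℕ) :
    piece ((coord k ^ (-1 : ℤ) : (Coord k)ˣ) : Coord k) (coeffsRight k) n ≤ piece 1 (coeffs k) n :=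
        by
  rw [piece_one]
  intro a ha
  rw [Subring.mem_toAddSubgroup]
  obtain ⟨l, hl, rfl⟩ := mem_piece.1 ha
  obtain ⟨p, rfl⟩ := mem_loc_one.1 hl
  rw [← Units.val_pow_eq_pow_val, ← zpow_natCast, ← zpow_mul, coord_zpow, evalAt_eq_sum]
  exact mul_mem (single_mem_coeffs _ _) (sum_mem fun i _ => single_mem_coeffs _ _)

lemma between_le (n : ℕ) : between k n ≤ piece 1 (coeffs k) n := by
  rw [piece_one]
  intro a ha
  -- Only finitely many exponents are possible. The summand with `i = 0` is harmless since the
  -- coefficient of exponent 0 vanishes.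
  have : a = ∑ i ∈ Finset.range n, HahnSeries.single (-(i : ℤ)) (a.coeff (-(i : ℤ))) := by
    classical
    ext j
    rw [HahnSeries.coeff_sum]
    simp only [HahnSeries.coeff_single]
    by_cases hj : a.coeff j = 0
    · rw [hj, Finset.sum_eq_zero]
      intro i _
      split_ifs with h
      · rw [← h, hj]
      · rfl
    · obtain ⟨h1, h2⟩ := ha j hj
      rw [Finset.sum_eq_single (-j).toNat]
      · rw [if_pos (by omega)]; congr 1; omega
      · intro i _ hi
        rw [if_neg (by omega)]
      · intro h; exact absurd (Finset.mem_range.2 (by omega)) h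
  rw [this]
  exact sum_mem fun i _ => single_mem_coeffs _ _

/-- For `n ≥ 1` the exponents that occur in the three pieces form disjoint ranges. In degree 0 this
fails, as the scalars belong to both outer rings. -/
lemma eq_zero_of_add_eq {n : ℕ} (hn : n ≠ 0) {a b c : Coord k} (ha : a ∈ coeffsLeft k)
    (hb : b ∈ between k n)
    (hc : c ∈ piece ((coord k ^ (-1 : ℤ) : (Coord k)ˣ) : Coord k) (coeffsRight k) n)
    (h : b = a + c) : a = 0 ∧ b = 0 ∧ c = 0 := by
  have ha' : ∀ j : ℤ, j < 0 → a.coeff j = 0 := by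
    intro j hj
    obtain ⟨p, rfl⟩ := mem_coeffsLeft.1 ha
    exact coeff_evalAt_of_ne p fun i => by omega
  have hc' : ∀ j : ℤ, -(n : ℤ) < j → c.coeff j = 0 := by
    intro j hj
    obtain ⟨l, hl, rfl⟩ := mem_piece.1 hc
    obtain ⟨p, rfl⟩ := mem_loc_one.1 hl
    rw [← Units.val_pow_eq_pow_val, ← zpow_natCast, ← zpow_mul, coord_zpow]
    obtain ⟨i, rfl⟩ : ∃ i, j = i + -1 * n := ⟨j + n, by ring⟩
    rw [HahnSeries.coeff_single_mul_add, one_mul]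
    exact coeff_evalAt_of_ne p fun i => by omega
  have hb' : ∀ j : ℤ, ¬ (-(n : ℤ) < j ∧ j < 0) → b.coeff j = 0 := fun j hj => by
    by_contra h; exact hj (hb j h)
  have hj : ∀ j, b.coeff j = a.coeff j + c.coeff j := fun j => by rw [h, HahnSeries.coeff_add]
  refine ⟨?_, ?_, ?_⟩
  all_goals
    ext j
    rw [HahnSeries.coeff_zero]
    have h0 := hj j
    by_cases h1 : j < 0
    · by_cases h2 : -(n : ℤ) < j
      · simp [ha' j h1, hc' j h2] at h0 ⊢
        try exact h0.symm
        try exact h0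
      · simp [ha' j h1, hb' j (by omega)] at h0 ⊢
        try exact h0.symm
        try exact h0
    · simp [hc' j (by omega), hb' j (by omega)] at h0 ⊢
      try exact h0.symm
      try exact h0

/-- Uniqueness of the decomposition of power series with constant coefficient one. -/
lemma eq_one_of_eq_mul {a b c : (Coord k)⟦X⟧}
    (ha : a ∈ series 1 (coeffsLeft k)) (ha0 : constantCoeff a = 1)
    (hc : c ∈ series ((coord k ^ (-1 : ℤ) : (Coord k)ˣ) : Coord k) (coeffsRight k))
    (hc0 : constantCoeff c = 1) (hb0 : constantCoeff b = 1)
    (hb : ∀ n, n ≠ 0 → coeff n b ∈ between k n) (h : b = a * c) : b = 1 := by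
  have key : ∀ n, n ≠ 0 → coeff n a = 0 ∧ coeff n b = 0 ∧ coeff n c = 0 := by
    intro n
    induction n using Nat.strong_induction_on with
    | _ n ih =>
      intro hn
      -- By induction the coefficients of `a` in degrees between 0 and `n` vanish, so all mixed
      -- terms of the product disappear.
      have h1 : coeff n b = coeff n a + coeff n c := by
        rw [h, coeff_mul]
        have : ∀ p ∈ Finset.HasAntidiagonal.antidiagonal n, coeff p.1 a * coeff p.2 c =
            (if p.2 = 0 then coeff n a else 0) + (if p.1 = 0 then coeff n c else 0) := by
          rintro ⟨i, j⟩ hp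
          rw [Finset.HasAntidiagonal.mem_antidiagonal] at hp
          dsimp only at hp ⊢
          rcases eq_or_ne i 0 with rfl | hi
          · rw [zero_add] at hp
            subst hp
            simp [ha0, hn]
          · rcases eq_or_ne j 0 with rfl | hj
            · rw [add_zero] at hp
              subst hp
              simp [hc0, hn]
            · rw [if_neg hi, if_neg hj, (ih i (by omega) hi).1, zero_mul, add_zero]
        rw [Finset.sum_congr rfl this, Finset.sum_add_distrib]
        congr 1
        · rw [Finset.sum_eq_single (n, 0)]
          · simp
          · rintro ⟨i, j⟩ hp hne
            rw [Finset.HasAntidiagonal.mem_antidiagonal] at hp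
            refine if_neg fun h => hne ?_
            dsimp only at h hp
            rw [h, add_zero] at hp
            rw [h, hp]
          · intro h; exact absurd (Finset.HasAntidiagonal.mem_antidiagonal.2 (add_zero n)) h
        · rw [Finset.sum_eq_single (0, n)]
          · simp
          · rintro ⟨i, j⟩ hp hne
            rw [Finset.HasAntidiagonal.mem_antidiagonal] at hp
            refine if_neg fun h => hne ?_
            dsimp only at h hp
            rw [h, zero_add] at hp
            rw [h, hp]
          · intro h; exact absurd (Finset.HasAntidiagonal.mem_antidiagonal.2 (zero_add n)) h
      have h2 : coeff n a ∈ coeffsLeft k := by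
        obtain ⟨l, hl, h⟩ := ha n
        rw [h, one_pow, one_mul]; exact hl
      exact eq_zero_of_add_eq hn h2 (hb n hn) (mem_piece.2 (hc n)) h1
  ext n
  rcases eq_or_ne n 0 with rfl | hn
  · simp [hb0]
  · rw [(key n hn).2.1, coeff_one, if_neg hn]

/-! ### The series `1 + x⁻¹ y⁻¹ k[[x⁻¹, y⁻¹]]` -/

/-- The values of `x⁻¹` and `y⁻¹` in terms of `X = x⁻¹` and the coordinate. -/
def invXY (k : Type u) [Field k] : Fin 2 → (Coord k)⟦X⟧ :=
  ![X, C ((coord k ^ (-1 : ℤ) : (Coord k)ˣ) : Coord k) * X]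

lemma hasSubst_invXY : MvPowerSeries.HasSubst (invXY k) := by
  refine MvPowerSeries.hasSubst_of_constantCoeff_zero fun i => ?_
  fin_cases i
  · exact PowerSeries.constantCoeff_X
  · change constantCoeff (C _ * X) = 0
    simp

/-- The substitution homomorphism. -/
def substXY (k : Type u) [Field k] : MvPowerSeries (Fin 2) k →+* (Coord k)⟦X⟧ :=
  (MvPowerSeries.substAlgHom (R := k) (hasSubst_invXY (k := k))).toRingHom

lemma prod_invXY (d : Fin 2 →₀ ℕ) : (d.prod fun s e => invXY k s ^ e) =
    C (HahnSeries.single (-(d 1 : ℤ)) 1) * X ^ (d 0 + d 1) := by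
  rw [Finsupp.prod_fintype _ _ (fun _ => pow_zero _), Fin.prod_univ_two]
  change X ^ d 0 * (C _ * X) ^ d 1 = _
  rw [mul_pow, ← map_pow, ← Units.val_pow_eq_pow_val, ← zpow_natCast, ← zpow_mul, coord_zpow,
    neg_one_mul, pow_add]
  ring

/-- The exponent `(a, b)`. -/
def expo (a b : ℕ) : Fin 2 →₀ ℕ := Finsupp.equivFunOnFinite.symm ![a, b]

lemma expo_eta (d : Fin 2 →₀ ℕ) : expo (d 0) (d 1) = d := by
  ext i; fin_cases i <;> rfl

/-- The monomial with exponents `(a, b)` becomes `v ^ (-b) * X ^ (a + b)`. The power of `X` records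
the total degree, and the power of `v` separates the monomials of the same degree; in particular the
substitution loses no coefficient. -/
lemma coeff_substXY (g : MvPowerSeries (Fin 2) k) (n : ℕ) :
    coeff n (substXY k g) = ∑ b ∈ Finset.range (n + 1),
      HahnSeries.single (-(b : ℤ)) (MvPowerSeries.coeff (expo (n - b) b) g) := by
  have h1 : coeff n (substXY k g) = finsum (fun d : Fin 2 →₀ ℕ =>
      HahnSeries.C (MvPowerSeries.coeff d g) * coeff n (d.prod fun s e => invXY k s ^ e)) := by
    change coeff n (MvPowerSeries.substAlgHom (hasSubst_invXY (k := k)) g) = _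
    rw [MvPowerSeries.substAlgHom_apply]
    refine (MvPowerSeries.coeff_subst (hasSubst_invXY (k := k)) g _).trans (finsum_congr fun d =>
        ?_)
    rw [Algebra.smul_def, LaurentSeries.algebraMap_apply k]
    rfl
  classical
  have h2 : ∀ d : Fin 2 →₀ ℕ, HahnSeries.C (MvPowerSeries.coeff d g) *
      coeff n (d.prod fun s e => invXY k s ^ e) =
      if n = d 0 + d 1 then HahnSeries.single (-(d 1 : ℤ)) (MvPowerSeries.coeff d g) else 0 := by
    intro d
    rw [prod_invXY, coeff_C_mul, coeff_X_pow, HahnSeries.C_apply]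
    split_ifs
    · rw [mul_one, HahnSeries.single_mul_single, zero_add, mul_one]
    · rw [mul_zero, mul_zero]
  rw [h1, finsum_congr h2, finsum_eq_sum_of_support_subset (s := (Finset.range (n + 1)).image
    fun b => expo (n - b) b), Finset.sum_image]
  · refine Finset.sum_congr rfl fun b hb => ?_
    rw [Finset.mem_range] at hb
    exact if_pos (show n = (n - b) + b by omega)
  · intro b _ b' _ h
    exact congrArg (fun d : Fin 2 →₀ ℕ => d 1) h
  · intro d hd
    rw [Function.mem_support] at hd
    have h : n = d 0 + d 1 := by
      by_contra h; exact hd (if_neg h)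
    rw [Finset.mem_coe, Finset.mem_image]
    refine ⟨d 1, Finset.mem_range.2 (by omega), ?_⟩
    rw [h, Nat.add_sub_cancel, expo_eta]

lemma coeff_coeff_substXY (g : MvPowerSeries (Fin 2) k) {n b : ℕ} (hb : b ≤ n) :
    (coeff n (substXY k g)).coeff (-(b : ℤ)) = MvPowerSeries.coeff (expo (n - b) b) g := by
  classical
  rw [coeff_substXY, HahnSeries.coeff_sum]
  simp only [HahnSeries.coeff_single, neg_inj, Nat.cast_inj]
  rw [Finset.sum_ite_eq, if_pos (Finset.mem_range.2 (by omega))]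

lemma coeff_coeff_substXY_of_ne (g : MvPowerSeries (Fin 2) k) {n : ℕ} {j : ℤ}
    (h : ∀ b : ℕ, b ≤ n → j ≠ -b) : (coeff n (substXY k g)).coeff j = 0 := by
  rw [coeff_substXY, HahnSeries.coeff_sum]
  refine Finset.sum_eq_zero fun b hb => HahnSeries.coeff_single_of_ne (h b ?_)
  exact Nat.lt_succ_iff.1 (Finset.mem_range.1 hb)

lemma substXY_injective : Function.Injective (substXY k) := by
  intro g h hgh
  ext d
  have := coeff_coeff_substXY g (Nat.le_add_left (d 1) (d 0))
  rw [hgh, coeff_coeff_substXY h (Nat.le_add_left (d 1) (d 0)),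
    Nat.add_sub_cancel, expo_eta] at this
  exact this.symm

/-- Both variables are sent to multiples of `X`, so discarding the monomials of total degree at
least `n` changes nothing modulo `X ^ n`. This links the substitution with the truncations that
define the value of a power series. -/
lemma dvd_substXY_sub_truncTotal (g : MvPowerSeries (Fin 2) k) (n : ℕ) :
    (X : (Coord k)⟦X⟧) ^ n ∣ substXY k g - MvPolynomial.aeval (invXY k) (g.truncTotal n) := by
  have h1 : MvPolynomial.aeval (invXY k) (g.truncTotal n) = substXY k ↑(g.truncTotal n) :=
    (MvPowerSeries.substAlgHom_coe hasSubst_invXY _).symm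
  rw [h1, ← map_sub, X_pow_dvd_iff]
  intro m hm
  rw [coeff_substXY]
  refine Finset.sum_eq_zero fun b hb => ?_
  have hd : (expo (m - b) b).degree < n := by
    have : (expo (m - b) b).degree = (m - b) + b := by
      rw [Finsupp.degree_eq_sum, Fin.sum_univ_two]; rfl
    have := Finset.mem_range.1 hb
    omega
  rw [map_sub, MvPolynomial.coeff_coe, MvPowerSeries.coeff_truncTotal _ hd, sub_self, map_zero]

-- Divisibility by the product of the two variables is tested one variable at a time, and
-- divisibility by a variable can be read off from the coefficients on one axis.
open ProjPlane in
lemma mem_G_iff {u : (MvPowerSeries (Fin 2) k)ˣ} : u ∈ G k ↔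
    ∀ a b : ℕ, a = 0 ∨ b = 0 → MvPowerSeries.coeff (expo a b) (u : MvPowerSeries (Fin 2) k) =
      if a = 0 ∧ b = 0 then 1 else 0 := by
  have h00 : ∀ a b : ℕ, expo a b = 0 ↔ a = 0 ∧ b = 0 := by
    intro a b
    constructor
    · intro h
      exact ⟨congrArg (fun d : Fin 2 →₀ ℕ => d 0) h, congrArg (fun d : Fin 2 →₀ ℕ => d 1) h⟩
    · rintro ⟨rfl, rfl⟩
      ext i; fin_cases i <;> rfl
  classical
  constructor
  · rintro ⟨h, hh⟩ a b hab
    rw [hh, map_add, MvPowerSeries.coeff_one]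
    have : MvPowerSeries.coeff (expo a b) (MvPowerSeries.X 0 * MvPowerSeries.X 1 * h) = 0 := by
      rcases hab with rfl | rfl
      · have hd : (MvPowerSeries.X 0 : MvPowerSeries (Fin 2) k) ∣
            MvPowerSeries.X 0 * MvPowerSeries.X 1 * h := (dvd_mul_right _ _).mul_right _
        exact MvPowerSeries.X_dvd_iff.1 hd _ rfl
      · have hd : (MvPowerSeries.X 1 : MvPowerSeries (Fin 2) k) ∣
            MvPowerSeries.X 0 * MvPowerSeries.X 1 * h := (dvd_mul_left _ _).mul_right _
        exact MvPowerSeries.X_dvd_iff.1 hd _ rfl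
    simp only [this, add_zero, h00]
  · intro h
    have h0 : MvPowerSeries.X 0 ∣ (u : MvPowerSeries (Fin 2) k) - 1 := by
      refine MvPowerSeries.X_dvd_iff.2 fun m hm => ?_
      rw [← expo_eta m, map_sub, MvPowerSeries.coeff_one, h _ _ (Or.inl hm)]
      simp only [h00, sub_self]
    obtain ⟨q, hq⟩ := h0
    have h1 : MvPowerSeries.X 1 ∣ q := by
      refine MvPowerSeries.X_dvd_iff.2 fun m hm => ?_
      have h2 := MvPowerSeries.coeff_add_monomial_mul (Finsupp.single 0 1) m q (1 : k)
      rw [one_mul] at h2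
      rw [← h2]
      change MvPowerSeries.coeff _ (MvPowerSeries.X 0 * q) = 0
      rw [← hq, ← expo_eta (Finsupp.single 0 1 + m), map_sub, MvPowerSeries.coeff_one,
        h _ _ (Or.inr (by simpa using hm))]
      simp only [h00, sub_self]
    obtain ⟨r, rfl⟩ := h1
    exact ⟨r, by linear_combination hq⟩

/-- The units of the ring of power series which come from the group `G`. -/
def substG (k : Type u) [Field k] : ProjPlane.G k →* (Coord k)⟦X⟧ˣ :=
  (Units.map (substXY k).toMonoidHom).comp (ProjPlane.G k).subtype

lemma coe_substG (g : ProjPlane.G k) :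
    (substG k g : (Coord k)⟦X⟧) = substXY k (g.1 : MvPowerSeries (Fin 2) k) := rfl

lemma substG_injective : Function.Injective (substG k) := fun _ _ h =>
  Subtype.ext (Units.ext (substXY_injective (congrArg Units.val h)))

lemma constantCoeff_substG (g : ProjPlane.G k) : constantCoeff (substG k g : (Coord k)⟦X⟧) = 1 := by
  rw [coe_substG, ← coeff_zero_eq_constantCoeff_apply, coeff_substXY, zero_add,
      Finset.sum_range_one,
    mem_G_iff.1 g.2 _ _ (Or.inl rfl), if_pos ⟨rfl, rfl⟩]
  rfl

/-- A monomial of degree `n` with both exponents positive has second exponent `b` with `0 < b < n`,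
and it contributes `v ^ (-b)`. -/
lemma coeff_substG_mem (g : ProjPlane.G k) {n : ℕ} (hn : n ≠ 0) :
    coeff n (substG k g : (Coord k)⟦X⟧) ∈ between k n := by
  intro j hj
  rw [coe_substG] at hj
  by_cases h : ∃ b : ℕ, b ≤ n ∧ j = -b
  · obtain ⟨b, hb, rfl⟩ := h
    rw [coeff_coeff_substXY _ hb] at hj
    by_contra hne
    refine hj ((mem_G_iff.1 g.2 _ _ ?_).trans (if_neg ?_)) <;> omega
  · push Not at h
    exact absurd (coeff_coeff_substXY_of_ne _ h) hj

/-- The coefficient of `g` at the exponents `(i, j)` has to be that of `v ^ (-j) * X ^ (i + j)` in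
`b`. The range of exponents in `between` forces the coefficients on the two axes to vanish outside
the origin. -/
lemma exists_substG_eq {b : (Coord k)⟦X⟧} (hb0 : constantCoeff b = 1)
    (hb : ∀ n, n ≠ 0 → coeff n b ∈ between k n) : ∃ g : ProjPlane.G k, substG k g = b := by
  let g : MvPowerSeries (Fin 2) k := fun d => (coeff (d 0 + d 1) b).coeff (-(d 1 : ℤ))
  have hg : ∀ d, MvPowerSeries.coeff d g = (coeff (d 0 + d 1) b).coeff (-(d 1 : ℤ)) := fun _ => rfl
  have hg0 : MvPowerSeries.constantCoeff g = 1 := by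
    rw [← MvPowerSeries.coeff_zero_eq_constantCoeff_apply, hg]
    simp [hb0]
  obtain ⟨u, hu⟩ := MvPowerSeries.isUnit_iff_constantCoeff.2 (hg0 ▸ isUnit_one)
  have huG : u ∈ ProjPlane.G k := by
    refine mem_G_iff.2 fun i j hij => ?_
    rw [hu, hg]
    change (coeff (i + j) b).coeff (-(j : ℤ)) = _
    split_ifs with h
    · obtain ⟨rfl, rfl⟩ := h
      simp [hb0]
    · by_contra hne
      have := hb (i + j) (by omega) _ hne
      omega
  refine ⟨⟨u, huG⟩, ?_⟩
  rw [coe_substG]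
  dsimp only
  rw [hu]
  ext n j
  by_cases h : ∃ b : ℕ, b ≤ n ∧ j = -b
  · obtain ⟨i, hi, rfl⟩ := h
    rw [coeff_coeff_substXY _ hi, hg]
    change (coeff (n - i + i) b).coeff (-(i : ℤ)) = _
    rw [Nat.sub_add_cancel hi]
  · push Not at h
    rw [coeff_coeff_substXY_of_ne _ h]
    rcases eq_or_ne n 0 with rfl | hn
    · rw [coeff_zero_eq_constantCoeff_apply, hb0, HahnSeries.coeff_one, if_neg]
      simpa using h 0 le_rfl
    · by_contra hne
      have h1 := hb n hn j (Ne.symm hne)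
      exact h (-j).toNat (by omega) (by omega)

/-! ### The decomposition of units on the overlap -/

/-- The numerator of a unit divides a power of the prime `Polynomial.X`, hence is a scalar times a
power of it. -/
lemma exists_of_mem_units_coeffs {u : (Coord k)ˣ} (hu : u ∈ (coeffs k).toSubmonoid.units) :
    ∃ (m : ℤ) (c : kˣ), (u : Coord k) = HahnSeries.single m (c : k) := by
  obtain ⟨⟨N, p, hp⟩, ⟨M, q, hq⟩⟩ := (Submonoid.mem_units_iff _ _).1 hu
  have hpq : p * q = Polynomial.X ^ (N + M) := by
    apply evalAt_injective (k := k) one_ne_zero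
    rw [map_mul, ← hp, ← hq, map_pow, pow_add]
    linear_combination (evalAt (coord k ^ (1 : ℤ)) Polynomial.X) ^ N *
      (evalAt (coord k ^ (1 : ℤ)) Polynomial.X) ^ M * u.mul_inv
  obtain ⟨i, -, hi⟩ := (dvd_prime_pow Polynomial.prime_X _).1 (Dvd.intro _ hpq)
  obtain ⟨w, hw⟩ := hi.symm
  obtain ⟨c, hc, hcw⟩ := Polynomial.isUnit_iff.1 w.isUnit
  refine ⟨i - N, hc.unit, ?_⟩
  have h1 : (u : Coord k) = evalAt (coord k ^ (1 : ℤ)) p * ((coord k ^ (-N : ℤ) : (Coord k)ˣ) :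
      Coord k) := by
    rw [← hp, evalAt_X, mul_assoc, zpow_one, ← Units.val_pow_eq_pow_val, ← Units.val_mul,
      zpow_neg, zpow_natCast, mul_inv_cancel, Units.val_one, mul_one]
  rw [h1, ← hw, ← hcw, map_mul, map_pow, evalAt_X, evalAt_C, zpow_one, ← Units.val_pow_eq_pow_val,
    ← zpow_natCast, coord_zpow, coord_zpow, HahnSeries.single_mul_single,
        HahnSeries.single_mul_single,
    one_mul, mul_one, add_zero, sub_eq_add_neg]
  rfl

/-- Constant power series, as units. -/
abbrev unitsC : (Coord k)ˣ →* (Coord k)⟦X⟧ˣ := Units.map (C (R := Coord k)).toMonoidHom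

lemma unitsC_mem {ω : Coord k} {L : Subring (Coord k)} {y : (Coord k)ˣ}
    (hy : y ∈ L.toSubmonoid.units) : unitsC y ∈ (series ω L).toSubmonoid.units := by
  obtain ⟨h1, h2⟩ := (Submonoid.mem_units_iff _ _).1 hy
  exact (Submonoid.mem_units_iff _ _).2 ⟨C_mem_series h1, C_mem_series h2⟩

/-- Every unit on the overlap is the product of units on the two charts, a power of the coordinate
and an element of `G`. -/
theorem exists_decomposition {u : (Coord k)⟦X⟧ˣ}
    (hu : u ∈ (series 1 (coeffs k)).toSubmonoid.units) :
    ∃ (n : ℤ) (g : ProjPlane.G k) (a c : (Coord k)⟦X⟧ˣ),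
      u = a * (unitsC (coord k ^ n) * substG k g) * c ∧
      a ∈ (series 1 (coeffsLeft k)).toSubmonoid.units ∧
      c ∈ (series ((coord k ^ (-1 : ℤ) : (Coord k)ˣ) : Coord k) (coeffsRight k)).toSubmonoid.units
          := by
  obtain ⟨n, y, hy⟩ := exists_of_mem_units_coeffs (constantCoeff_mem_units hu)
  -- The constant coefficient is a scalar times `v ^ n`. The scalar is absorbed into the factor on
  -- the first chart, and the power of `v` is the discrete invariant.
  let c₀ : (Coord k)ˣ := Units.map (HahnSeries.C (Γ := ℤ) (R := k)).toMonoidHom y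
  have hc₀ : c₀ ∈ (coeffsLeft k).toSubmonoid.units :=
    (Submonoid.mem_units_iff _ _).2 ⟨single_mem_coeffsLeft le_rfl _, single_mem_coeffsLeft le_rfl _⟩
  have hn : coord k ^ n ∈ (coeffs k).toSubmonoid.units := by
    refine (Submonoid.mem_units_iff _ _).2 ⟨?_, ?_⟩
    · rw [coord_zpow]; exact single_mem_coeffs _ _
    · rw [← zpow_neg, coord_zpow]; exact single_mem_coeffs _ _
  have hu0 : Units.map (constantCoeff (R := Coord k)).toMonoidHom u = c₀ * coord k ^ n := by
    refine Units.ext (hy.trans ?_)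
    rw [Units.val_mul, coord_zpow]
    change _ = HahnSeries.single 0 (y : k) * _
    rw [HahnSeries.single_mul_single, zero_add, mul_one]
  let u' := u * (unitsC (c₀ * coord k ^ n))⁻¹
  have hu' : u' ∈ (series 1 (coeffs k)).toSubmonoid.units :=
    mul_mem hu (inv_mem (unitsC_mem (mul_mem (Submonoid.units_mono coeffsLeft_le hc₀) hn)))
  have hu'0 : constantCoeff (u' : (Coord k)⟦X⟧) = 1 := by
    have h1 : u' * unitsC (c₀ * coord k ^ n) = u := inv_mul_cancel_right _ _
    have h2 := congrArg (Units.map (constantCoeff (R := Coord k)).toMonoidHom) h1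
    rw [map_mul, hu0] at h2
    have h3 : Units.map (constantCoeff (R := Coord k)).toMonoidHom (unitsC (c₀ * coord k ^ n)) =
      c₀ * coord k ^ n := Units.ext (constantCoeff_C _)
    rw [h3] at h2
    exact congrArg Units.val (mul_eq_right.1 h2)
  obtain ⟨a, b, c, habc, ha, ha0, hc, hc0, hb0, hb⟩ := exists_mul_mul (ω := 1) (ω₁ := 1)
    (ω₂ := ((coord k ^ (-1 : ℤ) : (Coord k)ˣ) : Coord k)) (L := coeffs k) (L₁ := coeffsLeft k)
    (L₂ := coeffsRight k) (between k) (fun n => AddSubgroup.map_mono coeffsLeft_le) piece_right_le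
    between_le (fun n _ => coeffs_le_sup n) ((Submonoid.mem_units_iff _ _).1 hu').1 hu'0
  obtain ⟨g, rfl⟩ := exists_substG_eq hb0 hb
  obtain ⟨a, rfl⟩ := isUnit_of_constantCoeff_eq_one ha0
  obtain ⟨c, rfl⟩ := isUnit_of_constantCoeff_eq_one hc0
  refine ⟨n, g, unitsC c₀ * a, c, ?_, mul_mem (unitsC_mem hc₀) (mem_units_of_inv_mem ha ?_),
    mem_units_of_inv_mem hc ?_⟩
  · have h1 : u' = a * substG k g * c := Units.ext habc
    have h2 : u = u' * unitsC (c₀ * coord k ^ n) := (inv_mul_cancel_right _ _).symm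
    rw [h2, h1, map_mul]
    simp only [mul_assoc, mul_left_comm, mul_comm]
  · rw [ha0, inv_one]; exact one_mem _
  · rw [hc0, inv_one]; exact one_mem _

/-- The units of a polynomial ring over a field are the nonzero constants. -/
lemma eq_single_of_mem_units {e : ℤ} (he : e ≠ 0) {u : (Coord k)ˣ}
    (hu : u ∈ (loc (evalAt (coord k ^ e)) 1).toSubmonoid.units) :
    ∃ c : k, (u : Coord k) = HahnSeries.single 0 c ∧
      (u : Coord k)⁻¹ ∈ (loc (evalAt (coord k ^ e)) 1) := by
  obtain ⟨h1, h2⟩ := (Submonoid.mem_units_iff _ _).1 hu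
  obtain ⟨p, hp⟩ := mem_loc_one.1 h1
  obtain ⟨q, hq⟩ := mem_loc_one.1 h2
  have hpq : p * q = 1 := by
    apply evalAt_injective he
    rw [map_mul, ← hp, ← hq, map_one, Units.mul_inv]
  obtain ⟨c, -, hc⟩ := Polynomial.isUnit_iff.1 (IsUnit.of_mul_eq_one _ hpq)
  exact ⟨c, by rw [hp, ← hc, evalAt_C], by rw [← Units.val_inv_eq_inv_val]; exact h2⟩

/-- On each chart the constant coefficient of a unit is a scalar, so comparison of constant
coefficients forces `n = 0`. Normalizing both factors to constant coefficient 1 then reduces the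
claim to `eq_one_of_eq_mul`. -/
theorem eq_one_of_decomposition {n : ℤ} {g : ProjPlane.G k} {a c : (Coord k)⟦X⟧ˣ}
    (ha : a ∈ (series 1 (coeffsLeft k)).toSubmonoid.units)
    (hc : c ∈ (series ((coord k ^ (-1 : ℤ) : (Coord k)ˣ) : Coord k)
      (coeffsRight k)).toSubmonoid.units)
    (h : unitsC (coord k ^ n) * substG k g = a * c) : n = 0 ∧ g = 1 := by
  obtain ⟨x, hx, hx'⟩ := eq_single_of_mem_units one_ne_zero (constantCoeff_mem_units ha)
  obtain ⟨y, hy, hy'⟩ := eq_single_of_mem_units (by decide) (constantCoeff_mem_units hc)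
  have h' : C ((coord k ^ n : (Coord k)ˣ) : Coord k) * (substG k g : (Coord k)⟦X⟧) = a * c :=
    congrArg Units.val h
  have h0 := congrArg constantCoeff h'
  have hx₁ : constantCoeff (a : (Coord k)⟦X⟧) = HahnSeries.single 0 x := hx
  have hy₁ : constantCoeff (c : (Coord k)⟦X⟧) = HahnSeries.single 0 y := hy
  rw [map_mul, map_mul, constantCoeff_C, constantCoeff_substG, mul_one, hx₁, hy₁,
    HahnSeries.single_mul_single, coord_zpow, add_zero] at h0
  have hn : n = 0 := by
    by_contra hn
    have := congrArg (fun F : Coord k => F.coeff n) h0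
    simp only [HahnSeries.coeff_single_same, HahnSeries.coeff_single_of_ne hn] at this
    exact one_ne_zero this
  subst hn
  refine ⟨rfl, substG_injective ?_⟩
  have hx0 : constantCoeff (a : (Coord k)⟦X⟧) ≠ 0 := (a.isUnit.map constantCoeff).ne_zero
  have hy0 : constantCoeff (c : (Coord k)⟦X⟧) ≠ 0 := (c.isUnit.map constantCoeff).ne_zero
  have hxy : constantCoeff (a : (Coord k)⟦X⟧) * constantCoeff (c : (Coord k)⟦X⟧) = 1 := by
    rw [hx₁, hy₁, HahnSeries.single_mul_single, add_zero, ← h0]; rfl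
  rw [map_one]
  -- The two constant coefficients have product 1, so dividing each factor by its own does not
  -- change `a * c`.
  refine Units.ext (eq_one_of_eq_mul (a := C (constantCoeff (a : (Coord k)⟦X⟧))⁻¹ * (a : (Coord
      k)⟦X⟧))
    (c := C (constantCoeff (c : (Coord k)⟦X⟧))⁻¹ * (c : (Coord k)⟦X⟧)) ?_ ?_ ?_ ?_
    (constantCoeff_substG g) (fun n hn => coeff_substG_mem g hn) ?_)
  · exact mul_mem (C_mem_series hx') ((Submonoid.mem_units_iff _ _).1 ha).1
  · rw [map_mul, constantCoeff_C, inv_mul_cancel₀ hx0]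
  · exact mul_mem (C_mem_series hy') ((Submonoid.mem_units_iff _ _).1 hc).1
  · rw [map_mul, constantCoeff_C, inv_mul_cancel₀ hy0]
  · rw [zpow_zero, Units.val_one, map_one, one_mul] at h'
    rw [h']
    have : C (constantCoeff (a : (Coord k)⟦X⟧))⁻¹ * C (constantCoeff (c : (Coord k)⟦X⟧))⁻¹ =
      (1 : (Coord k)⟦X⟧) := by
      rw [← map_mul, ← mul_inv, hxy, inv_one, map_one]
    linear_combination (-(a : (Coord k)⟦X⟧) * c) * this

/-- Every unit on the punctured overlap is the product of units on the two punctured charts and an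
element of `G`. -/
theorem exists_decomposition_laurent {u : (LaurentSeries (Coord k))ˣ}
    (hu : u ∈ (laurent 1 (coeffs k)).toSubmonoid.units) :
    ∃ (g : ProjPlane.G k) (a c : (LaurentSeries (Coord k))ˣ),
      u = a * unitsCoe (substG k g) * c ∧
      a ∈ (laurent 1 (coeffsLeft k)).toSubmonoid.units ∧
      c ∈ (laurent (coord k ^ (-1 : ℤ)) (coeffsRight k)).toSubmonoid.units := by
  obtain ⟨m, w, hw, rfl⟩ := exists_eq_laurentMonomial_mul hu
  obtain ⟨n, g, a, c, rfl, ha, hc⟩ := exists_decomposition hw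
  -- This is `v ^ n = X ^ n * (v⁻¹ * X) ^ (-n)`. The equation of the line is a unit on each
  -- punctured chart, so the power of `v` becomes a coboundary and the factor ℤ is lost.
  have key : unitsCoe (unitsC (coord k ^ n)) =
      laurentMonomial 1 n * laurentMonomial (coord k ^ (-1 : ℤ)) (-n) := by
    refine Units.ext ?_
    change HahnSeries.ofPowerSeries ℤ (Coord k) (C _) = HahnSeries.single _ _ * HahnSeries.single _
        _
    rw [HahnSeries.ofPowerSeries_C, HahnSeries.single_mul_single, add_neg_cancel, one_zpow,
      Units.val_one, one_mul, ← zpow_mul, neg_mul_neg, one_mul]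
    rfl
  refine ⟨g, laurentMonomial 1 m * laurentMonomial 1 n * unitsCoe a,
    laurentMonomial (coord k ^ (-1 : ℤ)) (-n) * unitsCoe c, ?_,
    mul_mem (mul_mem (laurentMonomial_mem _ _ _) (laurentMonomial_mem _ _ _)) (unitsCoe_mem ha),
    mul_mem (laurentMonomial_mem _ _ _) (unitsCoe_mem hc)⟩
  rw [map_mul, map_mul, map_mul, key]
  simp only [mul_assoc]
  rw [mul_left_comm (laurentMonomial (coord k ^ (-1 : ℤ)) (-n)) (unitsCoe (substG k g)),
    mul_left_comm (unitsCoe a) (laurentMonomial 1 n)]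

/-- The monomial parts of the two factors have opposite orders in `X`, so together they amount to a
power of `v`. This brings the relation back to the one for power series. -/
theorem eq_one_of_decomposition_laurent {g : ProjPlane.G k} {a c : (LaurentSeries (Coord k))ˣ}
    (ha : a ∈ (laurent 1 (coeffsLeft k)).toSubmonoid.units)
    (hc : c ∈ (laurent (coord k ^ (-1 : ℤ)) (coeffsRight k)).toSubmonoid.units)
    (h : unitsCoe (substG k g) = a * c) : g = 1 := by
  obtain ⟨m, a, ha', rfl⟩ := exists_eq_laurentMonomial_mul ha
  obtain ⟨l, c, hc', rfl⟩ := exists_eq_laurentMonomial_mul hc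
  have h1 : unitsCoe (substG k g * (a * c)⁻¹) =
      laurentMonomial 1 m * laurentMonomial (coord k ^ (-1 : ℤ)) l := by
    rw [map_mul, h, map_inv, map_mul, mul_inv_eq_iff_eq_mul, mul_mul_mul_comm]
  have h2 : HahnSeries.ofPowerSeries ℤ (Coord k)
      ((substG k g * (a * c)⁻¹ : (Coord k)⟦X⟧ˣ) : (Coord k)⟦X⟧) =
      HahnSeries.single (m + l) (((coord k) ^ (-l) : (Coord k)ˣ) : Coord k) := by
    refine (congrArg Units.val h1).trans ?_
    change HahnSeries.single _ _ * HahnSeries.single _ _ = _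
    rw [HahnSeries.single_mul_single, one_zpow, Units.val_one, one_mul, ← zpow_mul, neg_one_mul]
  -- The left side of `h2` is a power series with nonzero constant coefficient, while the right side
  -- is concentrated in degree `m + l`.
  have h3 : m + l = 0 := by
    have h4 := (((substG k g * (a * c)⁻¹ : (Coord k)⟦X⟧ˣ)).isUnit.map constantCoeff).ne_zero
    rw [← coeff_zero_eq_constantCoeff_apply, ← LaurentSeries.coeff_coe_powerSeries, h2] at h4
    by_contra hne
    exact h4 (HahnSeries.coeff_single_of_ne (Ne.symm hne))
  rw [h3] at h2
  have h4 : substG k g * (a * c)⁻¹ = unitsC (coord k ^ (-l)) := by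
    refine Units.ext (HahnSeries.ofPowerSeries_injective (Γ := ℤ) (h2.trans ?_))
    exact (HahnSeries.ofPowerSeries_C _).symm
  refine (eq_one_of_decomposition (n := l) (g := g) ha' hc' ?_).2
  rw [zpow_neg, map_inv, mul_inv_eq_iff_eq_mul] at h4
  rw [h4, mul_inv_cancel_left]

end SeriesSplitting

/-! ### Functions on the formal completion as compatible systems -/

namespace FormalCompletion
open Limits

variable {X : Scheme.{u}} (I : X.IdealSheafData)

/-- Sections over `W`, as a functor to types. -/
abbrev sectionsFunctor (W : Opens (space I)) :
    Sheaf (Opens.grothendieckTopology (space I)) CommRingCat.{u} ⥤ Type u :=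
  sheafToPresheaf _ _ ⋙ (evaluation _ _).obj (op W) ⋙ forget CommRingCat

/-- The sections of the structure sheaf form a limit. -/
def isLimitSections (W : Opens (space I)) :
    IsLimit ((sectionsFunctor I W).mapCone (limit.cone (Functor.ofOpSequence (nbhdRestr I)))) :=
  isLimitOfPreserves _ (limit.isLimit _)

variable {I}

lemma section_ext {W : Opens (space I)} {c d : (structureSheaf I).presheaf.obj (op W)}
    (h : ∀ n, reduction I n W c = reduction I n W d) : c = d :=
  (Types.isLimitEquivSections (isLimitSections I W)).injective
    (Subtype.ext (funext fun n => h n.unop))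

/-- Taking sections preserves limits, and compatibility of neighbouring terms propagates to all
transition maps of the sequence. -/
lemma exists_section {W : Opens (space I)}
    (x : ∀ n, Γ(nbhd I n, (Opens.map (nbhdToSpace I n)).obj W))
    (h : ∀ n, (nbhdRestr I n).hom.app (op W) (x (n + 1)) = x n) :
    ∃ c, ∀ n, reduction I n W c = x n := by
  let F := Functor.ofOpSequence (nbhdRestr I) ⋙ sectionsFunctor I W
  have key : ∀ (m d : ℕ), (F.map (homOfLE (Nat.le_add_right m d)).op) (x (m + d)) = x m := by
    intro m d
    induction d with
    | zero => exact ConcreteCategory.congr_hom (F.map_id (op m)) (x m)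
    | succ d ih =>
      have e : (homOfLE (Nat.le_add_right m (d + 1))).op =
        (homOfLE (Nat.le_succ (m + d))).op ≫ (homOfLE (Nat.le_add_right m d)).op := rfl
      refine (ConcreteCategory.congr_hom ((congrArg F.map e).trans (F.map_comp _ _)) _).trans ?_
      refine (congrArg (F.map (homOfLE (Nat.le_add_right m d)).op) ?_).trans ih
      refine Eq.trans ?_ (h (m + d))
      exact ConcreteCategory.congr_hom (congrArg (sectionsFunctor I W).map
        (Functor.ofOpSequence_map_homOfLE_succ (nbhdRestr I) (m + d))) _
  let y : F.sections := ⟨fun n => x n.unop, by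
    rintro ⟨m⟩ ⟨n⟩ f
    obtain ⟨d, rfl⟩ := Nat.exists_eq_add_of_le f.unop.le
    exact key n d⟩
  refine ⟨(Types.isLimitEquivSections (isLimitSections I W)).symm y, fun n => ?_⟩
  exact Types.isLimitEquivSections_symm_apply (isLimitSections I W) y (op n)

lemma restrictNbhd_eq_appLE (n : ℕ) (V : X.Opens) (W : Opens (space I))
    (h : W ≤ (Opens.map (incl I)).obj V) :
    restrictNbhd I n V W h =
      (I ^ (n + 1)).subschemeι.appLE V ((Opens.map (nbhdToSpace I n)).obj W)
        ((Opens.map (nbhdToSpace I n)).map (homOfLE h)).le :=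
  rfl

lemma nbhdRestr_app_eq_appLE (n : ℕ) (W : Opens (space I)) : (nbhdRestr I n).hom.app (op W) =
    (Scheme.IdealSheafData.inclusion (pow_succ_le I n)).appLE
      ((Opens.map (nbhdToSpace I (n + 1))).obj W) ((Opens.map (nbhdToSpace I n)).obj W)
        (congrArg (fun g => (Opens.map g).obj W) (inclusion_base_nbhdToSpace I n)).ge :=
  rfl

lemma nbhdRestr_restrictNbhd (n : ℕ) (V : X.Opens) (W : Opens (space I))
    (h : W ≤ (Opens.map (incl I)).obj V) (f : Γ(X, V)) :
    (nbhdRestr I n).hom.app (op W) (restrictNbhd I (n + 1) V W h f) =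
      restrictNbhd I n V W h f := by
  -- The morphism occurs in the proof argument of `appLE`; replacing it by a variable `g` allows the
  -- substitution of an equal morphism.
  have key : ∀ (g : nbhd I n ⟶ X) (_ : (I ^ (n + 1)).subschemeι = g) (e),
      (I ^ (n + 1)).subschemeι.appLE V ((Opens.map (nbhdToSpace I n)).obj W)
        ((Opens.map (nbhdToSpace I n)).map (homOfLE h)).le =
      g.appLE V ((Opens.map (nbhdToSpace I n)).obj W) e := by
    rintro _ rfl e
    rfl
  have : restrictNbhd I (n + 1) V W h ≫ (nbhdRestr I n).hom.app (op W) =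
      restrictNbhd I n V W h := by
    rw [nbhdRestr_app_eq_appLE, restrictNbhd_eq_appLE, restrictNbhd_eq_appLE]
    refine (Scheme.Hom.appLE_comp_appLE _ _ _ _ _ _ _).trans (key _ ?_ _).symm
    exact (Scheme.IdealSheafData.inclusion_subschemeι (pow_succ_le I n)).symm
  exact ConcreteCategory.congr_hom this f

lemma restrictNbhd_preimage (n : ℕ) (V : X.Opens) :
    restrictNbhd I n V _ (le_refl ((Opens.map (incl I)).obj V)) =
      (I ^ (n + 1)).subschemeι.app V :=
  (congrArg _ ((nbhd I n).presheaf.map_id _)).trans (Category.comp_id _)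

variable {V : X.Opens} (hV : IsAffineOpen V) (n : ℕ)
include hV

lemma restrictNbhd_surjective : Function.Surjective
    (restrictNbhd I n V _ (le_refl ((Opens.map (incl I)).obj V))) := by
  rw [restrictNbhd_preimage]
  exact (I ^ (n + 1)).subschemeι_app_surjective ⟨V, hV⟩

lemma restrictNbhd_eq_zero_iff (f : Γ(X, V)) :
    restrictNbhd I n V _ (le_refl ((Opens.map (incl I)).obj V)) f = 0 ↔
      f ∈ I.ideal ⟨V, hV⟩ ^ (n + 1) := by
  have h := (I ^ (n + 1)).ker_subschemeι_app ⟨V, hV⟩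
  rw [Scheme.IdealSheafData.ideal_pow, Pi.pow_apply] at h
  rw [← h, RingHom.mem_ker, restrictNbhd_preimage]
  rfl

end FormalCompletion

/-! ### Arcs and their lifts to the infinitesimal neighbourhoods -/

namespace FormalCompletion
open PowerSeries

section evalSpec
variable {Y Y' : Scheme.{u}} {R S : Type u} [CommRing R] [CommRing S]

/-- Pullback of functions on `V` to `R` along `Spec R ⟶ Y` with image in `V`. -/
def evalSpec (g : Spec (.of R) ⟶ Y) (V : Y.Opens) (h : ⊤ ≤ g ⁻¹ᵁ V) : Γ(Y, V) →+* R :=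
  (g.appLE V ⊤ h ≫ (Scheme.ΓSpecIso _).hom).hom

lemma evalSpec_res (g : Spec (.of R) ⟶ Y) {V V' : Y.Opens} (i : V' ⟶ V) (h : ⊤ ≤ g ⁻¹ᵁ V')
    (h' : ⊤ ≤ g ⁻¹ᵁ V) (a : Γ(Y, V)) :
    evalSpec g V' h (Y.presheaf.map i.op a) = evalSpec g V h' a := by
  have := ConcreteCategory.congr_hom (congrArg (· ≫ (Scheme.ΓSpecIso (.of R)).hom)
    (g.map_appLE h i.op)) a
  exact this

lemma evalSpec_appLE (g : Spec (.of R) ⟶ Y) (f : Y ⟶ Y') (V : Y'.Opens) (W : Y.Opens)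
    (e : W ≤ f ⁻¹ᵁ V) (h : ⊤ ≤ g ⁻¹ᵁ W) (h' : ⊤ ≤ (g ≫ f) ⁻¹ᵁ V) (a : Γ(Y', V)) :
    evalSpec g W h (f.appLE V W e a) = evalSpec (g ≫ f) V h' a := by
  have := ConcreteCategory.congr_hom (congrArg (· ≫ (Scheme.ΓSpecIso (.of R)).hom)
    (Scheme.Hom.appLE_comp_appLE g f V W ⊤ e h)) a
  exact this

lemma evalSpec_map (g : Spec (.of R) ⟶ Y) (φ : R →+* S) (V : Y.Opens) (h : ⊤ ≤ g ⁻¹ᵁ V)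
    (h' : ⊤ ≤ (Spec.map (CommRingCat.ofHom φ) ≫ g) ⁻¹ᵁ V) (a : Γ(Y, V)) :
    evalSpec (Spec.map (CommRingCat.ofHom φ) ≫ g) V h' a = φ (evalSpec g V h a) := by
  have h1 : (Spec.map (CommRingCat.ofHom φ) ≫ g).appLE V ⊤ h' =
      g.appLE V ⊤ h ≫ (Spec.map (CommRingCat.ofHom φ)).appLE ⊤ ⊤ le_rfl :=
    (Scheme.Hom.appLE_comp_appLE _ _ _ _ _ _ _).symm
  have h2 : (Spec.map (CommRingCat.ofHom φ)).appLE ⊤ ⊤ le_rfl ≫ (Scheme.ΓSpecIso (.of S)).hom =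
      (Scheme.ΓSpecIso (.of R)).hom ≫ CommRingCat.ofHom φ := by
    rw [← Scheme.ΓSpecIso_naturality]
    congr 1
  have := ConcreteCategory.congr_hom ((congrArg (· ≫ (Scheme.ΓSpecIso (.of S)).hom) h1).trans
    ((Category.assoc _ _ _).trans (congrArg (g.appLE V ⊤ h ≫ ·) h2))) a
  exact this

/-- A function on `Spec R` is a unit exactly if it vanishes nowhere. This translates between the
position of an arc relative to open sets and invertibility of power series. -/
lemma isUnit_evalSpec_iff (g : Spec (.of R) ⟶ Y) (V : Y.Opens) (h : ⊤ ≤ g ⁻¹ᵁ V) (a : Γ(Y, V)) :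
    IsUnit (evalSpec g V h a) ↔ ⊤ ≤ g ⁻¹ᵁ Y.basicOpen a := by
  have h1 : IsUnit (evalSpec g V h a) ↔ IsUnit (g.appLE V ⊤ h a) := by
    refine ⟨fun h' => ?_, fun h' => h'.map (Scheme.ΓSpecIso (.of R)).hom.hom⟩
    have := h'.map (Scheme.ΓSpecIso (.of R)).inv.hom
    have e : (Scheme.ΓSpecIso (.of R)).inv.hom (evalSpec g V h a) = g.appLE V ⊤ h a :=
      ConcreteCategory.congr_hom (Scheme.ΓSpecIso (.of R)).hom_inv_id (g.appLE V ⊤ h a)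
    exact e ▸ this
  have h2 := Scheme.basicOpen_appLE g ⊤ V h a
  rw [h1]
  constructor
  · intro hu
    rw [Scheme.basicOpen_of_isUnit _ hu] at h2
    exact h2.le.trans inf_le_right
  · intro hle
    rw [inf_eq_left.2 hle] at h2
    have h3 := (RingedSpace.isUnit_res_basicOpen (Spec (.of R)).toRingedSpace (g.appLE V ⊤ h a))
    have h4 := h3.map ((Spec (.of R)).presheaf.map (homOfLE h2.ge).op).hom
    have h5 := ConcreteCategory.congr_hom (((Spec (.of R)).presheaf.map_comp (homOfLE ((Spec (.of
        R)).basicOpen_le (g.appLE V ⊤ h a))).op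
      (homOfLE h2.ge).op).symm.trans ((Spec (.of R)).presheaf.map_id _)) (g.appLE V ⊤ h a)
    exact (congrArg IsUnit h5).mp h4
end evalSpec

lemma top_le_preimage {R : Type u} [CommRing R] [IsLocalRing R] {Y : Scheme.{u}} (g : Spec (.of R)
    ⟶ Y) {V : Y.Opens}
    (h : g (IsLocalRing.closedPoint R) ∈ V) : ⊤ ≤ g ⁻¹ᵁ V :=
  ((IsLocalRing.closed_point_mem_iff (R := R) (U := (g ⁻¹ᵁ V))).1 h).ge

variable {X : Scheme.{u}} (I : X.IdealSheafData) {K : Type u} [Field K] (j : Spec (.of K⟦X⟧) ⟶ X)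

/-- The image of the closed point of an arc. -/
def arcPoint : X := j (IsLocalRing.closedPoint K⟦X⟧)

variable {j} in
lemma arcPoint_mem_iff {V : X.Opens} : arcPoint j ∈ V ↔ ⊤ ≤ j ⁻¹ᵁ V :=
  ⟨fun h => top_le_preimage j h, fun h => h trivial⟩

-- Sections of `I` vanish at the closed point of the arc, so their pullbacks are not units, and over
-- a field a power series that is not a unit has constant coefficient 0.
variable {I j} in
lemma X_dvd_evalSpec (hj : arcPoint j ∈ I.support) (U : X.affineOpens) (h : ⊤ ≤ j ⁻¹ᵁ U.1)
    {a : Γ(X, U)} (ha : a ∈ I.ideal U) : PowerSeries.X ∣ evalSpec j U h a := by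
  have h1 := (Scheme.IdealSheafData.mem_support_iff_of_mem (arcPoint_mem_iff.2 h)).1 hj
  rw [Scheme.mem_zeroLocus_iff] at h1
  have h2 := h1 a ha
  rw [arcPoint_mem_iff, ← isUnit_evalSpec_iff _ _ h] at h2
  rw [PowerSeries.X_dvd_iff]
  by_contra h3
  exact h2 (PowerSeries.isUnit_iff_constantCoeff.2 (Ne.isUnit h3))

variable (K) in
/-- Power series modulo `X ^ (n + 1)`. -/
abbrev Trunc (n : ℕ) : Type u := K⟦X⟧ ⧸ Ideal.span {(PowerSeries.X ^ (n + 1) : K⟦X⟧)}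

/-- The truncation of an arc. -/
def truncArc (n : ℕ) : Spec (.of (Trunc K n)) ⟶ X :=
  Spec.map (CommRingCat.ofHom (Ideal.Quotient.mk _)) ≫ j

/-- A prime ideal of `K⟦X⟧` that contains `X ^ (n + 1)` contains `X`, hence is the maximal ideal:
the truncated arc sees only one point. -/
lemma truncArc_apply (n : ℕ) (x : Spec (.of (Trunc K n))) : truncArc j n x = arcPoint j := by
  change j _ = j _
  congr 1
  apply PrimeSpectrum.ext
  change Ideal.comap (Ideal.Quotient.mk _) (PrimeSpectrum.asIdeal x) = IsLocalRing.maximalIdeal K⟦X⟧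
  have : (Ideal.comap (Ideal.Quotient.mk (Ideal.span {(PowerSeries.X ^ (n + 1) : K⟦X⟧)}))
      (PrimeSpectrum.asIdeal x)).IsPrime := Ideal.IsPrime.comap _ (hK := x.2)
  refine le_antisymm (IsLocalRing.le_maximalIdeal this.ne_top) ?_
  rw [PowerSeries.maximalIdeal_eq_span_X, Ideal.span_singleton_le_iff_mem]
  refine this.mem_of_pow_mem (n + 1) ?_
  rw [Ideal.mem_comap, Ideal.Quotient.eq_zero_iff_mem.2 (Ideal.mem_span_singleton_self _)]
  exact zero_mem _

lemma subsingleton_of_eq_bot {Y : Scheme.{u}} {U : Y.Opens} (h : U = ⊥) : Subsingleton Γ(Y, U) := by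
  constructor
  intro a b
  exact TopCat.Sheaf.eq_of_locally_eq' Y.sheaf (fun x : Empty => x.elim) U (fun x => x.elim)
    (by rw [h]; exact bot_le) a b (fun x => x.elim)

/-- The arc pulls `I` back into `(X)`, hence `I ^ (n + 1)` into `(X ^ (n + 1))`. This is the
condition for the truncated arc to factor through the infinitesimal neighbourhood. -/
lemma ker_truncArc {I : X.IdealSheafData} {j : Spec (.of K⟦X⟧) ⟶ X} (hj : arcPoint j ∈ I.support)
    (n : ℕ) :
    I ^ (n + 1) ≤ (truncArc j n).ker := by
  apply Scheme.IdealSheafData.le_ofIdeals_iff.2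
  intro U a ha
  rw [RingHom.mem_ker]
  by_cases hU : arcPoint j ∈ U.1
  · have h1 : ⊤ ≤ truncArc j n ⁻¹ᵁ U.1 := fun x _ => by
      change truncArc j n x ∈ U.1
      rwa [truncArc_apply]
    have h2 := arcPoint_mem_iff.1 hU
    have h3 : evalSpec (truncArc j n) U.1 h1 a = 0 := by
      refine (evalSpec_map j _ U.1 h2 h1 a).trans ?_
      rw [Ideal.Quotient.eq_zero_iff_mem]
      rw [Scheme.IdealSheafData.ideal_pow, Pi.pow_apply] at ha
      have h4 : I.ideal U ≤ (Ideal.span {(PowerSeries.X : K⟦X⟧)}).comap (evalSpec j U.1 h2) :=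
        fun b hb => Ideal.mem_span_singleton.2 (X_dvd_evalSpec hj U h2 hb)
      have h5 := (Ideal.pow_right_mono h4 (n + 1)).trans (Ideal.le_comap_pow _ _) ha
      rw [Ideal.span_singleton_pow] at h5
      exact h5
    have h6 : (truncArc j n).appLE U.1 ⊤ h1 a = 0 :=
      (ConcreteCategory.bijective_of_isIso (Scheme.ΓSpecIso (.of (Trunc K n))).hom).1
        (h3.trans (map_zero _).symm)
    have h7 : (Spec (.of (Trunc K n))).presheaf.map (homOfLE h1).op ((truncArc j n).app U.1 a) = 0
        := h6
    have h8 := ConcreteCategory.congr_hom (((Spec (.of (Trunc K n))).presheaf.map_comp (homOfLE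
        h1).op
      (homOfLE le_top).op).symm.trans ((Spec (.of (Trunc K n))).presheaf.map_id _)) ((truncArc j
          n).app U.1 a)
    refine h8.symm.trans ?_
    refine (congrArg ((Spec (.of (Trunc K n))).presheaf.map (homOfLE le_top).op) h7).trans ?_
    exact map_zero _
  -- If the affine open set misses the point of the arc, its preimage is empty and carries only the
  -- zero function.
  · have := subsingleton_of_eq_bot (U := truncArc j n ⁻¹ᵁ U.1) (eq_bot_iff.2 fun x hx => hU (by
      change truncArc j n x ∈ U.1 at hx
      rwa [truncArc_apply] at hx))
    exact Subsingleton.elim _ _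

variable {I : X.IdealSheafData} {j : Spec (.of K⟦X⟧) ⟶ X} (hj : arcPoint j ∈ I.support)

/-- The lift of the truncated arc to the infinitesimal neighbourhood. -/
def liftArc (n : ℕ) : Spec (.of (Trunc K n)) ⟶ nbhd I n :=
  IsClosedImmersion.lift (I ^ (n + 1)).subschemeι (truncArc j n)
    ((I ^ (n + 1)).ker_subschemeι.trans_le (ker_truncArc hj n))

lemma liftArc_subschemeι (n : ℕ) : liftArc hj n ≫ (I ^ (n + 1)).subschemeι = truncArc j n :=
  IsClosedImmersion.lift_fac _ _ _

lemma liftArc_nbhdToSpace (n : ℕ) (x : Spec (.of (Trunc K n))) :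
    nbhdToSpace I n (liftArc hj n x) = ⟨arcPoint j, hj⟩ := by
  apply Subtype.ext
  refine Eq.trans ?_ (truncArc_apply j n x)
  rw [← liftArc_subschemeι hj]
  rfl

lemma top_le_liftArc (n : ℕ) {W : Opens (space I)} (hW : (⟨arcPoint j, hj⟩ : space I) ∈ W) :
    ⊤ ≤ liftArc hj n ⁻¹ᵁ ((Opens.map (nbhdToSpace I n)).obj W) := fun x _ => by
  change nbhdToSpace I n (liftArc hj n x) ∈ W
  rwa [liftArc_nbhdToSpace]

/-- The Taylor expansion of order `n` along an arc. -/
def taylor (n : ℕ) (W : Opens (space I)) (hW : (⟨arcPoint j, hj⟩ : space I) ∈ W) :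
    Γ(nbhd I n, (Opens.map (nbhdToSpace I n)).obj W) →+* Trunc K n :=
  evalSpec (liftArc hj n) _ (top_le_liftArc hj n hW)

lemma evalSpec_congr {Y : Scheme.{u}} {R : Type u} [CommRing R] {g g' : Spec (.of R) ⟶ Y} (e : g =
    g') {V : Y.Opens}
    (h : ⊤ ≤ g ⁻¹ᵁ V) (h' : ⊤ ≤ g' ⁻¹ᵁ V) (a : Γ(Y, V)) : evalSpec g V h a = evalSpec g' V h' a :=
        by
  subst e; rfl

lemma taylor_restrictNbhd (n : ℕ) (V : X.Opens) (W : Opens (space I))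
    (h : W ≤ (Opens.map (incl I)).obj V) (hW : (⟨arcPoint j, hj⟩ : space I) ∈ W) (f : Γ(X, V)) :
    taylor hj n W hW (restrictNbhd I n V W h f) =
      Ideal.Quotient.mk _ (evalSpec j V (arcPoint_mem_iff.1 (h hW)) f) := by
  have h1 : ⊤ ≤ truncArc j n ⁻¹ᵁ V := fun x _ => by
    change truncArc j n x ∈ V
    rw [truncArc_apply]
    exact h hW
  have h2 : ⊤ ≤ (liftArc hj n ≫ (I ^ (n + 1)).subschemeι) ⁻¹ᵁ V := by
    rwa [liftArc_subschemeι]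
  refine (evalSpec_appLE (liftArc hj n) _ V _ _ _ h2 f).trans ?_
  exact (evalSpec_congr (liftArc_subschemeι hj n) h2 h1 f).trans (evalSpec_map j _ V _ h1 f)

lemma taylor_res (n : ℕ) {W W' : Opens (space I)} (i : W' ⟶ W)
    (hW : (⟨arcPoint j, hj⟩ : space I) ∈ W') (a : Γ(nbhd I n, (Opens.map (nbhdToSpace I n)).obj W))
        :
    taylor hj n W' hW ((nbhd I n).presheaf.map ((Opens.map (nbhdToSpace I n)).map i).op a) =
      taylor hj n W (i.le hW) a :=
  evalSpec_res _ _ _ _ _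

variable (K) in
/-- Truncation. -/
def truncSucc (n : ℕ) : Trunc K (n + 1) →+* Trunc K n :=
  Ideal.Quotient.factor (by
    rw [Ideal.span_singleton_le_span_singleton]
    exact pow_dvd_pow _ (Nat.le_succ _))

lemma liftArc_succ (n : ℕ) : Spec.map (CommRingCat.ofHom (truncSucc K n)) ≫ liftArc hj (n + 1) =
    liftArc hj n ≫ Scheme.IdealSheafData.inclusion (pow_succ_le I n) := by
  rw [← cancel_mono (I ^ (n + 1 + 1)).subschemeι, Category.assoc, Category.assoc,
    Scheme.IdealSheafData.inclusion_subschemeι, liftArc_subschemeι, liftArc_subschemeι, truncArc,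
        truncArc, ← Category.assoc,
    ← Spec.map_comp]
  rfl

lemma taylor_nbhdRestr (n : ℕ) (W : Opens (space I)) (hW : (⟨arcPoint j, hj⟩ : space I) ∈ W)
    (a : Γ(nbhd I (n + 1), (Opens.map (nbhdToSpace I (n + 1))).obj W)) :
    taylor hj n W hW ((nbhdRestr I n).hom.app (op W) a) =
      truncSucc K n (taylor hj (n + 1) W hW a) := by
  have h1 := liftArc_succ hj n
  have h2 : ⊤ ≤ (Spec.map (CommRingCat.ofHom (truncSucc K n)) ≫ liftArc hj (n + 1)) ⁻¹ᵁ
      ((Opens.map (nbhdToSpace I (n + 1))).obj W) :=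
    (Spec.map (CommRingCat.ofHom (truncSucc K n))).preimage_mono (top_le_liftArc hj (n + 1) hW)
  have h3 := h1 ▸ h2
  refine (evalSpec_appLE (liftArc hj n) _ _ _ _ _ h3 a).trans ?_
  exact (evalSpec_congr h1 h2 h3 a).symm.trans (evalSpec_map _ _ _ _ h2 a)

end FormalCompletion

/-! ### Expansion along an arc of functions on the formal completion -/

namespace FormalCompletion
open PowerSeries

variable {X : Scheme.{u}} {I : X.IdealSheafData} {K : Type u} [Field K]
  {j : Spec (.of K⟦X⟧) ⟶ X} (hj : arcPoint j ∈ I.support)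

lemma nbhdRestr_reduction (n : ℕ) (W : Opens (space I)) (c : (structureSheaf I).presheaf.obj (op
    W)) :
    (nbhdRestr I n).hom.app (op W) (reduction I (n + 1) W c) = reduction I n W c := by
  have h := Limits.limit.w (C := Sheaf (Opens.grothendieckTopology (space I)) CommRingCat.{u})
    (Functor.ofOpSequence (nbhdRestr I)) (homOfLE n.le_succ).op
  rw [Functor.ofOpSequence_map_homOfLE_succ] at h
  exact ConcreteCategory.congr_hom (congrArg (fun g => g.hom.app (op W)) h) c

lemma mk_eq_mk_iff (n : ℕ) (F G : K⟦X⟧) :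
    (Ideal.Quotient.mk _ F : Trunc K n) = Ideal.Quotient.mk _ G ↔ PowerSeries.X ^ (n + 1) ∣ F - G
        := by
  rw [Ideal.Quotient.eq, Ideal.mem_span_singleton]

lemma eq_of_forall_mk_eq {F G : K⟦X⟧}
    (h : ∀ n, (Ideal.Quotient.mk _ F : Trunc K n) = Ideal.Quotient.mk _ G) : F = G :=
  SeriesSplitting.eq_of_forall_dvd fun n =>
    (pow_dvd_pow _ n.le_succ).trans ((mk_eq_mk_iff n F G).1 (h n))

variable {W : Opens (space I)} (hW : (⟨arcPoint j, hj⟩ : space I) ∈ W)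

/-- The Taylor expansions of all orders are compatible with truncation, so arbitrary lifts of them
converge `X`-adically. -/
lemma exists_expansion (c : (structureSheaf I).presheaf.obj (op W)) :
    ∃ F : K⟦X⟧, ∀ n, (Ideal.Quotient.mk _ F : Trunc K n) = taylor hj n W hW (reduction I n W c) :=
        by
  choose a ha using fun n => Ideal.Quotient.mk_surjective (taylor hj n W hW (reduction I n W c))
  obtain ⟨b, hb⟩ := SeriesSplitting.exists_limit a fun n => by
    refine (pow_dvd_pow _ n.le_succ).trans ((mk_eq_mk_iff n _ _).1 ?_)
    rw [ha, ← nbhdRestr_reduction, taylor_nbhdRestr, ← ha]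
    rfl
  refine ⟨b, fun n => ?_⟩
  -- The limit is controlled modulo `X ^ (n + 1)` only by the term with index `n + 1`, hence the
  -- detour through the next order.
  rw [← nbhdRestr_reduction, taylor_nbhdRestr, ← ha (n + 1)]
  exact (mk_eq_mk_iff n _ _).2 (hb (n + 1))

/-- The expansion along an arc of a function on the formal completion. -/
def expansion : (structureSheaf I).presheaf.obj (op W) →+* K⟦X⟧ where
  toFun c := (exists_expansion hj hW c).choose
  map_one' := eq_of_forall_mk_eq fun n => by
    rw [(exists_expansion hj hW _).choose_spec]
    simp
  map_mul' a b := eq_of_forall_mk_eq fun n => by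
    rw [map_mul]
    refine ((exists_expansion hj hW (a * b)).choose_spec n).trans ?_
    rw [map_mul, map_mul]
    exact congrArg₂ (· * ·) ((exists_expansion hj hW a).choose_spec n).symm
      ((exists_expansion hj hW b).choose_spec n).symm
  map_zero' := eq_of_forall_mk_eq fun n => by
    rw [(exists_expansion hj hW _).choose_spec]
    simp
  map_add' a b := eq_of_forall_mk_eq fun n => by
    rw [map_add]
    refine ((exists_expansion hj hW (a + b)).choose_spec n).trans ?_
    rw [map_add, map_add]
    exact congrArg₂ (· + ·) ((exists_expansion hj hW a).choose_spec n).symm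
      ((exists_expansion hj hW b).choose_spec n).symm

lemma mk_expansion (n : ℕ) (c : (structureSheaf I).presheaf.obj (op W)) :
    (Ideal.Quotient.mk _ (expansion hj hW c) : Trunc K n) = taylor hj n W hW (reduction I n W c) :=
  (exists_expansion hj hW c).choose_spec n

lemma expansion_res {W' : Opens (space I)} (i : W' ⟶ W) (hW' : (⟨arcPoint j, hj⟩ : space I) ∈ W')
    (c : (structureSheaf I).presheaf.obj (op W)) :
    expansion hj hW' ((structureSheaf I).presheaf.map i.op c) = expansion hj (i.le hW') c := by
  refine eq_of_forall_mk_eq fun n => ?_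
  rw [mk_expansion, mk_expansion, ← taylor_res hj n i hW']
  exact congrArg _ (ConcreteCategory.congr_hom (reduction_naturality I n i) c)

lemma IsLimitOf.dvd {V : X.Opens} {f : ℕ → Γ(X, V)} {c : (structureSheaf I).presheaf.obj (op W)}
    (h : IsLimitOf I V f W c) (n : ℕ) : PowerSeries.X ^ (n + 1) ∣ expansion hj hW c -
      evalSpec j V (arcPoint_mem_iff.1 (h.1 hW)) (f n) := by
  rw [← mk_eq_mk_iff, mk_expansion, h.2 n, taylor_restrictNbhd]

lemma IsLimitOf.expansion_eq {V : X.Opens} {f : Γ(X, V)} {c : (structureSheaf I).presheaf.obj (op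
    W)}
    (h : IsLimitOf I V (fun _ => f) W c) : expansion hj hW c =
      evalSpec j V (arcPoint_mem_iff.1 (h.1 hW)) f :=
  SeriesSplitting.eq_of_forall_dvd fun n => (pow_dvd_pow _ n.le_succ).trans (h.dvd hj hW n)

lemma exists_isLimitOf_const {V : X.Opens} (f : Γ(X, V)) {W : Opens (space I)}
    (h : W ≤ (Opens.map (incl I)).obj V) : ∃ c, IsLimitOf I V (fun _ => f) W c := by
  obtain ⟨c, hc⟩ := exists_section (I := I) (W := W) (fun n => restrictNbhd I n V W h f)
    (fun n => nbhdRestr_restrictNbhd n V W h f)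
  exact ⟨c, h, hc⟩

/-- On an affine open set the kernel of reduction is the power of the ideal, so the hypothesis says
that the reductions of the `f n` form a compatible system. -/
lemma exists_isLimitOf {V : X.Opens} (hV : IsAffineOpen V) (f : ℕ → Γ(X, V))
    (hf : ∀ n, f (n + 1) - f n ∈ I.ideal ⟨V, hV⟩ ^ (n + 1)) :
    ∃ c, IsLimitOf I V f ((Opens.map (incl I)).obj V) c := by
  obtain ⟨c, hc⟩ := exists_section (I := I) (fun n => restrictNbhd I n V _ le_rfl (f n))
    (fun n => by
      refine (nbhdRestr_restrictNbhd n V _ le_rfl _).trans (sub_eq_zero.1 ?_)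
      exact (map_sub (restrictNbhd I n V _ le_rfl).hom _ _).symm.trans
        ((restrictNbhd_eq_zero_iff hV n _).2 (hf n)))
  exact ⟨c, le_rfl, hc⟩

end FormalCompletion

/-! ### Affine charts in which formal functions become power series with graded coefficients -/

namespace FormalCompletion
open PowerSeries SeriesSplitting

/-- An affine chart `U` whose functions are the quotient of `k[x][y]` by `θ`, such that the ideal
`I` is generated by `y` on `U`, and in which the arc is `y = ω s`, `x = ι x`. -/
structure Chart {S : Scheme.{u}} (I : S.IdealSheafData) (k : Type u) [Field k] {K : Type u}
    [Field K] (j : Spec (.of K⟦X⟧) ⟶ S) where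
  /-- the open subset -/
  U : S.Opens
  affine : IsAffineOpen U
  mem : arcPoint j ∈ U
  /-- the coordinates -/
  θ : Polynomial (Polynomial k) →+* Γ(S, U)
  θ_surjective : Function.Surjective θ
  ideal_eq : I.ideal ⟨U, affine⟩ = Ideal.span {θ Polynomial.X}
  /-- the first coordinate of the arc -/
  ι : Polynomial k →+* K
  ι_injective : Function.Injective ι
  /-- the slope of the arc -/
  ω : Kˣ
  coeff_eval : ∀ p n, coeff n (evalSpec j U (arcPoint_mem_iff.1 mem) (θ p)) = ω ^ n * ι (p.coeff n)

namespace Chart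
variable {S : Scheme.{u}} {I : S.IdealSheafData} {k : Type u} [Field k] {K : Type u} [Field K]
    {j : Spec (.of K⟦X⟧) ⟶ S} (𝒞 : Chart I k j)

/-- The equation of the divisor. -/
def σ : Γ(S, 𝒞.U) := 𝒞.θ Polynomial.X

/-- The locus where the function `f` of the first coordinate does not vanish. -/
def V (f : Polynomial k) : S.Opens := S.basicOpen (𝒞.θ (Polynomial.C f))

/-- The part of the divisor where `f` does not vanish. -/
def W (f : Polynomial k) : Opens (space I) := (Opens.map (incl I)).obj (𝒞.V f)

lemma V_le (f : Polynomial k) : 𝒞.V f ≤ 𝒞.U := S.basicOpen_le _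

lemma isAffineOpen_V (f : Polynomial k) : IsAffineOpen (𝒞.V f) := 𝒞.affine.basicOpen _

/-- Restriction to `V f`. -/
def resV (f : Polynomial k) : Γ(S, 𝒞.U) →+* Γ(S, 𝒞.V f) :=
  (S.presheaf.map (homOfLE (𝒞.V_le f)).op).hom

lemma eval_C (f : Polynomial k) :
    evalSpec j 𝒞.U (arcPoint_mem_iff.1 𝒞.mem) (𝒞.θ (Polynomial.C f)) = C (𝒞.ι f) := by
  ext n
  rw [𝒞.coeff_eval, Polynomial.coeff_C, coeff_C]
  split_ifs with h <;> simp [h]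

lemma eval_σ : evalSpec j 𝒞.U (arcPoint_mem_iff.1 𝒞.mem) 𝒞.σ = C (𝒞.ω : K) * PowerSeries.X := by
  ext n
  rw [σ, 𝒞.coeff_eval, Polynomial.coeff_X, coeff_C_mul, coeff_X]
  split_ifs with h h' h'
  · simp [h']
  · exact absurd h.symm h'
  · exact absurd h'.symm h
  · simp

variable {𝒞} {f : Polynomial k}

/-- Along the arc `f` becomes the nonzero constant `ι f` of the field `K`. The arc thus behaves like
a generic point of the divisor, so expansions exist on all the sets `W f`. -/
lemma mem_V (hf : f ≠ 0) : arcPoint j ∈ 𝒞.V f := by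
  rw [arcPoint_mem_iff, V, ← isUnit_evalSpec_iff j _ (arcPoint_mem_iff.1 𝒞.mem), eval_C]
  exact (Ne.isUnit ((map_ne_zero_iff 𝒞.ι 𝒞.ι_injective).2 hf)).map _

variable (𝒞) in
/-- Evaluation along the arc on `V f`. -/
def eval (hf : f ≠ 0) : Γ(S, 𝒞.V f) →+* K⟦X⟧ :=
  evalSpec j (𝒞.V f) (arcPoint_mem_iff.1 (mem_V hf))

lemma eval_resV (hf : f ≠ 0) (a : Γ(S, 𝒞.U)) : 𝒞.eval hf (𝒞.resV f a) =
    evalSpec j 𝒞.U (arcPoint_mem_iff.1 𝒞.mem) a :=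
  evalSpec_res _ _ _ _ _

variable (𝒞 f) in
lemma isUnit_resV : IsUnit (𝒞.resV f (𝒞.θ (Polynomial.C f))) :=
  RingedSpace.isUnit_res_basicOpen S.toRingedSpace (𝒞.θ (Polynomial.C f))

variable (𝒞 f) in
lemma ideal_V : I.ideal ⟨𝒞.V f, 𝒞.isAffineOpen_V f⟩ = Ideal.span {𝒞.resV f 𝒞.σ} := by
  have h := I.map_ideal_basicOpen ⟨𝒞.U, 𝒞.affine⟩ (𝒞.θ (Polynomial.C f))
  rw [𝒞.ideal_eq, Ideal.map_span, Set.image_singleton] at h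
  exact h.symm

variable (𝒞) in
lemma exists_mul_pow (x : Γ(S, 𝒞.V f)) : ∃ (N : ℕ) (p : Polynomial (Polynomial k)),
    x * 𝒞.resV f (𝒞.θ (Polynomial.C f)) ^ N = 𝒞.resV f (𝒞.θ p) := by
  have := 𝒞.affine.isLocalization_basicOpen (𝒞.θ (Polynomial.C f))
  obtain ⟨N, a, h⟩ := IsLocalization.Away.surj
    (S := Γ(S, S.basicOpen (𝒞.θ (Polynomial.C f)))) (𝒞.θ (Polynomial.C f)) x
  obtain ⟨p, rfl⟩ := 𝒞.θ_surjective a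
  exact ⟨N, p, h⟩

lemma coeff_eval_mul_pow (hf : f ≠ 0) {x : Γ(S, 𝒞.V f)} {N : ℕ} {p : Polynomial (Polynomial k)}
    (h : x * 𝒞.resV f (𝒞.θ (Polynomial.C f)) ^ N = 𝒞.resV f (𝒞.θ p)) (n : ℕ) :
    coeff n (𝒞.eval hf x) * 𝒞.ι f ^ N = 𝒞.ω ^ n * 𝒞.ι (p.coeff n) := by
  have h1 := congrArg (𝒞.eval hf) h
  rw [map_mul, map_pow, eval_resV, eval_resV, eval_C, ← map_pow] at h1
  rw [← 𝒞.coeff_eval, ← h1, coeff_mul_C]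

/-- Every function on `V f` is a polynomial in the coordinates divided by a power of `f`, and the
coefficient of degree `n` of a polynomial expands to `ω ^ n` times the image of `ι`. -/
lemma eval_mem_series (hf : f ≠ 0) (x : Γ(S, 𝒞.V f)) :
    𝒞.eval hf x ∈ series (𝒞.ω : K) (loc 𝒞.ι f) := by
  intro n
  obtain ⟨N, p, h⟩ := 𝒞.exists_mul_pow x
  refine ⟨(𝒞.ω ^ n : Kˣ)⁻¹ * coeff n (𝒞.eval hf x), ⟨N, p.coeff n, ?_⟩, ?_⟩
  · rw [mul_assoc, coeff_eval_mul_pow hf h]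
    simp
  · simp

/-- The order of vanishing along the divisor is visible on the arc. After multiplication by a power
of `f`, the function is given by a polynomial whose coefficients below degree `n` are killed by the
injective map `ι`; it is divisible by the `n`-th power of the generator of the ideal. -/
lemma mem_ideal_pow (hf : f ≠ 0) {x : Γ(S, 𝒞.V f)} {n : ℕ} (hx : PowerSeries.X ^ n ∣ 𝒞.eval hf x) :
    x ∈ I.ideal ⟨𝒞.V f, 𝒞.isAffineOpen_V f⟩ ^ n := by
  obtain ⟨N, p, h⟩ := 𝒞.exists_mul_pow x
  have h1 : Polynomial.X ^ n ∣ p := by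
    rw [Polynomial.X_pow_dvd_iff]
    intro d hd
    have h2 := coeff_eval_mul_pow hf h d
    rw [X_pow_dvd_iff.1 hx d hd, zero_mul] at h2
    refine 𝒞.ι_injective ?_
    rw [map_zero]
    exact ((mul_eq_zero.1 h2.symm).resolve_left (pow_ne_zero _ 𝒞.ω.ne_zero))
  obtain ⟨q, rfl⟩ := h1
  rw [ideal_V, Ideal.span_singleton_pow, ← Ideal.unit_mul_mem_iff_mem _ ((𝒞.isUnit_resV f).pow N),
    mul_comm, h, map_mul, map_mul, map_pow, map_pow]
  exact Ideal.mul_mem_right _ _ (Ideal.mem_span_singleton_self _)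

lemma exists_eval_eq_C (hf : f ≠ 0) {l : K} (hl : l ∈ loc 𝒞.ι f) :
    ∃ x, 𝒞.eval hf x = C l := by
  obtain ⟨N, p, h⟩ := hl
  obtain ⟨u, hu⟩ := (𝒞.isUnit_resV f).pow N
  refine ⟨𝒞.resV f (𝒞.θ (Polynomial.C p)) * (u⁻¹ : (Γ(S, 𝒞.V f))ˣ), ?_⟩
  have h1 : 𝒞.eval hf (u : Γ(S, 𝒞.V f)) = C (𝒞.ι f) ^ N := by
    rw [hu, map_pow, eval_resV, eval_C]
  have h2 : IsUnit (𝒞.eval hf (u : Γ(S, 𝒞.V f))) := u.isUnit.map _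
  refine h2.mul_right_cancel ?_
  rw [← map_mul, mul_assoc, Units.inv_mul, mul_one, eval_resV, eval_C, h1, ← h, map_mul, map_pow]

variable (hj : arcPoint j ∈ I.support)

/-- The base point of the divisor. -/
abbrev point : space I := ⟨arcPoint j, hj⟩

lemma mem_W (hf : f ≠ 0) : point hj ∈ 𝒞.W f := mem_V hf

lemma exists_reduction_eq (n : ℕ) (c : (structureSheaf I).presheaf.obj (op (𝒞.W f))) :
    ∃ x, reduction I n (𝒞.W f) c = restrictNbhd I n (𝒞.V f) (𝒞.W f) le_rfl x :=
  (restrictNbhd_surjective (𝒞.isAffineOpen_V f) n (reduction I n (𝒞.W f) c)).imp fun _ h => h.symm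

lemma dvd_expansion_sub_eval (hf : f ≠ 0) {n : ℕ} {c : (structureSheaf I).presheaf.obj (op (𝒞.W f))}
    {x : Γ(S, 𝒞.V f)} (h : reduction I n (𝒞.W f) c = restrictNbhd I n (𝒞.V f) (𝒞.W f) le_rfl x) :
    PowerSeries.X ^ (n + 1) ∣ expansion hj (mem_W hj hf) c - 𝒞.eval hf x := by
  rw [← mk_eq_mk_iff, mk_expansion, h]
  exact taylor_restrictNbhd hj n (𝒞.V f) (𝒞.W f) le_rfl (mem_W hj hf) x

/-- The reduction of `c` is induced by some function `y` on the affine set. Then `x - y` expands to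
a multiple of `X ^ (n + 1)`, so it lies in the corresponding power of the ideal. -/
lemma reduction_eq_of_dvd (hf : f ≠ 0) {n : ℕ} {c : (structureSheaf I).presheaf.obj (op (𝒞.W f))}
    {x : Γ(S, 𝒞.V f)} (h : PowerSeries.X ^ (n + 1) ∣ expansion hj (mem_W hj hf) c - 𝒞.eval hf x) :
    reduction I n (𝒞.W f) c = restrictNbhd I n (𝒞.V f) (𝒞.W f) le_rfl x := by
  obtain ⟨y, hy⟩ := 𝒞.exists_reduction_eq n c
  refine hy.trans (sub_eq_zero.1 ?_)
  refine (map_sub (restrictNbhd I n (𝒞.V f) (𝒞.W f) le_rfl).hom _ _).symm.trans ?_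
  refine (restrictNbhd_eq_zero_iff (𝒞.isAffineOpen_V f) n _).2 (mem_ideal_pow hf ?_)
  rw [map_sub]
  have := dvd_sub h (dvd_expansion_sub_eval hj hf hy)
  rwa [sub_sub_sub_cancel_left] at this

lemma isLimitOf_of_dvd (hf : f ≠ 0) {c : (structureSheaf I).presheaf.obj (op (𝒞.W f))}
    {x : ℕ → Γ(S, 𝒞.V f)}
    (h : ∀ n, PowerSeries.X ^ (n + 1) ∣ expansion hj (mem_W hj hf) c - 𝒞.eval hf (x n)) :
    IsLimitOf I (𝒞.V f) x (𝒞.W f) c :=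
  ⟨le_rfl, fun n => reduction_eq_of_dvd hj hf (h n)⟩

lemma expansion_injective (hf : f ≠ 0) :
    Function.Injective (expansion hj (mem_W (𝒞 := 𝒞) hj hf)) := by
  rw [injective_iff_map_eq_zero]
  intro c hc
  refine section_ext fun n => ?_
  refine (reduction_eq_of_dvd hj hf (x := 0) ?_).trans ?_
  · rw [hc, map_zero, sub_zero]
    exact dvd_zero _
  · rw [map_zero]
    exact (map_zero (reduction I n (𝒞.W f)).hom).symm

lemma expansion_mem_series (hf : f ≠ 0) (c : (structureSheaf I).presheaf.obj (op (𝒞.W f))) :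
    expansion hj (mem_W hj hf) c ∈ series (𝒞.ω : K) (loc 𝒞.ι f) := by
  intro n
  obtain ⟨x, hx⟩ := 𝒞.exists_reduction_eq n c
  have h := X_pow_dvd_iff.1 (dvd_expansion_sub_eval hj hf hx) n n.lt_succ_self
  rw [map_sub, sub_eq_zero] at h
  rw [h]
  exact eval_mem_series hf x n

/-- If `F` has the coefficients `ω ^ m * l m`, choose functions `y m` that expand to the constants
`l m`. As `σ` expands to `ω * X`, the partial sums of `y m * σ ^ m` converge to a formal function
with expansion `F`. -/
lemma exists_expansion_eq (hf : f ≠ 0) {F : K⟦X⟧} (hF : F ∈ series (𝒞.ω : K) (loc 𝒞.ι f)) :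
    ∃ c : (structureSheaf I).presheaf.obj (op (𝒞.W f)), expansion hj (mem_W hj hf) c = F := by
  choose l hl hl' using hF
  choose y hy using fun n => exists_eval_eq_C hf (hl n)
  let x : ℕ → Γ(S, 𝒞.V f) := fun n => ∑ m ∈ Finset.range (n + 1), y m * 𝒞.resV f 𝒞.σ ^ m
  have hterm : ∀ m, 𝒞.eval hf (y m * 𝒞.resV f 𝒞.σ ^ m) = C (coeff m F) * PowerSeries.X ^ m := by
    intro m
    rw [map_mul, map_pow, hy, eval_resV, eval_σ, hl', mul_pow, ← map_pow, ← mul_assoc, ← map_mul,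
      mul_comm (l m)]
  obtain ⟨c, hc⟩ := exists_isLimitOf (I := I) (𝒞.isAffineOpen_V f) x fun n => by
    refine mem_ideal_pow hf ?_
    simp only [x]
    rw [Finset.sum_range_succ _ (n + 1), add_sub_cancel_left, hterm]
    exact dvd_mul_left _ _
  refine ⟨c, eq_of_forall_dvd fun n => ?_⟩
  have h1 : PowerSeries.X ^ (n + 1) ∣ expansion hj (mem_W hj hf) c - 𝒞.eval hf (x n) :=
    IsLimitOf.dvd hj (mem_W hj hf) hc n
  have h2 : PowerSeries.X ^ (n + 1) ∣ 𝒞.eval hf (x n) - F := by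
    rw [X_pow_dvd_iff]
    intro m hm
    simp only [x, map_sum, hterm, coeff_C_mul, map_sub, coeff_X_pow]
    simp [hm]
  have := dvd_add h1 h2
  rw [sub_add_sub_cancel] at this
  exact (pow_dvd_pow _ n.le_succ).trans this

end Chart
end FormalCompletion

/-! ### The topology of the divisor in a chart, and functions without zeros outside it -/

namespace FormalCompletion
open PowerSeries SeriesSplitting

namespace Chart
variable {S : Scheme.{u}} {I : S.IdealSheafData} {k : Type u} [Field k] {K : Type u} [Field K]
    {j : Spec (.of K⟦X⟧) ⟶ S} {𝒞 : Chart I k j} {f g : Polynomial k}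

variable (𝒞 f g) in
lemma W_mul : 𝒞.W (f * g) = 𝒞.W f ⊓ 𝒞.W g := by
  rw [W, V, map_mul, map_mul, Scheme.basicOpen_mul]
  rfl

lemma W_le_of_dvd (h : f ∣ g) : 𝒞.W g ≤ 𝒞.W f := by
  obtain ⟨q, rfl⟩ := h
  rw [W_mul]
  exact inf_le_left

variable (𝒞 f g) in
lemma W_add_le : 𝒞.W (f + g) ≤ 𝒞.W f ⊔ 𝒞.W g := fun z hz => by
  change z.1 ∈ S.basicOpen _ at hz
  rw [map_add, map_add] at hz
  exact S.basicOpen_add_le _ _ hz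

variable (𝒞) in
lemma W_one : 𝒞.W 1 = (Opens.map (incl I)).obj 𝒞.U := by
  rw [W, V, map_one, map_one, Scheme.basicOpen_of_isUnit _ isUnit_one]

/-- Where the combination `h` does not vanish, one of `f` and `g` does not vanish; the converse uses
that `h` divides both. -/
lemma W_sup_eq {x y h : Polynomial k} (hh : h = x * f + y * g) (hf : h ∣ f) (hg : h ∣ g) :
    𝒞.W f ⊔ 𝒞.W g = 𝒞.W h := by
  refine le_antisymm (sup_le (W_le_of_dvd hf) (W_le_of_dvd hg)) ?_
  rw [hh]
  exact (W_add_le _ _ _).trans (sup_le_sup (W_le_of_dvd (dvd_mul_left _ _))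
    (W_le_of_dvd (dvd_mul_left _ _)))

lemma not_mem_basicOpen_σ {z : S} (hz : z ∈ I.support) (hU : z ∈ 𝒞.U) : z ∉ S.basicOpen 𝒞.σ := by
  have h1 := (Scheme.IdealSheafData.mem_support_iff_of_mem (U := ⟨𝒞.U, 𝒞.affine⟩) hU).1 hz
  rw [Scheme.mem_zeroLocus_iff] at h1
  refine h1 _ ?_
  rw [𝒞.ideal_eq]
  exact Ideal.mem_span_singleton_self _

lemma mem_basicOpen_σ {z : S} (hz : z ∉ I.support) (hU : z ∈ 𝒞.U) : z ∈ S.basicOpen 𝒞.σ := by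
  by_contra h
  refine hz ((Scheme.IdealSheafData.mem_support_iff_of_mem (U := ⟨𝒞.U, 𝒞.affine⟩) hU).2 ?_)
  rw [𝒞.ideal_eq, Scheme.zeroLocus_span, Scheme.mem_zeroLocus_iff]
  rintro _ rfl
  exact h

/-- The second coordinate vanishes on the divisor, so only the constant coefficient of `p` matters
there. It makes the sets `W f` a basis of the topology. -/
lemma W_coeff_zero (p : Polynomial (Polynomial k)) :
    𝒞.W (p.coeff 0) = (Opens.map (incl I)).obj (S.basicOpen (𝒞.θ p)) := by
  ext z
  -- Adding a multiple of the second coordinate does not affect vanishing at `z`. Applied to `p`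
  -- with correction `-p.divX` and to `p.coeff 0` with correction `p.divX`, this gives both
  -- inclusions.
  have key : ∀ a b : Polynomial (Polynomial k), z.1 ∈ S.basicOpen (𝒞.θ (a + b * Polynomial.X)) →
      z.1 ∈ S.basicOpen (𝒞.θ a) := by
    intro a b h
    have hU := S.basicOpen_le _ h
    rw [map_add, map_mul] at h
    refine (S.basicOpen_add_le _ _ h).resolve_right fun h' => ?_
    erw [Scheme.basicOpen_mul] at h'
    exact not_mem_basicOpen_σ z.2 hU h'.2
  have e := Polynomial.divX_mul_X_add p
  constructor
  · intro h
    change z.1 ∈ S.basicOpen _ at h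
    refine key p (-p.divX) ?_
    convert h using 3
    linear_combination -e
  · intro h
    change z.1 ∈ S.basicOpen (𝒞.θ p) at h
    refine key (Polynomial.C (p.coeff 0)) p.divX ?_
    rwa [add_comm, e]

/-- A basis for the topology of the divisor. -/
lemma exists_basicOpen_le {z : space I} (hU : z.1 ∈ 𝒞.U) {O : S.Opens} (hz : z.1 ∈ O) :
    ∃ p, S.basicOpen (𝒞.θ p) ≤ O ∧ z ∈ 𝒞.W (p.coeff 0) := by
  obtain ⟨a, ha, hz'⟩ := 𝒞.affine.exists_basicOpen_le ⟨z.1, hz⟩ hU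
  obtain ⟨p, rfl⟩ := 𝒞.θ_surjective a
  refine ⟨p, ha, ?_⟩
  rw [W_coeff_zero]
  exact hz'

lemma exists_W_le {z : space I} (hU : z.1 ∈ 𝒞.U) {O : Opens (space I)} (hz : z ∈ O) :
    ∃ f, 𝒞.W f ≤ O ∧ z ∈ 𝒞.W f := by
  obtain ⟨O', hO', e⟩ := isOpen_induced_iff.1 O.2
  have hz' : z.1 ∈ (⟨O', hO'⟩ : S.Opens) := by
    have : z ∈ Subtype.val ⁻¹' O' := e ▸ hz
    exact this
  obtain ⟨p, hp, hz''⟩ := exists_basicOpen_le hU hz'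
  refine ⟨p.coeff 0, ?_, hz''⟩
  rw [W_coeff_zero]
  intro w hw
  have : w ∈ Subtype.val ⁻¹' O' := hp hw
  rw [e] at this
  exact this

variable (hj : arcPoint j ∈ I.support)

/-- On `V f`, the functions `g` and `σ` have no common zero: `g` has none on the divisor and `σ`
none outside. They generate the unit ideal, and the constant coefficient of the expansion of this
relation kills `σ` and exhibits an inverse of `ι g` in `loc ι f`. -/
lemma dvd_pow_of_W_le (hf : f ≠ 0) (h : 𝒞.W f ≤ 𝒞.W g) : ∃ N, g ∣ f ^ N := by
  have h1 : Ideal.span {𝒞.resV f (𝒞.θ (Polynomial.C g)), 𝒞.resV f 𝒞.σ} = ⊤ := by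
    rw [← (𝒞.isAffineOpen_V f).self_le_iSup_basicOpen_iff]
    intro z hz
    rw [Opens.mem_iSup]
    by_cases hz' : z ∈ I.support
    · refine ⟨⟨_, Or.inl rfl⟩, ?_⟩
      erw [Scheme.basicOpen_res]
      exact ⟨hz, h (show (⟨z, hz'⟩ : space I) ∈ 𝒞.W f from hz)⟩
    · refine ⟨⟨_, Or.inr rfl⟩, ?_⟩
      erw [Scheme.basicOpen_res]
      exact ⟨hz, mem_basicOpen_σ hz' (𝒞.V_le f hz)⟩
  obtain ⟨a, b, hab⟩ := Ideal.mem_span_pair.1 (h1.ge (Submodule.mem_top (x := 1)))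
  have h2 := congrArg (fun x => constantCoeff (𝒞.eval hf x)) hab
  simp only [map_add, map_mul, eval_resV, eval_C, eval_σ, map_one, constantCoeff_X, mul_zero,
    add_zero, constantCoeff_C] at h2
  obtain ⟨N, p, hN⟩ := constantCoeff_mem (eval_mem_series hf a)
  refine ⟨N, p, 𝒞.ι_injective ?_⟩
  rw [map_mul, ← hN, map_pow, ← mul_assoc, mul_comm (𝒞.ι g), h2, one_mul]

/-- Functions without zeros outside of the divisor divide powers of the equation of the divisor. -/
lemma exists_mul_eq_pow {V' : S.Opens} {a : Γ(S, V')} (ha : (V' : Set S) \ I.support ⊆ S.basicOpen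
    a)
    {z : space I} (hU : z.1 ∈ 𝒞.U) (hz : z.1 ∈ V') :
    ∃ (f : Polynomial k) (D : S.Opens) (h₁ : D ≤ V') (h₂ : D ≤ 𝒞.U) (b : Γ(S, D)) (N : ℕ), z ∈ 𝒞.W
        f ∧
      𝒞.W f ≤ (Opens.map (incl I)).obj D ∧ S.presheaf.map (homOfLE h₁).op a * b =
        S.presheaf.map (homOfLE h₂).op (𝒞.σ ^ N) := by
  obtain ⟨p, hp, hzp⟩ := exists_basicOpen_le hU hz
  have h₂ := S.basicOpen_le (𝒞.θ p)
  have hD : IsAffineOpen (S.basicOpen (𝒞.θ p)) := 𝒞.affine.basicOpen _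
  generalize hDe : S.basicOpen (𝒞.θ p) = D at hp h₂ hD
  let s : Γ(S, D) := S.presheaf.map (homOfLE h₂).op 𝒞.σ
  let a' : Γ(S, D) := S.presheaf.map (homOfLE hp).op a
  -- Off the divisor `a` has no zeros, and `σ` vanishes on the divisor. Hence `a` becomes invertible
  -- once `σ` is inverted.
  have hle : S.basicOpen s ≤ S.basicOpen a' := by
    intro w hw
    simp only [s, a'] at hw ⊢
    rw [Scheme.basicOpen_res] at hw ⊢
    refine ⟨hw.1, ha ⟨hp hw.1, fun hw' => not_mem_basicOpen_σ hw' (h₂ hw.1) hw.2⟩⟩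
  have := hD.isLocalization_basicOpen s
  have hu : IsUnit (algebraMap Γ(S, D) Γ(S, S.basicOpen s) a') := by
    have h1 := (RingedSpace.isUnit_res_basicOpen S.toRingedSpace a').map
      (S.presheaf.map (homOfLE hle).op).hom
    have h2 := ConcreteCategory.congr_hom (S.presheaf.map_comp (homOfLE (S.basicOpen_le a')).op
      (homOfLE hle).op) a'
    exact h2 ▸ h1
  obtain ⟨v, hv⟩ := hu
  obtain ⟨N, q, hq⟩ := IsLocalization.Away.surj s (v⁻¹ : (Γ(S, S.basicOpen s))ˣ).1
  have h3 : algebraMap Γ(S, D) Γ(S, S.basicOpen s) (a' * q) = algebraMap _ _ (s ^ N) := by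
    rw [map_mul, ← hq, ← hv, ← mul_assoc, Units.mul_inv, one_mul, map_pow]
  -- The equation `a' * q = s ^ N` holds only in the localization; a further factor `s ^ M` makes it
  -- valid on `D`.
  obtain ⟨M, hM⟩ := IsLocalization.Away.exists_of_eq s h3
  refine ⟨p.coeff 0, D, hp, h₂, s ^ M * q, M + N, hzp, ?_, ?_⟩
  · rw [W_coeff_zero, hDe]
  · rw [map_pow]
    change a' * (s ^ M * q) = s ^ (M + N)
    rw [pow_add, ← hM]
    ring

end Chart
end FormalCompletion

/-! ### Extension of expansions to the punctured formal neighbourhood -/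

namespace FormalCompletion

/-- A compatible family of homomorphisms on neighbourhoods of a point extends along morphisms
which are isomorphisms on stalks. -/
lemma exists_extension_of_isIso {T : TopCat.{u}} {P Q : TopCat.Presheaf CommRingCat.{u} T} (t : P ⟶
    Q) (p : T)
    (ht : IsIso ((TopCat.Presheaf.stalkFunctor CommRingCat.{u} p).map t))
    {R : CommRingCat.{u}} (φ : ∀ W : Opens T, p ∈ W → (P.obj (op W) ⟶ R))
    (hφ : ∀ (W W' : Opens T) (i : W' ⟶ W) (hW' : p ∈ W'), P.map i.op ≫ φ W' hW' = φ W (i.le hW')) :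
    ∃ ψ : ∀ W : Opens T, p ∈ W → (Q.obj (op W) ⟶ R),
      (∀ (W W' : Opens T) (i : W' ⟶ W) (hW' : p ∈ W'), Q.map i.op ≫ ψ W' hW' =
          ψ W (i.le hW')) ∧
      ∀ (W : Opens T) (hW : p ∈ W), t.app (op W) ≫ ψ W hW = φ W hW := by
  -- The compatible family is a cocone on the neighbourhoods of `p`, hence the same as a
  -- homomorphism from the stalk; the stalk does not change under `t`.
  obtain ⟨σ, hσ⟩ : ∃ σ : P.stalk p ⟶ R, ∀ (W : Opens T) (hW : p ∈ W), P.germ W p hW ≫ σ = φ W hW :=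
      by
    let c : Limits.Cocone ((OpenNhds.inclusion p).op ⋙ P) :=
     { pt := R
       ι := { app := fun W => φ ((OpenNhds.inclusion p).obj W.unop) W.unop.2
              naturality := fun W W' i =>
              (hφ _ _ ((OpenNhds.inclusion p).map i.unop) W'.unop.2).trans (Category.comp_id
                  _).symm } }
    refine ⟨Limits.colimit.desc ((OpenNhds.inclusion p).op ⋙ P) c, ?_⟩
    intro W hW
    exact Limits.colimit.ι_desc c (op (⟨W, hW⟩ : OpenNhds p))
  let τ := inv ((TopCat.Presheaf.stalkFunctor CommRingCat.{u} p).map t)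
  refine ⟨fun W hW => Q.germ W p hW ≫ τ ≫ σ, ?_, ?_⟩
  · intro W W' i hW'
    exact TopCat.Presheaf.germ_res_assoc _ i p hW' _
  · intro W hW
    have h := TopCat.Presheaf.stalkFunctor_map_germ W p hW t
    have h' : (TopCat.Presheaf.stalkFunctor CommRingCat.{u} p).map t ≫ τ = 𝟙 _ := IsIso.hom_inv_id _
    refine (Category.assoc _ _ _).symm.trans ?_
    refine (congrArg (· ≫ τ ≫ σ) h.symm).trans ?_
    refine (Category.assoc _ _ _).trans ?_
    refine (congrArg (P.germ W p hW ≫ ·) ((Category.assoc _ _ _).symm.trans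
      ((congrArg (· ≫ σ) h').trans (Category.id_comp _)))).trans (hσ W hW)

/-- The sheafification of a presheaf of rings. -/
abbrev sheafification {T : TopCat.{u}} (P : TopCat.Presheaf CommRingCat.{u} T) : TopCat.Sheaf
    CommRingCat.{u} T :=
  (presheafToSheaf (Opens.grothendieckTopology T) CommRingCat.{u}).obj P

/-- A compatible family of homomorphisms on neighbourhoods of a point extends to the
sheafification. -/
lemma exists_extension_sheafify {T : TopCat.{u}} (P : TopCat.Presheaf CommRingCat.{u} T) (p : T)
    {R : Type u} [CommRing R] (φ : ∀ W : Opens T, p ∈ W → (P.obj (op W) →+* R))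
    (hφ : ∀ (W W' : Opens T) (i : W' ⟶ W) (hW' : p ∈ W') (c : P.obj (op W)),
      φ W' hW' (P.map i.op c) = φ W (i.le hW') c) :
    ∃ ψ : ∀ W : Opens T, p ∈ W → ((sheafification P).presheaf.obj (op W) →+* R),
      (∀ (W W' : Opens T) (i : W' ⟶ W) (hW' : p ∈ W') (c : (sheafification P).presheaf.obj (op W)),
          ψ W' hW' ((sheafification P).presheaf.map i.op c) = ψ W (i.le hW') c) ∧
      ∀ (W : Opens T) (hW : p ∈ W) (c : P.obj (op W)),
        ψ W hW ((CategoryTheory.toSheafify (Opens.grothendieckTopology T) P).app (op W) c) =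
          φ W hW c := by
  obtain ⟨ψ, h₁, h₂⟩ := exists_extension_of_isIso
    (CategoryTheory.toSheafify (Opens.grothendieckTopology T) P) p
    (TopCat.Presheaf.stalkFunctor_map_unit_toSheafify_isIso p _ _) (R := .of R)
    (fun W hW => CommRingCat.ofHom (φ W hW))
    (fun W W' i hW' => CommRingCat.hom_ext (RingHom.ext (hφ W W' i hW')))
  exact ⟨fun W hW => (ψ W hW).hom, fun W W' i hW' => ConcreteCategory.congr_hom (h₁ W W' i hW'),
    fun W hW => ConcreteCategory.congr_hom (h₂ W hW)⟩
open PowerSeries SeriesSplitting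

namespace Chart
variable {S : Scheme.{u}} {I : S.IdealSheafData} {k : Type u} [Field k] {K : Type u} [Field K]
    {j : Spec (.of K⟦X⟧) ⟶ S} {𝒞 : Chart I k j} {f g : Polynomial k}

lemma ne_zero_of_mem_W {z : space I} (hz : z ∈ 𝒞.W f) : f ≠ 0 := by
  rintro rfl
  change z.1 ∈ S.basicOpen _ at hz
  rw [map_zero, map_zero, Scheme.basicOpen_zero] at hz
  exact hz

variable (hj : arcPoint j ∈ I.support)

-- Near `z` the function inducing `b` divides a power of `σ`. Expanding this relation, and `σ` to `ω
-- * X`, gives a cofactor whose coefficients are controlled on a neighbourhood of `z`, which need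
-- not be the point of the arc.
variable (𝒞) in
lemma exists_expansion_mul {W : Opens (space I)} {b : (structureSheaf I).presheaf.obj (op W)}
    (hb : b ∈ (locSubmonoid I).obj (op W)) (hW : point hj ∈ W) {z : space I} (hz : z ∈ W)
    (hU : z.1 ∈ 𝒞.U) : ∃ (f : Polynomial k) (_ : f ≠ 0) (N : ℕ), z ∈ 𝒞.W f ∧ ∃ G ∈ series (𝒞.ω : K)
        (loc 𝒞.ι f),
      expansion hj hW b * G = (C (𝒞.ω : K) * PowerSeries.X) ^ N := by
  obtain ⟨V', a, ha, hV, h⟩ := hb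
  obtain ⟨f, D, h₁, h₂, q, N, hzf, hD, e⟩ := exists_mul_eq_pow (𝒞 := 𝒞) ha hU (hV hz)
  have hf := ne_zero_of_mem_W hzf
  obtain ⟨c, hc⟩ := exists_isLimitOf_const (I := I) q hD
  refine ⟨f, hf, N, hzf, _, expansion_mem_series hj hf c, ?_⟩
  have e1 : expansion hj hW b = evalSpec j V' (arcPoint_mem_iff.1 (hV hW)) a :=
    IsLimitOf.expansion_eq (f := a) hj hW ⟨hV, h⟩
  have e2 := hc.expansion_eq hj (mem_W hj hf)
  have hpD : ⊤ ≤ j ⁻¹ᵁ D := arcPoint_mem_iff.1 (hD (mem_W hj hf))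
  rw [e1, e2, ← evalSpec_res j (homOfLE h₁) hpD, ← map_mul, e, evalSpec_res j _ hpD
      (arcPoint_mem_iff.1 𝒞.mem), map_pow, eval_σ]

variable (I) in
/-- The functions without zeros outside of the divisor do not vanish along the arc. -/
def IsTransversal : Prop :=
  ∀ (W : Opens (space I)) (b : (structureSheaf I).presheaf.obj (op W)) (hW : point hj ∈ W),
    b ∈ (locSubmonoid I).obj (op W) → expansion hj hW b ≠ 0

-- The expansion of `b` divides a power of `ω * X`, which is nonzero. Fractions can therefore be
-- expanded into Laurent series.
include 𝒞 in
lemma isTransversal : IsTransversal I hj := by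
  intro W b hW hb
  obtain ⟨f, hf, N, -, G, -, h⟩ := 𝒞.exists_expansion_mul hj hb hW hW 𝒞.mem
  intro h0
  rw [h0, zero_mul] at h
  refine pow_ne_zero N (mul_ne_zero ?_ X_ne_zero) h.symm
  exact (map_ne_zero_iff _ (C_injective)).2 𝒞.ω.ne_zero

end Chart

open Chart

variable {S : Scheme.{u}} {I : S.IdealSheafData} {K : Type u} [Field K]
    {j : Spec (.of K⟦X⟧) ⟶ S} {hj : arcPoint j ∈ I.support} (ht : IsTransversal I hj)

/-- Fractions on an open subset, before sheafification. -/
abbrev Fractions (I : S.IdealSheafData) (W : Opens (space I)) : Type u :=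
  Localization ((locSubmonoid I).obj (op W))

/-- Restriction of functions to the punctured formal neighbourhood. -/
def toPuncturedHom (W : Opens (space I)) : (structureSheaf I).presheaf.obj (op W) →+*
    (puncturedSheaf I).presheaf.obj (op W) :=
  ((toPunctured I).app (op W)).hom

/-- The function on the punctured formal neighbourhood defined by a fraction. -/
def ofFractions (W : Opens (space I)) : Fractions I W →+* (puncturedSheaf I).presheaf.obj (op W) :=
  ((CategoryTheory.toSheafify (Opens.grothendieckTopology (space I))
    (locSubmonoid I).localizationPresheaf).app (op W)).hom

lemma ofFractions_algebraMap (W : Opens (space I)) (a : (structureSheaf I).presheaf.obj (op W)) :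
    ofFractions W (algebraMap _ _ a) = toPuncturedHom W a := rfl

lemma toPuncturedHom_res {W W' : Opens (space I)} (i : W' ⟶ W)
    (a : (structureSheaf I).presheaf.obj (op W)) :
    toPuncturedHom W' ((structureSheaf I).presheaf.map i.op a) =
      (puncturedSheaf I).presheaf.map i.op (toPuncturedHom W a) :=
  ConcreteCategory.congr_hom ((toPunctured I).naturality i.op) a

lemma isUnit_toPuncturedHom {W : Opens (space I)} {b : (structureSheaf I).presheaf.obj (op W)}
    (hb : b ∈ (locSubmonoid I).obj (op W)) : IsUnit (toPuncturedHom W b) := by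
  rw [← ofFractions_algebraMap]
  exact (IsLocalization.map_units (Fractions I W) (⟨b, hb⟩ : (locSubmonoid I).obj (op W))).map _

lemma exists_mul_eq_toPuncturedHom {W : Opens (space I)} (c : (puncturedSheaf I).presheaf.obj (op
    W))
    {z : space I} (hz : z ∈ W) : ∃ (W' : Opens (space I)) (i : W' ⟶ W)
      (a b : (structureSheaf I).presheaf.obj (op W')), z ∈ W' ∧ b ∈ (locSubmonoid I).obj (op W') ∧
        (puncturedSheaf I).presheaf.map i.op c * toPuncturedHom W' b = toPuncturedHom W' a := by
  have h := Presheaf.imageSieve_mem (Opens.grothendieckTopology (space I))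
    (CategoryTheory.toSheafify (Opens.grothendieckTopology (space I))
      (locSubmonoid I).localizationPresheaf) (U := op W) c
  obtain ⟨W', i, ⟨s, hs⟩, hz'⟩ := h z hz
  replace hs : ofFractions W' s = (puncturedSheaf I).presheaf.map i.op c := hs
  obtain ⟨⟨a, b⟩, hab⟩ := IsLocalization.surj (S := Fractions I W') ((locSubmonoid I).obj (op W')) s
  refine ⟨W', i, a, b.1, hz', b.2, ?_⟩
  rw [← hs]
  exact (map_mul (ofFractions W') _ _).symm.trans (congrArg (ofFractions _) hab)

/-- Expansion of fractions. -/
def fractionsExpansion {W : Opens (space I)} (hW : point hj ∈ W) :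
    Fractions I W →+* LaurentSeries K :=
  IsLocalization.lift (M := (locSubmonoid I).obj (op W))
    (g := (HahnSeries.ofPowerSeries ℤ K).comp (expansion hj hW)) fun b => by
      refine Ne.isUnit ?_
      rw [RingHom.comp_apply]
      exact (map_ne_zero_iff _ HahnSeries.ofPowerSeries_injective).2 (ht W b.1 hW b.2)

lemma fractionsExpansion_algebraMap {W : Opens (space I)} (hW : point hj ∈ W)
    (a : (structureSheaf I).presheaf.obj (op W)) :
    fractionsExpansion ht hW (algebraMap _ _ a) =
      HahnSeries.ofPowerSeries ℤ K (expansion hj hW a) :=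
  IsLocalization.lift_eq _ _

lemma fractionsExpansion_res {W W' : Opens (space I)} (i : W' ⟶ W) (hW' : point hj ∈ W') :
    (fractionsExpansion ht hW').comp (IsLocalization.map (Fractions I W')
      ((structureSheaf I).presheaf.map i.op).hom ((locSubmonoid I).map i.op)) =
        fractionsExpansion ht (i.le hW') := by
  refine IsLocalization.ringHom_ext ((locSubmonoid I).obj (op W)) (RingHom.ext fun a => ?_)
  rw [RingHom.comp_apply, RingHom.comp_apply, IsLocalization.map_eq, RingHom.comp_apply,
    fractionsExpansion_algebraMap, fractionsExpansion_algebraMap]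
  exact congrArg _ (expansion_res hj i _ a)

/-- Expansions of functions on the punctured formal neighbourhood. -/
structure PuncturedExpansion (hj : arcPoint j ∈ I.support) where
  /-- the expansion -/
  toFun : ∀ W : Opens (space I), point hj ∈ W →
    ((puncturedSheaf I).presheaf.obj (op W) →+* LaurentSeries K)
  toFun_res : ∀ (W W' : Opens (space I)) (i : W' ⟶ W) (hW' : point hj ∈ W')
    (c : (puncturedSheaf I).presheaf.obj (op W)),
      toFun W' hW' ((puncturedSheaf I).presheaf.map i.op c) = toFun W (i.le hW') c
  toFun_toPuncturedHom : ∀ (W : Opens (space I)) (hW : point hj ∈ W)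
    (a : (structureSheaf I).presheaf.obj (op W)),
      toFun W hW (toPuncturedHom W a) = HahnSeries.ofPowerSeries ℤ K (expansion hj hW a)

-- Fractions expand compatibly on all neighbourhoods of the point. Sheafification does not change
-- stalks, so the expansions pass to the sheafified localization.
include ht in
lemma nonempty_puncturedExpansion : Nonempty (PuncturedExpansion hj) := by
  obtain ⟨ψ, h₁, h₂⟩ := exists_extension_sheafify (locSubmonoid I).localizationPresheaf (point hj)
    (fun W hW => fractionsExpansion ht hW)
    (fun W W' i hW' c => RingHom.congr_fun (fractionsExpansion_res ht i hW') c)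
  exact ⟨⟨ψ, h₁, fun W hW a => (h₂ W hW (algebraMap _ (Fractions I W) a)).trans
    (fractionsExpansion_algebraMap ht hW a)⟩⟩

end FormalCompletion

/-! ### Functions on the punctured charts as Laurent series with graded coefficients -/

namespace FormalCompletion
open PowerSeries SeriesSplitting

namespace Chart
variable {S : Scheme.{u}} {I : S.IdealSheafData} {k : Type u} [Field k] {K : Type u} [Field K]
    {j : Spec (.of K⟦X⟧) ⟶ S} {𝒞 : Chart I k j} {f g : Polynomial k}
    {hj : arcPoint j ∈ I.support} (Ψ : PuncturedExpansion hj)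

lemma exists_W_le_mul_eq {W : Opens (space I)} (c : (puncturedSheaf I).presheaf.obj (op W))
    {z : space I} (hz : z ∈ W) (hU : z.1 ∈ 𝒞.U) : ∃ (f : Polynomial k) (i : 𝒞.W f ⟶ W)
      (a b : (structureSheaf I).presheaf.obj (op (𝒞.W f))), z ∈ 𝒞.W f ∧
        b ∈ (locSubmonoid I).obj (op (𝒞.W f)) ∧
        (puncturedSheaf I).presheaf.map i.op c * toPuncturedHom _ b = toPuncturedHom _ a := by
  obtain ⟨W', i, a, b, hz', hb, h⟩ := exists_mul_eq_toPuncturedHom c hz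
  obtain ⟨f, hf, hzf⟩ := exists_W_le (𝒞 := 𝒞) hU hz'
  refine ⟨f, homOfLE hf ≫ i, (structureSheaf I).presheaf.map (homOfLE hf).op a,
    (structureSheaf I).presheaf.map (homOfLE hf).op b, hzf, (locSubmonoid I).map (homOfLE hf).op
        hb, ?_⟩
  rw [toPuncturedHom_res, toPuncturedHom_res, ← h, map_mul]
  refine congrArg (· * _) ?_
  exact ConcreteCategory.congr_hom ((puncturedSheaf I).presheaf.map_comp i.op (homOfLE hf).op) c

/-- Near each point `c` is a fraction with numerator `a` on some `W g`. The point of the arc lies in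
every such set, so a vanishing expansion of `c` forces `a = 0` by injectivity for formal functions,
and `c` vanishes locally. -/
lemma toFun_injective (hf : f ≠ 0) : Function.Injective (Ψ.toFun (𝒞.W f) (mem_W hj hf)) := by
  rw [injective_iff_map_eq_zero]
  intro c hc
  have key : ∀ z : 𝒞.W f, ∃ (V : Opens (space I)) (i : V ⟶ 𝒞.W f), z.1 ∈ V ∧
      (puncturedSheaf I).presheaf.map i.op c = 0 := by
    intro z
    obtain ⟨g, i, a, b, hz, hb, h⟩ := exists_W_le_mul_eq (𝒞 := 𝒞) c z.2 (𝒞.V_le f z.2)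
    have hg := ne_zero_of_mem_W hz
    have h1 := congrArg (Ψ.toFun _ (mem_W hj hg)) h
    rw [map_mul, Ψ.toFun_res, hc, zero_mul, Ψ.toFun_toPuncturedHom] at h1
    have h2 := (map_eq_zero_iff _ HahnSeries.ofPowerSeries_injective).1 h1.symm
    have h3 := (map_eq_zero_iff _ (expansion_injective hj hg)).1 h2
    rw [h3, map_zero] at h
    exact ⟨_, i, hz, ((isUnit_toPuncturedHom hb).mul_left_eq_zero).1 h⟩
  choose V i hV h using key
  refine TopCat.Sheaf.eq_of_locally_eq' (puncturedSheaf I) V (𝒞.W f) i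
    (fun z hz => Opens.mem_iSup.2 ⟨⟨z, hz⟩, hV _⟩) c 0 fun z => ?_
  exact (h z).trans (map_zero ((puncturedSheaf I).presheaf.map (i z).op).hom).symm

lemma coe_C_mul_X (ω : Kˣ) : HahnSeries.ofPowerSeries ℤ K (C (ω : K) * PowerSeries.X) =
    laurentMonomial ω 1 := by
  rw [map_mul, HahnSeries.ofPowerSeries_C, HahnSeries.ofPowerSeries_X]
  change HahnSeries.single 0 _ * _ = HahnSeries.single _ _
  rw [HahnSeries.single_mul_single]
  simp

lemma mem_laurent_of_mul_pow_mem {ω : Kˣ} {L : Subring K} {F : LaurentSeries K} {N : ℕ}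
    (h : F * (laurentMonomial ω 1 : (LaurentSeries K)ˣ) ^ N ∈ laurent ω L) : F ∈ laurent ω L := by
  have h1 := (Submonoid.mem_units_iff _ _).1 (laurentMonomial_mem ω 1 L)
  have h2 := mul_mem h (pow_mem h1.2 N)
  rwa [mul_assoc, ← mul_pow, Units.mul_inv, one_pow, mul_one] at h2

lemma W_le_W_pow (h : Polynomial k) (N : ℕ) : 𝒞.W h ≤ 𝒞.W (h ^ N) := by
  induction N with
  | zero =>
    rw [pow_zero, W_one]
    exact fun z hz => 𝒞.V_le h hz
  | succ N ih =>
    rw [pow_succ, W_mul]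
    exact le_inf ih le_rfl

/-- Elements which are locally in the localizations are in the localization. -/
lemma mem_loc_of_forall (hf : f ≠ 0) {l : K}
    (h : ∀ z ∈ 𝒞.W f, ∃ g, z ∈ 𝒞.W g ∧ l ∈ loc 𝒞.ι g) : l ∈ loc 𝒞.ι f := by
  -- The ideal of denominators of `l`. By hypothesis it has, at each point of `W f`, an element that
  -- does not vanish there, so its generator has no zeros on `W f` and divides a power of `f`.
  let J : Ideal (Polynomial k) :=
    { carrier := {p | ∃ q, l * 𝒞.ι p = 𝒞.ι q}
      add_mem' := by
        rintro p p' ⟨q, h⟩ ⟨q', h'⟩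
        exact ⟨q + q', by rw [map_add, map_add, mul_add, h, h']⟩
      zero_mem' := ⟨0, by simp⟩
      smul_mem' := by
        rintro a p ⟨q, h⟩
        exact ⟨a * q, by rw [smul_eq_mul, map_mul, map_mul, ← h]; ring⟩ }
  obtain ⟨d, hd⟩ := IsPrincipalIdealRing.principal J
  have hle : 𝒞.W f ≤ 𝒞.W d := by
    intro z hz
    obtain ⟨g, hzg, N, q, hq⟩ := h z hz
    have h1 : g ^ N ∈ J := ⟨q, by rw [map_pow, hq]⟩
    rw [hd] at h1
    exact W_le_of_dvd (Ideal.mem_span_singleton.1 h1) (W_le_W_pow g N hzg)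
  obtain ⟨N, hN⟩ := dvd_pow_of_W_le hf hle
  have h1 : f ^ N ∈ J := by
    rw [hd]
    exact Ideal.mem_span_singleton.2 hN
  obtain ⟨q, hq⟩ := h1
  exact ⟨N, q, by rw [← map_pow, hq]⟩

/-- Locally `c = a / b`, and `1 / b` is a series with controlled coefficients divided by a power of
the equation. Each coefficient thus lies in a localization near every point of `W f`, and
`mem_loc_of_forall` removes the superfluous denominators. -/
lemma toFun_mem_laurent (hf : f ≠ 0) (c : (puncturedSheaf I).presheaf.obj (op (𝒞.W f))) :
    Ψ.toFun (𝒞.W f) (mem_W hj hf) c ∈ laurent 𝒞.ω (loc 𝒞.ι f) := by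
  have key : ∀ z ∈ 𝒞.W f, ∃ g, z ∈ 𝒞.W g ∧
      Ψ.toFun (𝒞.W f) (mem_W hj hf) c ∈ laurent 𝒞.ω (loc 𝒞.ι g) := by
    intro z hz
    have hU := 𝒞.V_le f hz
    obtain ⟨g, i, a, b, hzg, hb, h⟩ := exists_W_le_mul_eq (𝒞 := 𝒞) c hz hU
    have hg := ne_zero_of_mem_W hzg
    obtain ⟨g', hg', N, hzg', G, hG, e⟩ := 𝒞.exists_expansion_mul hj hb (mem_W hj hg) hzg hU
    refine ⟨g * g', ?_, ?_⟩
    · rw [W_mul]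
      exact ⟨hzg, hzg'⟩
    have hι : 𝒞.ι (g * g') ≠ 0 := (map_ne_zero_iff _ 𝒞.ι_injective).2 (mul_ne_zero hg hg')
    have h1 := congrArg (Ψ.toFun _ (mem_W hj hg)) h
    rw [map_mul, Ψ.toFun_res, Ψ.toFun_toPuncturedHom, Ψ.toFun_toPuncturedHom] at h1
    refine mem_laurent_of_mul_pow_mem (N := N) ?_
    rw [← coe_C_mul_X, ← map_pow, ← e, map_mul, ← mul_assoc, h1, ← map_mul]
    exact coe_mem_laurent (mul_mem (series_mono (loc_mono hι (dvd_mul_right _ _))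
      (expansion_mem_series hj hg a)) (series_mono (loc_mono hι (dvd_mul_left _ _)) hG))
  intro n
  refine ⟨(𝒞.ω ^ n : Kˣ)⁻¹ * (Ψ.toFun (𝒞.W f) (mem_W hj hf) c).coeff n,
    mem_loc_of_forall (𝒞 := 𝒞) hf fun z hz => ?_, (Units.mul_inv_cancel_left _ _).symm⟩
  obtain ⟨g, hzg, h⟩ := key z hz
  obtain ⟨l, hl, e⟩ := h n
  refine ⟨g, hzg, ?_⟩
  rw [e, Units.inv_mul_cancel_left]
  exact hl

lemma exists_mul_pow_eq_coe {ω : Kˣ} {L : Subring K} {F : LaurentSeries K} (hF : F ∈ laurent ω L) :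
    ∃ (N : ℕ) (G : K⟦X⟧), G ∈ series (ω : K) L ∧
      F * (laurentMonomial ω 1 : (LaurentSeries K)ˣ) ^ N = HahnSeries.ofPowerSeries ℤ K G := by
  obtain ⟨N, G, h⟩ : ∃ (N : ℕ) (G : K⟦X⟧),
      F * (laurentMonomial ω 1 : (LaurentSeries K)ˣ) ^ N = HahnSeries.ofPowerSeries ℤ K G := by
    obtain ⟨⟨G, ⟨_, N, rfl⟩⟩, h⟩ := IsLocalization.surj (Submonoid.powers (PowerSeries.X : K⟦X⟧)) F
    refine ⟨N, G * C ((ω : K) ^ N), ?_⟩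
    rw [← coe_C_mul_X, ← map_pow, mul_pow, map_mul, mul_left_comm, map_mul, mul_comm
        (HahnSeries.ofPowerSeries ℤ K G), ← map_pow (C (R := K))]
    exact congrArg _ h
  refine ⟨N, G, fun n => ?_, h⟩
  have h1 := (Submonoid.mem_units_iff _ _).1 (laurentMonomial_mem ω 1 L)
  have h2 := mul_mem hF (pow_mem h1.1 N)
  rw [h] at h2
  obtain ⟨l, hl, e⟩ := h2 n
  rw [HahnSeries.ofPowerSeries_apply_coeff] at e
  exact ⟨l, hl, by simpa using e⟩

/-- Multiplication by a power of `ω * X` clears the pole and leaves the expansion of a formal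
function. The equation `σ` of the divisor is among the inverted functions, so that power can be
divided out again. -/
lemma exists_toFun_eq (hf : f ≠ 0) {F : LaurentSeries K} (hF : F ∈ laurent 𝒞.ω (loc 𝒞.ι f)) :
    ∃ c, Ψ.toFun (𝒞.W f) (mem_W hj hf) c = F := by
  obtain ⟨N, G, hG, h⟩ := exists_mul_pow_eq_coe hF
  obtain ⟨a, ha⟩ := exists_expansion_eq hj hf hG
  obtain ⟨b, hb⟩ := exists_isLimitOf_const (I := I) 𝒞.σ (W := 𝒞.W f) (fun _ h => 𝒞.V_le f h)
  have hb' : b ∈ (locSubmonoid I).obj (op (𝒞.W f)) :=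
    ⟨𝒞.U, 𝒞.σ, fun z hz => mem_basicOpen_σ hz.2 hz.1, hb⟩
  obtain ⟨u, hu⟩ := isUnit_toPuncturedHom hb'
  have hbe : Ψ.toFun (𝒞.W f) (mem_W hj hf) (u : (puncturedSheaf I).presheaf.obj (op (𝒞.W f))) =
      laurentMonomial 𝒞.ω 1 := by
    rw [hu, Ψ.toFun_toPuncturedHom, ← coe_C_mul_X, hb.expansion_eq hj (mem_W hj hf), eval_σ]
  have hinv : Ψ.toFun (𝒞.W f) (mem_W hj hf)
      ((u⁻¹ : ((puncturedSheaf I).presheaf.obj (op (𝒞.W f)))ˣ) : (puncturedSheaf I).presheaf.obj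
        (op (𝒞.W f))) * laurentMonomial 𝒞.ω 1 = 1 := by
    rw [← hbe, ← map_mul, Units.inv_mul, map_one]
  refine ⟨toPuncturedHom _ a * ((u⁻¹ : ((puncturedSheaf I).presheaf.obj (op (𝒞.W f)))ˣ) :
    (puncturedSheaf I).presheaf.obj (op (𝒞.W f))) ^ N, ?_⟩
  refine ((laurentMonomial 𝒞.ω 1).isUnit.pow N).mul_right_cancel ?_
  rw [h, map_mul, map_pow, mul_assoc, ← mul_pow, hinv, one_pow, mul_one, Ψ.toFun_toPuncturedHom, ha]

end Chart
end FormalCompletion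

/-! ### The Picard group in terms of subrings of one ring of expansions -/

namespace SheafPic

variable {T : TopCat.{u}} {O : TopCat.Sheaf CommRingCat.{u} T} {p : T} {R : Type u} [CommRing R]

variable (O p R) in
/-- Compatible homomorphisms from functions on neighbourhoods of a point to a fixed ring. -/
structure Expansion where
  /-- the homomorphisms -/
  toFun : ∀ W : Opens T, p ∈ W → (fn O W →+* R)
  toFun_res : ∀ {W W' : Opens T} (h : W' ≤ W) (hW' : p ∈ W') (c : fn O W),
    toFun W' hW' (fnRes O h c) = toFun W (h hW') c

lemma mem_units_range_iff {A : Type*} [CommRing A] {ψ : A →+* R} (hψ : Function.Injective ψ) {u :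
    Rˣ} :
    u ∈ ψ.range.toSubmonoid.units ↔ ∃ a : Aˣ, Units.map (ψ : A →* R) a = u := by
  rw [Submonoid.mem_units_iff]
  constructor
  · rintro ⟨⟨a, ha⟩, ⟨b, hb⟩⟩
    refine ⟨⟨a, b, hψ ?_, hψ ?_⟩, Units.ext ha⟩
    · rw [map_mul, ha, hb, Units.mul_inv, map_one]
    · rw [map_mul, ha, hb, Units.inv_mul, map_one]
  · rintro ⟨a, rfl⟩
    exact ⟨⟨a, rfl⟩, ⟨(a⁻¹ : Aˣ), rfl⟩⟩

variable {U V : Opens T} (Ψ : Expansion O p R)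

/-- An expansion is an isomorphism of the functions on `U` with the subring `E`. -/
structure Expansion.IsIsoOn (U : Opens T) (E : Subring R) : Prop where
  mem : p ∈ U
  injective : Function.Injective (Ψ.toFun U mem)
  range_eq : (Ψ.toFun U mem).range = E

variable {Ψ} {EU EV E : Subring R}

lemma Expansion.IsIsoOn.mem_units_iff (h : Ψ.IsIsoOn U EU) {u : Rˣ} :
    u ∈ EU.toSubmonoid.units ↔ ∃ a : (fn O U)ˣ, Ψ.toFun U h.mem (a : fn O U) = u := by
  refine (iff_of_eq (congrArg (u ∈ ·.toSubmonoid.units) h.range_eq.symm)).trans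
    ((mem_units_range_iff h.injective).trans (exists_congr fun a => Units.ext_iff))

lemma Expansion.IsIsoOn.mem_units (h : Ψ.IsIsoOn U EU) (a : (fn O U)ˣ) :
    ∃ u ∈ EU.toSubmonoid.units, Ψ.toFun U h.mem (a : fn O U) = (u : R) :=
  ⟨Units.map (Ψ.toFun U h.mem : fn O U →* R) a, h.mem_units_iff.2 ⟨a, rfl⟩, rfl⟩

lemma exists_eq_fnRes_mul_fnRes (hU : Ψ.IsIsoOn U EU) (hV : Ψ.IsIsoOn V EV)
    (hUV : Ψ.IsIsoOn (U ⊓ V) E)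
    (h : E.toSubmonoid.units ≤ EU.toSubmonoid.units ⊔ EV.toSubmonoid.units) (c : (fn O (U ⊓ V))ˣ) :
    ∃ (a : (fn O U)ˣ) (b : (fn O V)ˣ),
      (c : fn O (U ⊓ V)) = fnRes O inf_le_left (a : fn O U) * fnRes O inf_le_right (b : fn O V) :=
          by
  obtain ⟨u, hu, e⟩ := hUV.mem_units c
  obtain ⟨v, hv, w, hw, rfl⟩ := Subgroup.mem_sup.1 (h hu)
  obtain ⟨a, ha⟩ := hU.mem_units_iff.1 hv
  obtain ⟨b, hb⟩ := hV.mem_units_iff.1 hw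
  refine ⟨a, b, hUV.injective ?_⟩
  rw [e, map_mul, Ψ.toFun_res, Ψ.toFun_res, ha, hb, Units.val_mul]

/-- The Picard group in terms of expansions. -/
theorem exists_pic_equiv_of_expansion {T' : Type*} [CommGroup T'] (hsup : U ⊔ V = ⊤)
    (hU : Ψ.IsIsoOn U EU) (hV : Ψ.IsIsoOn V EV) (hUV : Ψ.IsIsoOn (U ⊓ V) E)
    (hfU : ∀ L : LineBundle O, ∃ s, IsFrame L.1.val U s)
    (hfV : ∀ L : LineBundle O, ∃ s, IsFrame L.1.val V s)
    (ρ : T' →* Rˣ) (hρ : ∀ t, ρ t ∈ E.toSubmonoid.units)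
    (hsurj : ∀ u ∈ E.toSubmonoid.units, ∃ t, ∃ a ∈ EU.toSubmonoid.units,
      ∃ b ∈ EV.toSubmonoid.units, u = a * ρ t * b)
    (hinj : ∀ t, ∀ a ∈ EU.toSubmonoid.units, ∀ b ∈ EV.toSubmonoid.units, ρ t = a * b → t = 1) :
    ∃ (τ : T' →* (fn O (U ⊓ V))ˣ) (e : Pic O ≃* T'),
      (∀ t, Ψ.toFun _ hUV.mem (τ t : fn O (U ⊓ V)) = ρ t) ∧
      ∀ t, (e.symm t).HasTransition U V (τ t) := by
  have hinj' : Function.Injective (Units.map (Ψ.toFun _ hUV.mem : fn O (U ⊓ V) →* R)) :=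
    Units.map_injective hUV.injective
  choose c hc using fun t => hUV.mem_units_iff.1 (hρ t)
  have hc' : ∀ t, Units.map (Ψ.toFun _ hUV.mem : fn O (U ⊓ V) →* R) (c t) = ρ t :=
    fun t => Units.ext (hc t)
  let τ : T' →* (fn O (U ⊓ V))ˣ :=
    { toFun := c
      map_one' := hinj' (by rw [hc', map_one, map_one])
      map_mul' := fun s t => hinj' (by rw [hc', map_mul, map_mul, hc', hc']) }
  obtain ⟨e, he⟩ := exists_pic_equiv hsup τ hfU hfV (fun d => by
      obtain ⟨u, hu, h⟩ := hUV.mem_units d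
      obtain ⟨t, v, hv, w, hw, rfl⟩ := hsurj u hu
      obtain ⟨a, ha⟩ := hU.mem_units_iff.1 hv
      obtain ⟨b, hb⟩ := hV.mem_units_iff.1 hw
      refine ⟨t, a, b, hUV.injective ?_⟩
      rw [h, map_mul, map_mul, Ψ.toFun_res, Ψ.toFun_res, ha, hb, Units.val_mul, Units.val_mul]
      exact congrArg (_ * · * _) (hc t).symm) (fun t a b h => by
      obtain ⟨v, hv, ha⟩ := hU.mem_units a
      obtain ⟨w, hw, hb⟩ := hV.mem_units b
      refine hinj t v hv w hw (Units.ext ?_)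
      have h1 := congrArg (Ψ.toFun _ hUV.mem) h
      rw [map_mul, Ψ.toFun_res, Ψ.toFun_res, ha, hb] at h1
      exact (hc t).symm.trans h1)
  exact ⟨τ, e, hc, he⟩

end SheafPic

/-! ### Triviality of line bundles on a chart -/

namespace FormalCompletion.Chart
open SeriesSplitting SheafPic

variable {S : Scheme.{u}} {I : S.IdealSheafData} {k : Type u} [Field k] {K : Type u} [Field K]
    {j : Spec (.of (PowerSeries K)) ⟶ S} {𝒞 : Chart I k j} {hj : arcPoint j ∈ I.support}

/-- Invertible modules are trivial on the chart if units can be split. -/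
theorem exists_isFrame {O : TopCat.Sheaf CommRingCat.{u} (space I)} {R : Type u} [CommRing R]
    {Ψ : Expansion O (point hj) R} {E : Polynomial k → Subring R}
    (hE : ∀ f, f ≠ 0 → Ψ.IsIsoOn (𝒞.W f) (E f))
    (hsplit : ∀ f g, f ≠ 0 → g ≠ 0 → (E (f * g)).toSubmonoid.units ≤
      (E f).toSubmonoid.units ⊔ (E g).toSubmonoid.units) (L : LineBundle O) :
    ∃ s, IsFrame L.1.val ((Opens.map (incl I)).obj 𝒞.U) s := by
  have hres : ∀ {A B : Opens (space I)}, B ≤ A → (∃ s, IsFrame L.1.val A s) →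
      ∃ s, IsFrame L.1.val B s := fun h ⟨s, hs⟩ => ⟨_, hs.res h⟩
  -- The `f` over whose nonvanishing locus `L` has a frame form an ideal once 0 is added. For sums,
  -- frames over `W f` and `W g` combine to a frame over their union, the locus of the greatest
  -- common divisor, which contains `W (f + g)`. Zero is admitted separately because units are known
  -- to split only for nonzero `f` and `g`.
  let J : Ideal (Polynomial k) :=
    { carrier := {f | f = 0 ∨ ∃ s, IsFrame L.1.val (𝒞.W f) s}
      zero_mem' := Or.inl rfl
      smul_mem' := by
        rintro a f (rfl | h)
        · exact Or.inl (smul_zero a)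
        · exact Or.inr (hres (W_le_of_dvd (dvd_mul_left f a)) h)
      add_mem' := by
        rintro f g hf hg
        by_cases hf0 : f = 0
        · rwa [hf0, zero_add]
        by_cases hg0 : g = 0
        · rwa [hg0, add_zero]
        obtain ⟨h, f', g', x, y, hh, hhf, hhg, -⟩ := exists_bezout f g hf0
        refine Or.inr (hres (W_le_of_dvd (dvd_add (Dvd.intro _ hhf.symm) (Dvd.intro _ hhg.symm)))
            ?_)
        rw [← W_sup_eq hh (Dvd.intro _ hhf.symm) (Dvd.intro _ hhg.symm)]
        refine exists_isFrame_sup L.1 (exists_eq_fnRes_mul_fnRes (hE f hf0) (hE g hg0) ?_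
          (hsplit f g hf0 hg0)) (hf.resolve_left hf0) (hg.resolve_left hg0)
        rw [← W_mul]
        exact hE _ (mul_ne_zero hf0 hg0) }
  obtain ⟨d, hd⟩ := IsPrincipalIdealRing.principal J
  -- Since `L` is locally trivial, each point of the divisor in the chart has an element of `J` that
  -- does not vanish there. The generator `d` divides it, so `d` vanishes nowhere.
  have hle : (Opens.map (incl I)).obj 𝒞.U ≤ 𝒞.W d := by
    intro z hz
    obtain ⟨O', hz', s, hs⟩ := L.2 z
    obtain ⟨f, hf, hzf⟩ := exists_W_le (𝒞 := 𝒞) hz hz'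
    have h1 : f ∈ J := Or.inr ⟨_, hs.res hf⟩
    rw [hd] at h1
    exact W_le_of_dvd (Ideal.mem_span_singleton.1 h1) hzf
  have hd' : d ∈ J := by
    rw [hd]
    exact Ideal.mem_span_singleton_self d
  exact hres hle (hd'.resolve_left (ne_zero_of_mem_W (hle (show point hj ∈ _ from 𝒞.mem))))

/-- Expansions of functions on the formal completion. -/
def formalExpansion (hj : arcPoint j ∈ I.support) :
    Expansion (structureSheaf I) (point hj) (PowerSeries K) where
  toFun _ hW := expansion hj hW
  toFun_res h _ c := expansion_res hj (homOfLE h) _ c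

/-- Expansions of functions on the punctured formal neighbourhood. -/
def puncturedExpansion (Ψ : PuncturedExpansion hj) :
    Expansion (puncturedSheaf I) (point hj) (LaurentSeries K) where
  toFun W hW := Ψ.toFun W hW
  toFun_res h hW' c := Ψ.toFun_res _ _ (homOfLE h) hW' c

variable (𝒞)

lemma formalExpansion_isIsoOn {f : Polynomial k} (hf : f ≠ 0) :
    (formalExpansion hj).IsIsoOn (𝒞.W f) (series (𝒞.ω : K) (loc 𝒞.ι f)) where
  mem := mem_W hj hf
  injective := expansion_injective hj hf
  range_eq := by
    refine le_antisymm ?_ ?_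
    · rintro _ ⟨c, rfl⟩
      exact expansion_mem_series hj hf c
    · intro F hF
      exact exists_expansion_eq hj hf hF

lemma puncturedExpansion_isIsoOn (Ψ : PuncturedExpansion hj) {f : Polynomial k} (hf : f ≠ 0) :
    (puncturedExpansion Ψ).IsIsoOn (𝒞.W f) (laurent 𝒞.ω (loc 𝒞.ι f)) where
  mem := mem_W hj hf
  injective := toFun_injective Ψ hf
  range_eq := by
    refine le_antisymm ?_ ?_
    · rintro _ ⟨c, rfl⟩
      exact toFun_mem_laurent Ψ hf c
    · intro F hF
      exact exists_toFun_eq Ψ hf hF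

include hj in
theorem exists_isFrame_formal (L : LineBundle (structureSheaf I)) :
    ∃ s, IsFrame L.1.val ((Opens.map (incl I)).obj 𝒞.U) s :=
  exists_isFrame (hj := hj) (fun _ hf => 𝒞.formalExpansion_isIsoOn hf) (fun _ _ hf hg =>
    units_series_le_sup (loc_mono ((map_ne_zero_iff _ 𝒞.ι_injective).2 (mul_ne_zero hf hg))
        (dvd_mul_right _ _))
      (loc_mono ((map_ne_zero_iff _ 𝒞.ι_injective).2 (mul_ne_zero hf hg)) (dvd_mul_left _ _))
      (loc_mul_le_sup 𝒞.ι_injective hf hg) (units_loc_mul_le_sup 𝒞.ι_injective hf hg)) L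

theorem exists_isFrame_punctured (Ψ : PuncturedExpansion hj) (L : LineBundle (puncturedSheaf I)) :
    ∃ s, IsFrame L.1.val ((Opens.map (incl I)).obj 𝒞.U) s :=
  exists_isFrame (fun _ hf => 𝒞.puncturedExpansion_isIsoOn Ψ hf) (fun _ _ hf hg =>
    units_laurent_le_sup (loc_mono ((map_ne_zero_iff _ 𝒞.ι_injective).2 (mul_ne_zero hf hg))
        (dvd_mul_right _ _))
      (loc_mono ((map_ne_zero_iff _ 𝒞.ι_injective).2 (mul_ne_zero hf hg)) (dvd_mul_left _ _))
      (loc_mul_le_sup 𝒞.ι_injective hf hg) (units_loc_mul_le_sup 𝒞.ι_injective hf hg)) L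

end FormalCompletion.Chart

/-! ### Functions on the charts of the projective plane and the ideal of the line at infinity -/

namespace ProjPlane
open MvPolynomial
variable {k : Type u} [Field k]

instance (x : P2 k) : (ProjectiveSpectrum.asHomogeneousIdeal (𝒜 := grading k) x).toIdeal.IsPrime :=
  ProjectiveSpectrum.isPrime (𝒜 := grading k) x

/-- The local ring of `Proj k[z₀, z₁, z₂]` at `x`, before passing to degree `0`. -/
abbrev LocalizationAt (x : P2 k) : Type u :=
  Localization (ProjectiveSpectrum.asHomogeneousIdeal (𝒜 := grading k) x).toIdeal.primeCompl

/-- The value of a section in the localization at a point. -/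
def germVal {U : (P2 k).Opens} (x : U) (s : Γ(P2 k, U)) : LocalizationAt x.1 :=
  HomogeneousLocalization.val (s.1 x)

lemma section_ext {U : (P2 k).Opens} {s t : Γ(P2 k, U)} (h : ∀ x, germVal x s = germVal x t) :
    s = t :=
  Subtype.ext (funext fun x => HomogeneousLocalization.val_injective _ (h x))

lemma germVal_mul {U : (P2 k).Opens} (x : U) (s t : Γ(P2 k, U)) :
    germVal x (s * t) = germVal x s * germVal x t :=
  HomogeneousLocalization.val_mul _ _

lemma germVal_res {U V : (P2 k).Opens} (h : V ≤ U) (x : V) (s : Γ(P2 k, U)) :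
    germVal x ((P2 k).presheaf.map (homOfLE h).op s) = germVal ⟨x.1, h x.2⟩ s := rfl

lemma germVal_frac (i j) (x : chart k j) :
    germVal x (frac k i j) = Localization.mk (X i) ⟨X j, x.2⟩ := by
  have h : germVal x (frac k i j) = Localization.mk (X i) ⟨X j ^ 1, (pow_one (X j : MvPolynomial
      (Fin 3) k)).symm ▸ x.2⟩ := rfl
  rw [h]
  congr 2
  exact pow_one _

lemma germVal_const (j) (x : chart k j) (c : k) :
    germVal x (const k j c) = algebraMap _ _ (C c : MvPolynomial (Fin 3) k) :=
  rfl

lemma frac_self (i : Fin 3) : frac k i i = 1 := by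
  apply section_ext
  intro x
  rw [germVal_frac]
  exact (Localization.mk_self (⟨X i, x.2⟩ : (ProjectiveSpectrum.asHomogeneousIdeal
    (𝒜 := grading k) x.1).toIdeal.primeCompl)).trans HomogeneousLocalization.val_one.symm

lemma frac_mul (i j l : Fin 3) :
    (P2 k).presheaf.map (homOfLE (inf_le_left : chart k j ⊓ chart k l ≤ _)).op (frac k i j) *
      (P2 k).presheaf.map (homOfLE (inf_le_right : chart k j ⊓ chart k l ≤ _)).op (frac k j l) =
      (P2 k).presheaf.map (homOfLE (inf_le_right : chart k j ⊓ chart k l ≤ _)).op (frac k i l) := by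
  apply section_ext
  intro x
  rw [germVal_mul, germVal_res, germVal_res, germVal_res, germVal_frac, germVal_frac, germVal_frac,
    Localization.mk_mul, Localization.mk_eq_mk_iff, Localization.r_iff_exists]
  exact ⟨1, by simp; ring⟩

lemma const_res (j l : Fin 3) (c : k) :
    (P2 k).presheaf.map (homOfLE (inf_le_left : chart k j ⊓ chart k l ≤ _)).op (const k j c) =
      (P2 k).presheaf.map (homOfLE (inf_le_right : chart k j ⊓ chart k l ≤ _)).op (const k l c) :=
          by
  apply section_ext
  intro x
  rw [germVal_res, germVal_res, germVal_const, germVal_const]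

lemma X_mem (j : Fin 3) : (X j : MvPolynomial (Fin 3) k) ∈ grading k 1 := isHomogeneous_X k j

lemma eval₂_mul_of_isHomogeneous {R S σ : Type*} [CommRing R] [CommRing S] (f : R →+* S) (g : σ →
    S) (c : S)
    {p : MvPolynomial σ R} {n : ℕ} (hp : p.IsHomogeneous n) : eval₂ f (fun i => g i * c) p = eval₂
        f g p * c ^ n := by
  rw [eval₂_eq, eval₂_eq, Finset.sum_mul]
  refine Finset.sum_congr rfl fun d hd => ?_
  have h : ∑ i ∈ d.support, d i = n := by
    rw [← hp (mem_support_iff.1 hd)]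
    simp [Finsupp.weight_apply, Finsupp.sum]
  simp only [mul_pow, Finset.prod_mul_distrib]
  rw [Finset.prod_pow_eq_pow_sum, h, mul_assoc]

/-- A function on the chart is `p / zⱼⁿ` with `p` homogeneous of degree `n`, and by homogeneity this
is `p` evaluated at the quotients `zᵢ / zⱼ`. -/
lemma exists_eq_eval₂ (j : Fin 3) (a : Γ(P2 k, chart k j)) :
    ∃ p, a = eval₂ (const k j) (fun i => frac k i j) p := by
  obtain ⟨b, rfl⟩ := (ConcreteCategory.bijective_of_isIso
    (Proj.basicOpenIsoAway (grading k) (X j) (X_mem j) one_pos).hom).2 a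
  obtain ⟨n, p, hp, rfl⟩ := HomogeneousLocalization.Away.mk_surjective (grading k) (X_mem j) b
  refine ⟨p, ?_⟩
  rw [Proj.basicOpenIsoAway_hom]
  have h := eval₂_comp_left (Proj.awayToSection (grading k) (X j)).hom
    ((algebraMap (grading k 0) (HomogeneousLocalization.Away (grading k) (X j))).comp
      (algebraMap k (grading k 0))) (fun i => HomogeneousLocalization.Away.mk (grading k) (d := 1)
          (X_mem j) 1 (X i)
      (X_mem i)) p
  refine Eq.trans (congrArg (Proj.awayToSection (grading k) (X j)).hom ?_) h
  apply HomogeneousLocalization.val_injective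
  have h := eval₂_comp_left (algebraMap (HomogeneousLocalization.Away (grading k) (X j))
      (Localization.Away (X j : MvPolynomial (Fin 3) k)))
    ((algebraMap (grading k 0) (HomogeneousLocalization.Away (grading k) (X j))).comp
      (algebraMap k (grading k 0))) (fun i => HomogeneousLocalization.Away.mk (grading k) (d := 1)
          (X_mem j) 1 (X i)
      (X_mem i)) p
  rw [HomogeneousLocalization.algebraMap_apply] at h
  rw [h, HomogeneousLocalization.Away.val_mk]
  have h1 : (fun i : Fin 3 => algebraMap _ (Localization.Away (X j : MvPolynomial (Fin 3) k)) (X i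
      : MvPolynomial (Fin 3) k) *
      Localization.mk 1 (⟨X j, Submonoid.mem_powers _⟩ : Submonoid.powers (X j : MvPolynomial (Fin
          3) k))) = ⇑(algebraMap (HomogeneousLocalization.Away (grading k) (X j))
              (Localization.Away (X j : MvPolynomial (Fin 3) k))) ∘ (fun i =>
                  HomogeneousLocalization.Away.mk (grading k) (d := 1) (X_mem j) 1 (X i)
      (X_mem i)) := by
    funext i
    refine Eq.trans ?_ (HomogeneousLocalization.Away.val_mk (grading k) 1 (X_mem j) (X i) (X_mem
        i)).symm
    rw [← Localization.mk_one_eq_algebraMap, Localization.mk_mul]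
    simp
  rw [← h1, eval₂_mul_of_isHomogeneous _ _ _ (by simpa using hp : p.IsHomogeneous n)]
  have h2 : eval₂ ((algebraMap (HomogeneousLocalization.Away (grading k) (X j)) (Localization.Away
      (X j : MvPolynomial (Fin 3) k))).comp ((algebraMap (grading k 0)
          (HomogeneousLocalization.Away (grading k) (X j))).comp
      (algebraMap k (grading k 0)))) (fun i : Fin 3 => algebraMap _ (Localization.Away (X j :
          MvPolynomial (Fin 3) k)) (X i : MvPolynomial (Fin 3) k)) p = algebraMap _ _ p := by
    have := eval₂_comp_left (algebraMap (MvPolynomial (Fin 3) k) (Localization.Away (X j :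
        MvPolynomial (Fin 3) k))) C X p
    rw [eval₂_eta] at this
    exact this.symm
  rw [h2, Localization.mk_pow, ← Localization.mk_one_eq_algebraMap, Localization.mk_mul]
  congr 1
  · simp
  · rw [one_mul]
    rfl

variable (k) in
lemma basicOpen_frac (i j : Fin 3) : (P2 k).basicOpen (frac k i j) = chart k i ⊓ chart k j := by
  have hle : (P2 k).basicOpen (frac k i j) ≤ chart k j := (P2 k).basicOpen_le _
  have h1 := (chart k j).toSpecΓ_preimage_basicOpen (frac k i j)
  have h2 : (chart k j).ι ⁻¹ᵁ chart k i = (chart k j).toSpecΓ ⁻¹ᵁ PrimeSpectrum.basicOpen (frac k i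
      j) := by
    have e : (chart k j).ι = Proj.basicOpenToSpec (grading k) (X j) ≫ Proj.awayι (grading k) (X j)
        (X_mem j) one_pos := by
      rw [← Proj.basicOpenIsoSpec_inv_ι, ← Proj.basicOpenIsoSpec_hom _ _ (X_mem j) one_pos,
          Iso.hom_inv_id_assoc]
      rfl
    rw [e]
    change Proj.basicOpenToSpec (grading k) (X j) ⁻¹ᵁ (Proj.awayι (grading k) (X j) (X_mem j)
        one_pos ⁻¹ᵁ (Proj.basicOpen (grading k) (X i))) = _
    rw [Proj.awayι_preimage_basicOpen (grading k) (X_mem j) one_pos (X_mem i) one_pos]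
    change (chart k j).toSpecΓ ⁻¹ᵁ PrimeSpectrum.basicOpen ((Proj.awayToSection (grading k) (X
        j)).hom _) = _
    congr 3
    simp [HomogeneousLocalization.Away.isLocalizationElem]
  ext x
  constructor
  · intro hx
    have hxj := hle hx
    have : (⟨x, hxj⟩ : chart k j) ∈ (chart k j).ι ⁻¹ᵁ chart k i := by
      rw [h2, h1]
      exact hx
    exact ⟨this, hxj⟩
  · rintro ⟨hxi, hxj⟩
    have : (⟨x, hxj⟩ : chart k j) ∈ (chart k j).ι ⁻¹ᵁ chart k i := hxi
    rw [h2, h1] at this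
    exact this

lemma isAffineOpen_chart (j : Fin 3) : IsAffineOpen (chart k j) :=
  Proj.isAffineOpen_basicOpen (grading k) (X j) (X_mem j) one_pos

variable (k) in
lemma iSup_chart : ⨆ i, chart k i = ⊤ := by
  refine Proj.iSup_basicOpen_eq_top' (grading k) (fun i : Fin 3 => (X i : MvPolynomial (Fin 3) k))
    (fun i => ⟨1, X_mem i⟩) (top_le_iff.1 fun p _ => ?_)
  induction p using MvPolynomial.induction_on with
  | C a => exact Subalgebra.algebraMap_mem _ (⟨C a, isHomogeneous_C _ a⟩ : grading k 0)
  | add p q hp hq => exact add_mem (hp trivial) (hq trivial)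
  | mul_X p i hp => exact mul_mem (hp trivial) (Algebra.subset_adjoin ⟨i, rfl⟩)

lemma mem_support_iff {z : P2 k} : z ∈ (idealInfinity k).support ↔ z ∉ chart k 0 := by
  rw [← SetLike.mem_coe, idealInfinity, Scheme.IdealSheafData.coe_support_vanishingIdeal]
  rfl

variable (k) in
lemma chartInfinity_sup : chartInfinity k 1 ⊔ chartInfinity k 2 = ⊤ := by
  refine top_le_iff.1 fun z _ => ?_
  have h : z.1 ∈ ⨆ i, chart k i := by
    rw [iSup_chart]
    trivial
  obtain ⟨i, hi⟩ := Opens.mem_iSup.1 h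
  fin_cases i
  · exact absurd hi (mem_support_iff.1 z.2)
  · exact Or.inl hi
  · exact Or.inr hi

/-- The reduced structure is defined by all functions that vanish on the zero set of `z₀ / zⱼ`,
which is where the radical comes from. It is removed in `chartOf`. -/
lemma ideal_chart (j : Fin 3) : (idealInfinity k).ideal ⟨chart k j, isAffineOpen_chart j⟩ =
    (Ideal.span {frac k 0 j}).radical := by
  rw [← PrimeSpectrum.vanishingIdeal_zeroLocus_eq_radical, PrimeSpectrum.zeroLocus_span]
  refine congrArg PrimeSpectrum.vanishingIdeal ?_
  ext x
  have h1 : (isAffineOpen_chart (k := k) j).fromSpec x ∈ (P2 k).basicOpen (frac k 0 j) ↔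
      frac k 0 j ∉ x.asIdeal := by
    have h := (isAffineOpen_chart (k := k) j).fromSpec_preimage_basicOpen (frac k 0 j)
    have h2 := congrArg (x ∈ ·) h
    exact iff_of_eq h2
  have h2 : (isAffineOpen_chart (k := k) j).fromSpec x ∈ chart k j := by
    have h := (isAffineOpen_chart (k := k) j).fromSpec_preimage_self
    have : x ∈ (isAffineOpen_chart (k := k) j).fromSpec ⁻¹ᵁ chart k j := by
      rw [h]
      trivial
    exact this
  rw [basicOpen_frac] at h1
  rw [PrimeSpectrum.mem_zeroLocus, Set.singleton_subset_iff, SetLike.mem_coe, ← not_iff_not, ← h1]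
  change ¬¬ _ ↔ _
  rw [not_not]
  exact ⟨fun h => ⟨h, h2⟩, fun h => h.1⟩

end ProjPlane

/-! ### The arc through the line at infinity and the two charts -/

namespace ProjPlane
open MvPolynomial SeriesSplitting FormalCompletion

variable {k : Type u} [Field k]

lemma evalSpec_fromSpec {Y : Scheme.{u}} {V : Y.Opens} (hV : IsAffineOpen V) {R : Type u} [CommRing
    R]
    (φ : Γ(Y, V) →+* R) (h : ⊤ ≤ (Spec.map (CommRingCat.ofHom φ) ≫ hV.fromSpec) ⁻¹ᵁ V) (a : Γ(Y,
        V)) :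
    evalSpec (Spec.map (CommRingCat.ofHom φ) ≫ hV.fromSpec) V h a = φ a := by
  have h1 : ⊤ ≤ hV.fromSpec ⁻¹ᵁ V := hV.fromSpec_preimage_self.ge
  refine (evalSpec_map (R := Γ(Y, V)) hV.fromSpec φ V h1 h a).trans (congrArg φ ?_)
  have h2 : hV.fromSpec.appLE V ⊤ h1 ≫ (Scheme.ΓSpecIso Γ(Y, V)).hom = 𝟙 _ := by
    rw [Scheme.Hom.appLE, IsAffineOpen.fromSpec_app_self, Category.assoc, Category.assoc,
      ← Functor.map_comp_assoc]
    have : (eqToHom hV.fromSpec_preimage_self).op ≫ (homOfLE h1).op = 𝟙 _ := Subsingleton.elim _ _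
    rw [this, CategoryTheory.Functor.map_id, Category.id_comp, Iso.inv_hom_id]
  exact ConcreteCategory.congr_hom h2 a

variable (k) in
/-- The substitution `z₀ = s`, `z₁ = 1`, `z₂ = v`. -/
def substArc : MvPolynomial (Fin 3) k →+* PowerSeries (Coord k) :=
  eval₂Hom (PowerSeries.C.comp HahnSeries.C) ![PowerSeries.X, 1, PowerSeries.C (coord k : Coord k)]

lemma substArc_X_one : substArc k (X 1) = 1 := by simp [substArc]

variable (k) in
/-- The extension of the substitution to fractions. -/
def substArcAway : Localization.Away (X 1 : MvPolynomial (Fin 3) k) →+* PowerSeries (Coord k) :=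
  IsLocalization.Away.lift (X 1) (g := substArc k) (by rw [substArc_X_one]; exact isUnit_one)

lemma substArcAway_mk_X (i : Fin 3) (s : Submonoid.powers (X 1 : MvPolynomial (Fin 3) k)) :
    substArcAway k (Localization.mk (X i) s) = substArc k (X i) := by
  obtain ⟨_, n, rfl⟩ := s
  have h := congrArg (substArcAway k) (IsLocalization.mk'_spec (Localization.Away (X 1 :
      MvPolynomial (Fin 3) k)) (X i) (⟨_, n, rfl⟩ : Submonoid.powers (X 1 : MvPolynomial (Fin 3)
          k)))
  rw [map_mul, substArcAway, IsLocalization.Away.lift_eq, IsLocalization.Away.lift_eq, map_pow,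
      substArc_X_one, one_pow, mul_one] at h
  rw [Localization.mk_eq_mk']
  exact h

variable (k) in
/-- The expansion of functions on the chart `z₁ ≠ 0` along the arc. -/
def arcHom : Γ(P2 k, chart k 1) →+* PowerSeries (Coord k) :=
  ((substArcAway k).comp (algebraMap (HomogeneousLocalization.Away (grading k) (X 1)) _)).comp
    (Proj.basicOpenIsoAway (grading k) (X 1) (X_mem 1) one_pos).inv.hom

lemma arcHom_awayToSection (a : HomogeneousLocalization.Away (grading k) (X 1)) :
    arcHom k ((Proj.awayToSection (grading k) (X 1)).hom a) = substArcAway k a.val := by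
  have h := (Proj.basicOpenIsoAway (grading k) (X 1) (X_mem 1) one_pos).hom_inv_id
  rw [Proj.basicOpenIsoAway_hom] at h
  exact congrArg (fun b : HomogeneousLocalization.Away (grading k) (X 1) => substArcAway k b.val)
    (ConcreteCategory.congr_hom h a)

lemma arcHom_frac (i : Fin 3) : arcHom k (frac k i 1) = substArc k (X i) := by
  refine (arcHom_awayToSection _).trans ?_
  exact (congrArg (substArcAway k) (HomogeneousLocalization.Away.val_mk (grading k) 1 (X_mem 1)
    (X i) (X_mem i))).trans (substArcAway_mk_X i _)

lemma arcHom_const (c : k) : arcHom k (const k 1 c) = PowerSeries.C (HahnSeries.C c) := by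
  refine (arcHom_awayToSection _).trans ?_
  refine (IsLocalization.Away.lift_eq (X 1 : MvPolynomial (Fin 3) k) _ (C c)).trans ?_
  simp [substArc]

variable (k) in
/-- The arc `z₀ / z₁ = s`, `z₂ / z₁ = v`. -/
def arc : Spec (.of (PowerSeries (Coord k))) ⟶ P2 k :=
  Spec.map (CommRingCat.ofHom (arcHom k)) ≫ (isAffineOpen_chart 1).fromSpec

lemma top_le_arc_one : ⊤ ≤ arc k ⁻¹ᵁ chart k 1 := by
  rw [arc, Scheme.Hom.comp_preimage, (isAffineOpen_chart (k := k) 1).fromSpec_preimage_self]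
  exact le_rfl

lemma evalSpec_arc_one (a : Γ(P2 k, chart k 1)) :
    evalSpec (arc k) (chart k 1) top_le_arc_one a = arcHom k a :=
  evalSpec_fromSpec _ _ _ _

/-- On the arc `z₂ / z₁` is the coordinate `v`, which is invertible in the field of Laurent series.
One arc therefore serves both charts. -/
lemma top_le_arc_inf : ⊤ ≤ arc k ⁻¹ᵁ (chart k 2 ⊓ chart k 1) := by
  rw [← basicOpen_frac, ← isUnit_evalSpec_iff _ _ top_le_arc_one, evalSpec_arc_one, arcHom_frac]
  simp [substArc]

lemma top_le_arc_two : ⊤ ≤ arc k ⁻¹ᵁ chart k 2 := top_le_arc_inf.trans fun _ hx => hx.1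

/-- Dividing `zᵢ / z₁` by `z₂ / z₁ = v` gives `zᵢ / z₂`; this is the source of the slope `v⁻¹` in
the second chart. -/
lemma evalSpec_arc_frac_two (i : Fin 3) : evalSpec (arc k) (chart k 2) top_le_arc_two (frac k i 2) =
    PowerSeries.C ((coord k ^ (-1 : ℤ) : (Coord k)ˣ) : Coord k) * substArc k (X i) := by
  have h := congrArg (evalSpec (arc k) _ top_le_arc_inf) (frac_mul (k := k) i 2 1)
  rw [map_mul, evalSpec_res _ _ _ top_le_arc_two, evalSpec_res _ _ _ top_le_arc_one,
    evalSpec_res _ _ _ top_le_arc_one, evalSpec_arc_one, evalSpec_arc_one, arcHom_frac,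
    arcHom_frac] at h
  rw [← h, zpow_neg_one, mul_left_comm]
  have h1 : substArc k (X 2) = PowerSeries.C (coord k : Coord k) := by simp [substArc]
  rw [h1, ← map_mul, Units.inv_mul, map_one, mul_one]

lemma evalSpec_arc_const_two (c : k) : evalSpec (arc k) (chart k 2) top_le_arc_two (const k 2 c) =
    PowerSeries.C (HahnSeries.C c) := by
  have h := congrArg (evalSpec (arc k) _ top_le_arc_inf) (const_res (k := k) 2 1 c)
  rwa [evalSpec_res _ _ _ top_le_arc_two, evalSpec_res _ _ _ top_le_arc_one, evalSpec_arc_one,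
    arcHom_const] at h

lemma arcPoint_mem_support : arcPoint (arc k) ∈ (idealInfinity k).support := by
  rw [mem_support_iff]
  intro h
  have h1 : arcPoint (arc k) ∈ chart k 0 ⊓ chart k 1 := ⟨h, arcPoint_mem_iff.2 top_le_arc_one⟩
  rw [← basicOpen_frac, arcPoint_mem_iff, ← isUnit_evalSpec_iff _ _ top_le_arc_one,
    evalSpec_arc_one, arcHom_frac] at h1
  have h2 : substArc k (X 0) = PowerSeries.X := by simp [substArc]
  rw [h2] at h1
  exact PowerSeries.X_prime.not_isUnit h1

section chartOf

variable {i j : Fin 3} {e : ℤ} {ω : (Coord k)ˣ}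

variable (k i j) in
/-- Polynomials in `zᵢ / zⱼ` and `z₀ / zⱼ`. -/
def coordHom : Polynomial (Polynomial k) →+* Γ(P2 k, chart k j) :=
  Polynomial.eval₂RingHom (Polynomial.eval₂RingHom (const k j) (frac k i j)) (frac k 0 j)

lemma coordHom_surjective (hij : ∀ l, l = 0 ∨ l = i ∨ l = j) :
    Function.Surjective (coordHom k i j) := by
  intro a
  obtain ⟨p, rfl⟩ := exists_eq_eval₂ j a
  change _ ∈ (coordHom k i j).range
  induction p using MvPolynomial.induction_on with
  | C c =>
    rw [eval₂_C]
    exact ⟨Polynomial.C (Polynomial.C c), by simp [coordHom]⟩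
  | add p q hp hq =>
    rw [eval₂_add]
    exact add_mem hp hq
  | mul_X p l hp =>
    rw [eval₂_mul, eval₂_X]
    refine mul_mem hp ?_
    rcases hij l with rfl | rfl | rfl
    · exact ⟨Polynomial.X, by simp [coordHom]⟩
    · exact ⟨Polynomial.C Polynomial.X, by simp [coordHom]⟩
    · rw [frac_self]
      exact one_mem _

variable (hj : ⊤ ≤ arc k ⁻¹ᵁ chart k j)
  (hc : ∀ c, evalSpec (arc k) (chart k j) hj (const k j c) = PowerSeries.C (HahnSeries.C c))
  (hi : evalSpec (arc k) (chart k j) hj (frac k i j) = PowerSeries.C ((coord k ^ e : (Coord k)ˣ) :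
      Coord k))
  (h₀ : evalSpec (arc k) (chart k j) hj (frac k 0 j) = PowerSeries.C (ω : Coord k) * PowerSeries.X)

include hc hi h₀

lemma coeff_evalSpec_coordHom (p : Polynomial (Polynomial k)) (n : ℕ) :
    PowerSeries.coeff n (evalSpec (arc k) (chart k j) hj (coordHom k i j p)) =
      ω ^ n * evalAt (coord k ^ e) (p.coeff n) := by
  have hC : ∀ a : Polynomial k, evalSpec (arc k) (chart k j) hj (coordHom k i j (Polynomial.C a)) =
      PowerSeries.C (evalAt (coord k ^ e) a) := by
    intro a
    refine RingHom.congr_fun (f := ((evalSpec (arc k) (chart k j) hj).comp (coordHom k i j)).comp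
      Polynomial.C) (g := PowerSeries.C.comp (evalAt (coord k ^ e))) ?_ a
    refine Polynomial.ringHom_ext (fun c => ?_) ?_
    · simpa [coordHom] using hc c
    · simpa [coordHom] using hi
  induction p using Polynomial.induction_on' with
  | add p q hp hq => simp only [map_add, Polynomial.coeff_add, hp, hq, mul_add]
  | monomial m a =>
    have hX : evalSpec (arc k) (chart k j) hj (coordHom k i j Polynomial.X) =
        PowerSeries.C (ω : Coord k) * PowerSeries.X := by
      rw [← h₀]
      simp [coordHom]
    rw [← Polynomial.C_mul_X_pow_eq_monomial, map_mul, map_pow, map_mul, map_pow, hC, hX, mul_pow,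
      ← map_pow, ← mul_assoc, ← map_mul, PowerSeries.coeff_C_mul, PowerSeries.coeff_X_pow,
      Polynomial.coeff_C_mul, Polynomial.coeff_X_pow]
    split_ifs with h
    · rw [h, mul_one, mul_one, mul_comm]
    · simp

/-- The chart `zⱼ ≠ 0` with the coordinates `zᵢ / zⱼ` and `z₀ / zⱼ`. -/
def chartOf (he : e ≠ 0) (hij : ∀ l, l = 0 ∨ l = i ∨ l = j) : Chart (idealInfinity k) k (arc k)
    where
  U := chart k j
  affine := isAffineOpen_chart j
  mem := arcPoint_mem_iff.2 hj
  θ := coordHom k i j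
  θ_surjective := coordHom_surjective hij
  ideal_eq := by
    have hX : coordHom k i j Polynomial.X = frac k 0 j := by simp [coordHom]
    rw [ideal_chart, hX]
    refine le_antisymm ?_ Ideal.le_radical
    -- The ideal `(z₀ / zⱼ)` is already radical. If `a ^ n` lies in it, the prime `X` divides the
    -- expansion of `a`, so the constant coefficient of a polynomial representing `a` vanishes and
    -- `a` is a multiple of `z₀ / zⱼ`.
    rintro a ⟨n, hn⟩
    obtain ⟨p, rfl⟩ := coordHom_surjective hij a
    obtain ⟨b, hb⟩ := Ideal.mem_span_singleton.1 hn
    have h1 := congrArg (evalSpec (arc k) (chart k j) hj) hb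
    rw [map_pow, map_mul, h₀, mul_assoc, mul_left_comm] at h1
    have h2 := PowerSeries.X_prime.dvd_of_dvd_pow (Dvd.intro _ h1.symm)
    rw [PowerSeries.X_dvd_iff, ← PowerSeries.coeff_zero_eq_constantCoeff_apply,
      coeff_evalSpec_coordHom hj hc hi h₀, pow_zero, one_mul,
      map_eq_zero_iff _ (evalAt_injective he), ← Polynomial.X_dvd_iff] at h2
    rw [← hX, Ideal.mem_span_singleton]
    exact map_dvd _ h2
  ι := evalAt (coord k ^ e)
  ι_injective := evalAt_injective he
  ω := ω
  coeff_eval := coeff_evalSpec_coordHom hj hc hi h₀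

end chartOf

variable (k) in
/-- The chart `z₁ ≠ 0`. -/
def chartOne : Chart (idealInfinity k) k (arc k) :=
  chartOf (i := 2) (j := 1) (e := 1) (ω := 1) top_le_arc_one
    (fun c => by rw [evalSpec_arc_one, arcHom_const])
    (by rw [evalSpec_arc_one, arcHom_frac]; simp [substArc])
    (by rw [evalSpec_arc_one, arcHom_frac]; simp [substArc]) one_ne_zero (by decide)

variable (k) in
/-- The chart `z₂ ≠ 0`. -/
def chartTwo : Chart (idealInfinity k) k (arc k) :=
  chartOf (i := 1) (j := 2) (e := -1) (ω := coord k ^ (-1 : ℤ)) top_le_arc_two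
    evalSpec_arc_const_two
    (by rw [evalSpec_arc_frac_two, substArc_X_one, mul_one])
    (by rw [evalSpec_arc_frac_two]; simp [substArc]) (by decide) (by decide)

end ProjPlane

namespace FormalCompletion.Chart
open SeriesSplitting

lemma isLimitOf_of_dvd_of_eq {S : Scheme.{u}} {I : S.IdealSheafData} {k : Type u} [Field k]
    {K : Type u} [Field K] {j : Spec (.of (PowerSeries K)) ⟶ S} {𝒞 : Chart I k j}
    {f : Polynomial k} (hj : arcPoint j ∈ I.support) (hf : f ≠ 0) {V : S.Opens}
    {W : Opens (space I)} (hV : 𝒞.V f = V) (hW : 𝒞.W f = W) (h : ⊤ ≤ j ⁻¹ᵁ V) (h' : point hj ∈ W)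
    {c : (structureSheaf I).presheaf.obj (op W)} {x : ℕ → Γ(S, V)}
    (hx : ∀ n, PowerSeries.X ^ (n + 1) ∣ expansion hj h' c - evalSpec j V h (x n)) :
    IsLimitOf I V x W c := by
  subst hV hW
  exact isLimitOf_of_dvd hj hf hx

end FormalCompletion.Chart

/-! ### The two Picard groups -/

namespace ProjPlane
open MvPolynomial SeriesSplitting FormalCompletion SheafPic

variable {k : Type u} [Field k]

lemma chartOne_V : (chartOne k).V Polynomial.X = chart k 1 ⊓ chart k 2 := by
  have : coordHom k 2 1 (Polynomial.C Polynomial.X) = frac k 2 1 := by simp [coordHom]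
  change (P2 k).basicOpen (coordHom k 2 1 (Polynomial.C Polynomial.X)) = _
  rw [this, basicOpen_frac, inf_comm]

lemma chartOne_W : (chartOne k).W Polynomial.X = chartInfinity k 1 ⊓ chartInfinity k 2 := by
  rw [Chart.W, chartOne_V]
  rfl

lemma chartOne_W_one : (chartOne k).W 1 = chartInfinity k 1 := (chartOne k).W_one

lemma chartTwo_W_one : (chartTwo k).W 1 = chartInfinity k 2 := (chartTwo k).W_one

variable (k) in
/-- The expansion along the arc on the formal completion. -/
abbrev infinityExpansion : Expansion (formalSheaf k) (Chart.point (arcPoint_mem_support (k := k)))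
    (PowerSeries (Coord k)) :=
  Chart.formalExpansion arcPoint_mem_support

lemma infinityExpansion_isIsoOn_one :
    (infinityExpansion k).IsIsoOn (chartInfinity k 1) (series 1 (coeffsLeft k)) := by
  have h := (chartOne k).formalExpansion_isIsoOn (hj := arcPoint_mem_support) one_ne_zero
  rw [chartOne_W_one] at h
  exact h

lemma infinityExpansion_isIsoOn_two :
    (infinityExpansion k).IsIsoOn (chartInfinity k 2)
      (series ((coord k ^ (-1 : ℤ) : (Coord k)ˣ) : Coord k) (coeffsRight k)) := by
  have h := (chartTwo k).formalExpansion_isIsoOn (hj := arcPoint_mem_support) one_ne_zero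
  rw [chartTwo_W_one] at h
  exact h

lemma infinityExpansion_isIsoOn_inf :
    (infinityExpansion k).IsIsoOn (chartInfinity k 1 ⊓ chartInfinity k 2) (series 1 (coeffs k)) :=
        by
  have h := (chartOne k).formalExpansion_isIsoOn (hj := arcPoint_mem_support) Polynomial.X_ne_zero
  rw [chartOne_W] at h
  exact h

lemma top_le_arc_inf' : ⊤ ≤ arc k ⁻¹ᵁ (chart k 1 ⊓ chart k 2) :=
  top_le_arc_inf.trans fun _ h => ⟨h.2, h.1⟩

/-- Along the arc `x⁻¹ = z₀ / z₁` and `y⁻¹ = z₀ / z₂` take the values `X` and `v⁻¹ * X`, so the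
truncations that define values are those of the substitution `substXY`. -/
lemma evalSpec_evalTrunc (g : MvPowerSeries (Fin 2) k) (n : ℕ) :
    evalSpec (arc k) _ top_le_arc_inf' (evalTrunc k g n) =
      aeval (invXY k) (g.truncTotal (n + 1)) := by
  have hl : ∀ a, evalSpec (arc k) _ top_le_arc_inf' (resLeft k a) = arcHom k a := fun a =>
    (evalSpec_res _ _ _ top_le_arc_one a).trans (evalSpec_arc_one a)
  rw [evalTrunc, ← coe_eval₂Hom, ← RingHom.comp_apply, aeval_def, ← coe_eval₂Hom]
  congr 1
  refine ringHom_ext (fun c => ?_) fun i => ?_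
  · rw [RingHom.comp_apply, coe_eval₂Hom, coe_eval₂Hom, eval₂_C, eval₂_C, RingHom.comp_apply, hl,
      arcHom_const, PowerSeries.algebraMap_apply, LaurentSeries.algebraMap_apply k]
  · rw [RingHom.comp_apply, coe_eval₂Hom, coe_eval₂Hom, eval₂_X, eval₂_X]
    fin_cases i
    · refine (hl _).trans ((arcHom_frac 0).trans ?_)
      simp [substArc, invXY]
    · refine (evalSpec_res _ _ _ top_le_arc_two _).trans ((evalSpec_arc_frac_two 0).trans ?_)
      simp [substArc, invXY]

lemma isValue_of_expansion_eq {g : MvPowerSeries (Fin 2) k}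
    {c : fn (formalSheaf k) (chartInfinity k 1 ⊓ chartInfinity k 2)}
    (h : (infinityExpansion k).toFun _ infinityExpansion_isIsoOn_inf.mem c = substXY k g) :
    IsValue k g c :=
  Chart.isLimitOf_of_dvd_of_eq arcPoint_mem_support Polynomial.X_ne_zero chartOne_V chartOne_W
    top_le_arc_inf' infinityExpansion_isIsoOn_inf.mem fun n => by
      rw [evalSpec_evalTrunc]
      refine (dvd_substXY_sub_truncTotal g (n + 1)).trans (dvd_of_eq (congrArg (· - _) h.symm))

lemma isRatio_of_expansion_eq
    {c : fn (formalSheaf k) (chartInfinity k 1 ⊓ chartInfinity k 2)}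
    (h : (infinityExpansion k).toFun _ infinityExpansion_isIsoOn_inf.mem c =
      PowerSeries.C ((coord k ^ (-1 : ℤ) : (Coord k)ˣ) : Coord k)) : IsRatio k c :=
  Chart.isLimitOf_of_dvd_of_eq arcPoint_mem_support Polynomial.X_ne_zero chartOne_V chartOne_W
    top_le_arc_inf' infinityExpansion_isIsoOn_inf.mem fun n => by
      have h1 : evalSpec (arc k) _ top_le_arc_inf' (ratio k) =
          PowerSeries.C ((coord k ^ (-1 : ℤ) : (Coord k)ˣ) : Coord k) := by
        refine (evalSpec_res _ _ _ top_le_arc_two _).trans ((evalSpec_arc_frac_two 1).trans ?_)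
        rw [substArc_X_one, mul_one]
      refine (dvd_zero _).trans (dvd_of_eq ?_)
      exact (sub_eq_zero.2 (h.trans h1.symm)).symm

lemma unitsC_coord_zpow_mem (n : ℤ) :
    unitsC (coord k ^ n) ∈ (series 1 (coeffs k)).toSubmonoid.units := by
  refine unitsC_mem ((Submonoid.mem_units_iff _ _).2 ⟨?_, ?_⟩)
  · rw [coord_zpow]
    exact single_mem_coeffs _ _
  · rw [← zpow_neg, coord_zpow]
    exact single_mem_coeffs _ _

lemma substG_mem (g : G k) : substG k g ∈ (series 1 (coeffs k)).toSubmonoid.units := by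
  have h : ∀ g : G k, (substG k g : PowerSeries (Coord k)) ∈ series 1 (coeffs k) := by
    intro g n
    rcases eq_or_ne n 0 with rfl | hn
    · refine ⟨1, one_mem _, ?_⟩
      rw [PowerSeries.coeff_zero_eq_constantCoeff_apply, constantCoeff_substG, pow_zero, one_mul]
    · exact mem_piece.1 (between_le n (coeff_substG_mem g hn))
  refine (Submonoid.mem_units_iff _ _).2 ⟨h g, ?_⟩
  rw [← map_inv]
  exact h g⁻¹

/-- The Picard group of the formal completion. -/
theorem exists_formal_pic_equiv : ∃ e : Pic (formalSheaf k) ≃* Multiplicative ℤ × G k,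
    ∃ r : (fn (formalSheaf k) (chartInfinity k 1 ⊓ chartInfinity k 2))ˣ, IsRatio k r ∧
      ∀ (n : ℤ) (g : G k), ∃ c, IsValue k g.1 c ∧
        (e.symm (Multiplicative.ofAdd n, g)).HasTransition (chartInfinity k 1) (chartInfinity k 2)
          ((r ^ n : (fn (formalSheaf k) (chartInfinity k 1 ⊓ chartInfinity k 2))ˣ) * c) := by
  -- The function `x / y` expands to `v⁻¹`, while `exists_decomposition` works with powers of `v`.
  -- This is why the sign of the integer changes below.
  let ρ : Multiplicative ℤ × G k →* (PowerSeries (Coord k))ˣ :=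
    (unitsC.comp (zpowersHom _ (coord k)⁻¹)).coprod (substG k)
  have hρ : ∀ n g, ρ (n, g) = unitsC (coord k ^ (-n.toAdd)) * substG k g := fun n g => by
    rw [zpow_neg, ← inv_zpow]
    rfl
  obtain ⟨τ, e, hτ, he⟩ := exists_pic_equiv_of_expansion (chartInfinity_sup k)
    infinityExpansion_isIsoOn_one infinityExpansion_isIsoOn_two infinityExpansion_isIsoOn_inf
    ((chartOne k).exists_isFrame_formal (hj := arcPoint_mem_support))
    ((chartTwo k).exists_isFrame_formal (hj := arcPoint_mem_support)) ρ
    (fun t => by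
      rw [hρ t.1 t.2]
      exact mul_mem (unitsC_coord_zpow_mem _) (substG_mem _))
    (fun u hu => by
      obtain ⟨n, g, a, c, h, ha, hc⟩ := exists_decomposition hu
      refine ⟨(Multiplicative.ofAdd (-n), g), a, ha, c, hc, ?_⟩
      rw [hρ, toAdd_ofAdd, neg_neg]
      exact h)
    (fun t a ha c hc h => by
      rw [hρ t.1 t.2] at h
      obtain ⟨h1, h2⟩ := eq_one_of_decomposition ha hc h
      exact Prod.ext (toAdd_eq_zero.1 (neg_eq_zero.1 h1)) h2)
  refine ⟨e, τ (Multiplicative.ofAdd 1, 1), isRatio_of_expansion_eq ?_, fun n g =>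
    ⟨τ (1, g), isValue_of_expansion_eq ?_, ?_⟩⟩
  · rw [hτ, hρ, map_one (substG k), mul_one]
    rfl
  · rw [hτ, hρ, toAdd_one, neg_zero, zpow_zero, map_one, one_mul, coe_substG]
  · have h : (Multiplicative.ofAdd n, g) =
        ((Multiplicative.ofAdd (1 : ℤ), 1) : Multiplicative ℤ × G k) ^ n * (1, g) := by
      refine Prod.ext ?_ ?_
      · change Multiplicative.ofAdd n = Multiplicative.ofAdd (1 : ℤ) ^ n * 1
        rw [mul_one, ← ofAdd_zsmul, smul_eq_mul, mul_one]
      · simp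
    have h1 := he (Multiplicative.ofAdd n, g)
    rw [← map_zpow, ← Units.val_mul, ← map_mul, ← h]
    exact h1

section punctured

variable (Ψ : PuncturedExpansion (arcPoint_mem_support (k := k)))

lemma puncturedExpansion_isIsoOn_one :
    (Chart.puncturedExpansion Ψ).IsIsoOn (chartInfinity k 1) (laurent 1 (coeffsLeft k)) := by
  have h := (chartOne k).puncturedExpansion_isIsoOn Ψ one_ne_zero
  rw [chartOne_W_one] at h
  exact h

lemma puncturedExpansion_isIsoOn_two :
    (Chart.puncturedExpansion Ψ).IsIsoOn (chartInfinity k 2)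
      (laurent (coord k ^ (-1 : ℤ)) (coeffsRight k)) := by
  have h := (chartTwo k).puncturedExpansion_isIsoOn Ψ one_ne_zero
  rw [chartTwo_W_one] at h
  exact h

lemma puncturedExpansion_isIsoOn_inf :
    (Chart.puncturedExpansion Ψ).IsIsoOn (chartInfinity k 1 ⊓ chartInfinity k 2)
      (laurent 1 (coeffs k)) := by
  have h := (chartOne k).puncturedExpansion_isIsoOn Ψ Polynomial.X_ne_zero
  rw [chartOne_W] at h
  exact h

end punctured

/-- The Picard group of the punctured formal neighbourhood. -/
theorem exists_punctured_pic_equiv : ∃ e : Pic (formalPuncturedSheaf k) ≃* G k,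
    ∀ g : G k, ∃ c, IsValue k g.1 c ∧
      (e.symm g).HasTransition (chartInfinity k 1) (chartInfinity k 2) (restrictPunctured k c) := by
  obtain ⟨Ψ⟩ := nonempty_puncturedExpansion
    (Chart.isTransversal (𝒞 := chartOne k) arcPoint_mem_support)
  obtain ⟨τ, e, hτ, he⟩ := exists_pic_equiv_of_expansion (chartInfinity_sup k)
    (puncturedExpansion_isIsoOn_one Ψ) (puncturedExpansion_isIsoOn_two Ψ)
    (puncturedExpansion_isIsoOn_inf Ψ) ((chartOne k).exists_isFrame_punctured Ψ)
    ((chartTwo k).exists_isFrame_punctured Ψ) (unitsCoe.comp (substG k))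
    (fun g => unitsCoe_mem (ω := 1) (substG_mem g))
    (fun u hu => by
      obtain ⟨g, a, c, h, ha, hc⟩ := exists_decomposition_laurent hu
      exact ⟨g, a, ha, c, hc, h⟩)
    (fun g a ha c hc h => eq_one_of_decomposition_laurent ha hc h)
  refine ⟨e, fun g => ?_⟩
  -- The transition function is the restriction of a function on the unpunctured completion: both
  -- have the expansion of `g`, and expansions on the punctured overlap are injective.
  obtain ⟨c, hc⟩ := infinityExpansion_isIsoOn_inf.mem_units_iff.1 (substG_mem g)
  refine ⟨c, isValue_of_expansion_eq hc, ?_⟩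
  have h : restrictPunctured k c = τ g := by
    refine (puncturedExpansion_isIsoOn_inf Ψ).injective (Eq.trans ?_ (hτ g).symm)
    refine (Ψ.toFun_toPuncturedHom _ (puncturedExpansion_isIsoOn_inf Ψ).mem _).trans ?_
    exact congrArg _ hc
  rw [h]
  exact he g

end ProjPlane

end

theorem mainTheorem10 (k : Type*) [Field k] :
    (∃ e : SheafPic.Pic (ProjPlane.formalSheaf k) ≃* Multiplicative ℤ × ProjPlane.G k,
      ∃ r : (SheafPic.fn (ProjPlane.formalSheaf k)
          (ProjPlane.chartInfinity k 1 ⊓ ProjPlane.chartInfinity k 2))ˣ,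
        ProjPlane.IsRatio k r ∧
        ∀ (n : ℤ) (g : ProjPlane.G k), ∃ c, ProjPlane.IsValue k g.1 c ∧
          (e.symm (Multiplicative.ofAdd n, g)).HasTransition
            (ProjPlane.chartInfinity k 1) (ProjPlane.chartInfinity k 2)
            ((r ^ n : (SheafPic.fn (ProjPlane.formalSheaf k)
              (ProjPlane.chartInfinity k 1 ⊓ ProjPlane.chartInfinity k 2))ˣ) * c)) ∧
    (∃ e' : SheafPic.Pic (ProjPlane.formalPuncturedSheaf k) ≃* ProjPlane.G k,
      ∀ g : ProjPlane.G k, ∃ c, ProjPlane.IsValue k g.1 c ∧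
        (e'.symm g).HasTransition
          (ProjPlane.chartInfinity k 1) (ProjPlane.chartInfinity k 2)
          (ProjPlane.restrictPunctured k c)) :=
  ⟨ProjPlane.exists_formal_pic_equiv, ProjPlane.exists_punctured_pic_equiv⟩
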